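/- Let $\mathcal H$ be a finite-dimensional complex Hilbert space and let $\Phi$ be a quantum channel on $\mathcal B(\mathcal H)$, i.e. a completely positive trace-preserving linear map $\mathcal B(\mathcal H)\to\mathcal B(\mathcal H)$. Let $$\mathrm{Attr}(\Phi)=\mathrm{span}\{X\in\mathcal B(\mathcal H) : \Phi(X)=\lambda X \text{ for some } \lambda\in\mathbb C,\ |\lambda|=1\}$$ be its attractor subspace, let $\hat\Phi_P=\Phi|_{\mathrm{Attr}(\Phi)}:\mathrm{Attr}(\Phi)\to\mathrm{Attr}(\Phi)$ be its asymptotic map, and let $\mathcal H_0=\mathrm{Ran}\,\mathcal P(\mathbb I)$, where $\mathcal P$ is the eigenprojection of $\Phi$ for the eigenvalue $1$ (the projection onto the generalized eigenspace for $1$ along the sum of the other generalized eigenspaces). Then there exist $L\ge 0$, integers $m_\ell\ge 1$, nonzero finite-dimensional Hilbert spaces $\mathcal H_1^{(\ell)}$ and $\mathcal H_{k,2}^{(\ell)}$ ($1\le\ell\le L$, $1\le k\le m_\ell$), and a decomposition (up to a unitary identification) $$\mathcal H=\mathcal H_0^{\perp}\oplus\bigoplus_{\ell=1}^{L}\Bigl(\mathcal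 H_1^{(\ell)}\otimes\bigl(\textstyle\bigoplus_{k=1}^{m_\ell}\mathcal H_{k,2}^{(\ell)}\bigr)\Bigr),$$ together with positive definite density operators $\rho_k^{(\ell)}$ on $\mathcal H_{k,2}^{(\ell)}$, unitaries $U_\ell$ on $\mathcal H_1^{(\ell)}$ and $m_\ell$-cycles $\pi_\ell$ on $\{1,\dots,m_\ell\}$ (a $1$-cycle being the identity), such that, with respect to this decomposition, $$\mathrm{Attr}(\Phi)=0\oplus\bigoplus_{\ell=1}^{L}\Bigl(\mathcal B(\mathcal H_1^{(\ell)})\otimes\bigl(\textstyle\bigoplus_{k=1}^{m_\ell}\mathbb C\rho_k^{(\ell)}\bigr)\Bigr)$$ and, for every $X=0\oplus\bigoplus_\ell X_\ell\in\mathrm{Attr}(\Phi)$, $$\hat\Phi_P(X)=0\oplus\bigoplus_{\ell=1}^{L}(\Phi_{U_\ell}\otimes\Phi_{\pi_\ell})(X_\ell).$$ Here $\Phi_{U_\ell}(Y)=U_\ell YU_\ell^\dagger$ for $Y\in\mathcal B(\mathcal H_1^{(\ell)})$, and $$\Phi_{\pi_\ell}(Z)=\bigoplus_{k=1}^{m_\ell}\mathrm{tr}\bigl(Q^{(\ell)}_{\pi_\ell(k)}Z\bigr)\rho_k^{(\ell)},\qquad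 Z\in\mathcal B\bigl(\textstyle\bigoplus_{k}\mathcal H_{k,2}^{(\ell)}\bigr),$$ with $Q_k^{(\ell)}$ the orthogonal projection onto $\mathcal H_{k,2}^{(\ell)}$. Both $\Phi_{U_\ell}$ and $\Phi_{\pi_\ell}$ are quantum channels, and, writing $\hat\rho_k^{(\ell)}=0\oplus\dots\oplus\rho_k^{(\ell)}\oplus\dots\oplus 0$, one has $\Phi_{\pi_\ell}(\hat\rho^{(\ell)}_{\pi_\ell(k)})=\hat\rho^{(\ell)}_{k}$ for all $k$. -/

import Mathlib

open scoped CStarAlgebra Kronecker ComplexOrder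

noncomputable section

namespace QChannel

/-- The algebra `B(H)` of bounded operators on a Hilbert space. -/
abbrev Op (H : Type*) [NormedAddCommGroup H] [InnerProductSpace ℂ H] := H →L[ℂ] H

section Channels

variable {H : Type*} [NormedAddCommGroup H] [InnerProductSpace ℂ H] [CompleteSpace H]

/-- A quantum channel (in the Schroedinger picture): a completely positive, trace-preserving linear
map on `B(H)`. -/
structure IsQuantumChannel (Φ : Op H →ₗ[ℂ] Op H) : Prop where
  completelyPositive : ∃ Ψ : Op H →CP Op H, Ψ.toLinearMap = Φ
  tracePreserving : ∀ X : Op H,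
    LinearMap.trace ℂ H (Φ X : H →ₗ[ℂ] H) = LinearMap.trace ℂ H (X : H →ₗ[ℂ] H)

end Channels

section Spectral

variable {V : Type*} [AddCommGroup V] [Module ℂ V]

/-- The eigenvalues of unit modulus. -/
def peripheralSpectrum (Φ : V →ₗ[ℂ] V) : Set ℂ :=
  {μ | Module.End.HasEigenvalue Φ μ ∧ ‖μ‖ = 1}

/-- The attractor subspace: the span of the eigenspaces for the peripheral eigenvalues. -/
def attr (Φ : V →ₗ[ℂ] V) : Submodule ℂ V :=
  ⨆ μ ∈ peripheralSpectrum Φ, Module.End.eigenspace Φ μ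

theorem map_mem_attr (Φ : V →ₗ[ℂ] V) : ∀ X ∈ attr Φ, Φ X ∈ attr Φ := by
  have h : attr Φ ≤ (attr Φ).comap Φ := by
    refine iSup₂_le fun μ hμ X hX => ?_
    have hX' : X ∈ attr Φ :=
      (le_iSup₂ (f := fun ν (_ : ν ∈ peripheralSpectrum Φ) => Module.End.eigenspace Φ ν) μ hμ) hX
    rw [Submodule.mem_comap, Module.End.mem_eigenspace_iff.mp hX]
    exact (attr Φ).smul_mem μ hX'
  exact h

/-- The asymptotic map: the restriction of `Φ` to its attractor subspace. -/
def asymptoticMap (Φ : V →ₗ[ℂ] V) : attr Φ →ₗ[ℂ] attr Φ :=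
  Φ.restrict (map_mem_attr Φ)

theorem isCompl_maxGenEigenspace [FiniteDimensional ℂ V] (Φ : V →ₗ[ℂ] V) (μ : ℂ) :
    IsCompl (Module.End.maxGenEigenspace Φ μ)
      (⨆ ν, ⨆ _ : ν ≠ μ, Module.End.maxGenEigenspace Φ ν) := by
  refine ⟨Module.End.independent_maxGenEigenspace Φ μ, codisjoint_iff.mpr ?_⟩
  rw [eq_top_iff, ← Module.End.iSup_maxGenEigenspace_eq_top Φ]
  refine iSup_le fun ν => ?_
  by_cases h : ν = μ
  · subst h
    exact le_sup_left
  · exact le_sup_of_le_right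
      (le_iSup₂ (f := fun ν (_ : ν ≠ μ) => Module.End.maxGenEigenspace Φ ν) ν h)

/-- The eigenprojection of `Φ` for `μ` in the spectral (Jordan) decomposition: the projection onto
the generalized eigenspace for `μ` along the sum of all the other generalized eigenspaces. -/
def eigenprojection [FiniteDimensional ℂ V] (Φ : V →ₗ[ℂ] V) (μ : ℂ) : V →ₗ[ℂ] V :=
  Submodule.projection _ _ (isCompl_maxGenEigenspace Φ μ)

end Spectral

section Support

variable {H : Type*} [NormedAddCommGroup H] [InnerProductSpace ℂ H] [FiniteDimensional ℂ H]

/-- `H₀ = supp 𝒫(𝕀) = Ran 𝒫(𝕀)`, with `𝒫` the eigenprojection of `Φ` for the eigenvalue `1`. -/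
def recurrentSpace (Φ : Op H →ₗ[ℂ] Op H) : Submodule ℂ H :=
  LinearMap.range ((eigenprojection Φ 1 (1 : Op H) : Op H) : H →ₗ[ℂ] H)

end Support

section Matrices

/-- `Φ ⊗ Ψ` for linear maps on matrix algebras, determined by
`(Φ ⊗ Ψ) (A ⊗ₖ B) = Φ A ⊗ₖ Ψ B`. -/
def tensorMap {a b : Type*} [Fintype a] [Fintype b] [DecidableEq a] [DecidableEq b]
    (Φ : Matrix a a ℂ →ₗ[ℂ] Matrix a a ℂ) (Ψ : Matrix b b ℂ →ₗ[ℂ] Matrix b b ℂ) :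
    Matrix (a × b) (a × b) ℂ →ₗ[ℂ] Matrix (a × b) (a × b) ℂ :=
  (kroneckerLinearEquiv a a b b ℂ).conj (TensorProduct.map Φ Ψ)

theorem tensorMap_kronecker {a b : Type*} [Fintype a] [Fintype b] [DecidableEq a] [DecidableEq b]
    (Φ : Matrix a a ℂ →ₗ[ℂ] Matrix a a ℂ) (Ψ : Matrix b b ℂ →ₗ[ℂ] Matrix b b ℂ)
    (A : Matrix a a ℂ) (B : Matrix b b ℂ) :
    tensorMap Φ Ψ (A ⊗ₖ B) = Φ A ⊗ₖ Ψ B := by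
  rw [tensorMap, LinearEquiv.conj_apply_apply, ← kroneckerLinearEquiv_tmul,
    LinearEquiv.symm_apply_apply, TensorProduct.map_tmul, kroneckerLinearEquiv_tmul]

/-- A linear map on `ι × ι` matrices, read as a linear map on `B(ℂ^ι)`. -/
def onOperators {ι : Type*} [Fintype ι] [DecidableEq ι]
    (T : Matrix ι ι ℂ →ₗ[ℂ] Matrix ι ι ℂ) :
    Op (EuclideanSpace ℂ ι) →ₗ[ℂ] Op (EuclideanSpace ℂ ι) :=
  (Matrix.toEuclideanCLM (n := ι) (𝕜 := ℂ)).toAlgEquiv.toLinearEquiv.conj T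

/-- The unitary channel `Y ↦ U Y U†`. -/
def unitaryChannel {ι : Type*} [Fintype ι] [DecidableEq ι] (U : Matrix.unitaryGroup ι ℂ) :
    Matrix ι ι ℂ →ₗ[ℂ] Matrix ι ι ℂ :=
  LinearMap.mulLeftRight ℂ ((U : Matrix ι ι ℂ), (U : Matrix ι ι ℂ).conjTranspose)

/-- A density matrix that is positive definite. -/
def IsFaithfulState {ι : Type*} [Fintype ι] (ρ : Matrix ι ι ℂ) : Prop :=
  ρ.PosDef ∧ ρ.trace = 1

section Cycle

variable {m : ℕ} {n : Fin m → ℕ}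

/-- The orthogonal projection of `⨁ₖ ℂ^(n k)` onto its `k`-th summand. -/
def blockProj (n : Fin m → ℕ) (k : Fin m) : Matrix (Σ j, Fin (n j)) (Σ j, Fin (n j)) ℂ :=
  Matrix.diagonal fun i => if i.1 = k then 1 else 0

/-- `0 ⊕ ⋯ ⊕ ρₖ ⊕ ⋯ ⊕ 0`, as an operator on `⨁ₖ ℂ^(n k)`. -/
def hatState (ρ : ∀ k, Matrix (Fin (n k)) (Fin (n k)) ℂ) (k : Fin m) :
    Matrix (Σ j, Fin (n j)) (Σ j, Fin (n j)) ℂ :=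
  Matrix.blockDiagonal' (Pi.single k (ρ k))

/-- The subspace `⨁ₖ ℂ ρₖ` of `B(⨁ₖ ℂ^(n k))`. -/
def statesSpan (ρ : ∀ k, Matrix (Fin (n k)) (Fin (n k)) ℂ) :
    Submodule ℂ (Matrix (Σ j, Fin (n j)) (Σ j, Fin (n j)) ℂ) :=
  Submodule.span ℂ (Set.range (hatState ρ))

/-- The map `Z ↦ ⨁ₖ tr(Q_{π(k)} Z) ρₖ` on `B(⨁ₖ ℂ^(n k))`. -/
def permChannel (ρ : ∀ k, Matrix (Fin (n k)) (Fin (n k)) ℂ) (π : Equiv.Perm (Fin m)) :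
    Matrix (Σ j, Fin (n j)) (Σ j, Fin (n j)) ℂ →ₗ[ℂ]
      Matrix (Σ j, Fin (n j)) (Σ j, Fin (n j)) ℂ where
  toFun Z := Matrix.blockDiagonal' fun k => (blockProj n (π k) * Z).trace • ρ k
  map_add' Z W := by
    rw [← Matrix.blockDiagonal'_add]
    congr 1
    funext k
    simp [mul_add, add_smul]
  map_smul' c Z := by
    rw [RingHom.id_apply, ← Matrix.blockDiagonal'_smul]
    congr 1
    funext k
    simp [mul_smul]

/-- The subspace `B(ℂ^d) ⊗ (⨁ₖ ℂ ρₖ)` of `B(ℂ^d ⊗ ⨁ₖ ℂ^(n k))`. -/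
def cycleSpace (d : ℕ) (ρ : ∀ k, Matrix (Fin (n k)) (Fin (n k)) ℂ) :
    Submodule ℂ (Matrix (Fin d × Σ j, Fin (n j)) (Fin d × Σ j, Fin (n j)) ℂ) :=
  Submodule.span ℂ {X | ∃ A : Matrix (Fin d) (Fin d) ℂ, ∃ R ∈ statesSpan ρ, X = A ⊗ₖ R}

end Cycle

section Blocks

variable {L : ℕ} (d₀ : ℕ) (d m : Fin L → ℕ) (n : ∀ ℓ, Fin (m ℓ) → ℕ)

/-- Labels of the standard orthonormal basis of
`ℂ^d₀ ⊕ ⨁_ℓ (ℂ^(d ℓ) ⊗ ⨁ₖ ℂ^(n ℓ k))`. An orthonormal basis of `H` with these labels is the same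
as a unitary identification of `H` with this space. -/
abbrev Label := Fin d₀ ⊕ Σ ℓ, Fin (d ℓ) × Σ k, Fin (n ℓ k)

variable {d m n}

/-- The operator `0 ⊕ ⨁_ℓ X ℓ` on `ℂ^d₀ ⊕ ⨁_ℓ (ℂ^(d ℓ) ⊗ ⨁ₖ ℂ^(n ℓ k))`. -/
def zeroPlus (X : ∀ ℓ, Matrix (Fin (d ℓ) × Σ k, Fin (n ℓ k)) (Fin (d ℓ) × Σ k, Fin (n ℓ k)) ℂ) :
    Matrix (Label d₀ d m n) (Label d₀ d m n) ℂ :=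
  Matrix.fromBlocks 0 0 0 (Matrix.blockDiagonal' X)

end Blocks

/-- The matrix of an operator on `H` in an orthonormal basis. -/
def mat {ι H : Type*} [Fintype ι] [DecidableEq ι] [NormedAddCommGroup H] [InnerProductSpace ℂ H]
    (b : OrthonormalBasis ι ℂ H) (X : Op H) : Matrix ι ι ℂ :=
  LinearMap.toMatrix b.toBasis b.toBasis (X : H →ₗ[ℂ] H)

end Matrices

end QChannel

end

/-!
# Attractor subspace and asymptotic map of a quantum channel

Write `Φ X = ∑ᵢ Kᵢ X Kᵢ†` (Choi's theorem, `IsQuantumChannel.exists_krausMap`). The orbits of `Φ`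
are bounded, so its eigenprojection for the eigenvalue `1` is the limit of the Cesàro means of the
iterates (`tendsto_cesaro`). A peripheral eigenvector `X` is dominated, as an off-diagonal block,
by `‖X‖` times the identity; averaging the iterates, it is dominated by `‖X‖ σ`, with `σ` the
ergodic mean of the identity (`dominated_eigenprojection`). Hence `X` lives on the recurrent space
`H₀ = Ran σ`, which the `Kᵢ` leave invariant (`kraus_mem_range`), and everything reduces to the
compressed channel on `H₀`, which has an invertible invariant state.

For such a channel let `τ` be the ergodic mean of the identity, again positive, invertible and
fixed. Equality in the Schwarz inequality shows that the eigenvectors for `|μ| = 1` are the `x τ`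
with `Kᵢ x = μ x Kᵢ` and `Kᵢ† x = μ̄ x Kᵢ†` (`exists_twisted_of_eigenvector`). These `x` are the
homogeneous elements of a *-algebra graded by the phases `μ`, every element of which commutes with
`τ`. Its degree-one part is the commutant of the Kraus operators, so `1` is an orthogonal sum of
minimal projections `f` of that commutant. By Schur's lemma the corner at such an `f` has
dimension at most one in each degree, and the degrees which occur form a finite, hence cyclic,
group: the corner is the group algebra of `ℤ/m`, generated by a unitary `u` with `Kᵢ u = ω u Kᵢ`
on the range of `f`, where `ω` is a primitive `m`-th root of unity (`exists_cyclic_unitary`). The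
spectral projections `q₀, …, qₘ₋₁` of `u` satisfy `Kᵢ qₖ₊₁ = qₖ Kᵢ`; this is the cyclic
permutation (`exists_cyclic_projections`).

Two minimal projections are linked by a homogeneous partial isometry, of some phase, or not at
all. Choosing a representative `f` of each class `ℓ` and isometries `vₐ`, of phases `θₐ`, from the
range of `f` to those of the members of the class, the operators `vₐ qₖ v_b†` span the graded
algebra (`exists_cyclicFrame`) and `Φ (vₐ qₖ₊₁ v_b† τ) = θₐ θ̄_b vₐ qₖ v_b† τ`
(`CyclicFrame.krausMap_unit_mul_of_fixed`). The vectors `vₐ φ`, with `φ` in an orthonormal basis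
of the range of `qₖ`, form an orthonormal basis in which `vₐ qₖ v_b† τ` is `|a⟩⟨b|` tensored with
the `k`-th block of `τ` (`CyclicFrame.mat_unit_mul`). Trace preservation makes these blocks have a
trace independent of `k`, by which they are normalised to the states `ρₖ`, and `U` is the diagonal
matrix of the `θₐ` (`exists_normal_form_of_isUnit`).
-/

namespace QChannel

/-! ### Kraus operators -/

section Kraus

variable {H : Type*} [NormedAddCommGroup H] [InnerProductSpace ℂ H]

theorem mul_rankOne (A : Op H) (x y : H) :
    A * InnerProductSpace.rankOne ℂ x y = InnerProductSpace.rankOne ℂ (A x) y :=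
  InnerProductSpace.comp_rankOne x y A

theorem trace_rankOne [FiniteDimensional ℂ H] (x y : H) :
    LinearMap.trace ℂ H (InnerProductSpace.rankOne ℂ x y : Op H) = inner ℂ y x := by
  rw [LinearMap.trace_eq_sum_inner _ (stdOrthonormalBasis ℂ H)]
  simp only [ContinuousLinearMap.coe_coe, InnerProductSpace.rankOne_apply, inner_smul_right]
  exact (stdOrthonormalBasis ℂ H).sum_inner_mul_inner y x

theorem eq_sum_rankOne [FiniteDimensional ℂ H] {ι : Type*} [Fintype ι]
    (b : OrthonormalBasis ι ℂ H) (X : Op H) :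
    X = ∑ j, ∑ k, (inner ℂ (b j) (X (b k)) : ℂ) •
      (InnerProductSpace.rankOne ℂ (b j) (b k) : Op H) := by
  ext v
  simp only [_root_.sum_apply, _root_.smul_apply,
    InnerProductSpace.rankOne_apply]
  conv_lhs => rw [← b.sum_repr' v]
  rw [map_sum, Finset.sum_comm]
  refine Finset.sum_congr rfl fun k _ => ?_
  rw [map_smul]
  conv_lhs => rw [← b.sum_repr' (X (b k))]
  rw [Finset.smul_sum]
  exact Finset.sum_congr rfl fun j _ => smul_comm _ _ _

variable [CompleteSpace H]
variable {κ : Type*} [Fintype κ]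

/-- The map `X ↦ ∑ᵢ Kᵢ X Kᵢ†` with Kraus operators `Kᵢ`. -/
noncomputable def krausMap (K : κ → Op H) : Op H →ₗ[ℂ] Op H :=
  ∑ i, LinearMap.mulLeftRight ℂ (K i, star (K i))

theorem krausMap_apply (K : κ → Op H) (X : Op H) :
    krausMap K X = ∑ i, K i * X * star (K i) := by
  simp [krausMap, LinearMap.sum_apply]

theorem star_krausMap (K : κ → Op H) (X : Op H) :
    star (krausMap K X) = krausMap K (star X) := by
  simp [krausMap_apply, mul_assoc]

theorem trace_krausMap [FiniteDimensional ℂ H] (K : κ → Op H)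
    (hK : ∑ i, star (K i) * K i = 1) (X : Op H) :
    LinearMap.trace ℂ H (krausMap K X : Op H) = LinearMap.trace ℂ H (X : H →ₗ[ℂ] H) := by
  have h1 : ((krausMap K X : Op H) : H →ₗ[ℂ] H)
      = ∑ i, (K i : H →ₗ[ℂ] H) * ((X : H →ₗ[ℂ] H) * ((star (K i) : Op H) : H →ₗ[ℂ] H)) := by
    rw [krausMap_apply]
    ext v
    simp [LinearMap.sum_apply]
  have h2 : (X : H →ₗ[ℂ] H)
      = ∑ i, (X : H →ₗ[ℂ] H) * ((star (K i) : Op H) : H →ₗ[ℂ] H) * (K i : H →ₗ[ℂ] H) := by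
    conv_lhs => rw [← mul_one X, ← hK]
    ext v
    simp [LinearMap.sum_apply]
  rw [h1, h2]
  simp only [map_sum]
  rw [← h2]
  exact Finset.sum_congr rfl fun i _ => LinearMap.trace_mul_comm _ _ _

theorem exists_eq_star_mul_self {A : Type*} [NonUnitalCStarAlgebra A] [PartialOrder A]
    [StarOrderedRing A] {a : A} (ha : 0 ≤ a) : ∃ b, a = star b * b :=
  CStarAlgebra.nonneg_iff_eq_star_mul_self.mp ha

theorem isQuantumChannel_krausMap [FiniteDimensional ℂ H] (K : κ → Op H)
    (hK : ∑ i, star (K i) * K i = 1) : IsQuantumChannel (krausMap K) := by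
  refine ⟨⟨⟨krausMap K, fun k M hM => ?_⟩, rfl⟩, trace_krausMap K hK⟩
  obtain ⟨B, rfl⟩ := exists_eq_star_mul_self hM
  have : (star B * B).map (krausMap K)
      = ∑ i, star (B.map (· * star (K i))) * (B.map (· * star (K i))) := by
    ext1 a b
    have hsum : ∀ (f : κ → CStarMatrix (Fin k) (Fin k) (Op H)), (∑ i, f i) a b = ∑ i, f i a b := by
      intro f
      exact Matrix.sum_apply a b Finset.univ f
    rw [hsum]
    simp only [CStarMatrix.map_apply, CStarMatrix.mul_apply, CStarMatrix.star_apply,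
      krausMap_apply, Finset.mul_sum, Finset.sum_mul, star_mul, star_star, mul_assoc]
  rw [this]
  exact Finset.sum_nonneg fun i _ => star_mul_self_nonneg _

theorem rankOne_mul (A : Op H) (x y : H) :
    InnerProductSpace.rankOne ℂ x y * A = InnerProductSpace.rankOne ℂ x (star A y) :=
  InnerProductSpace.rankOne_comp x y A

theorem star_rankOne (x y : H) :
    star (InnerProductSpace.rankOne ℂ x y : Op H) = InnerProductSpace.rankOne ℂ y x :=
  InnerProductSpace.adjoint_rankOne x y

/-- Choi's theorem: the Choi matrix `(Φ |bⱼ⟩⟨bₖ|)ⱼₖ` is positive, and any factorization of it as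
`M† M` provides Kraus operators. -/
theorem IsQuantumChannel.exists_krausMap [FiniteDimensional ℂ H] {Φ : Op H →ₗ[ℂ] Op H}
    (hΦ : IsQuantumChannel Φ) :
    ∃ (κ : Type) (_ : Fintype κ) (K : κ → Op H),
      Φ = krausMap K ∧ ∑ i, star (K i) * K i = 1 := by
  obtain ⟨⟨Ψ, rfl⟩, hT⟩ := hΦ
  set n := Module.finrank ℂ H
  set b := stdOrthonormalBasis ℂ H
  let C : CStarMatrix (Fin n) (Fin n) (Op H) := CStarMatrix.ofMatrix
    (Matrix.of fun j k => InnerProductSpace.rankOne ℂ (b j) (b k))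
  have hC : 0 ≤ C := by
    let D : CStarMatrix (Fin n) (Fin n) (Op H) := CStarMatrix.ofMatrix
      (Matrix.of fun j k => ((Real.sqrt n : ℂ))⁻¹ • InnerProductSpace.rankOne ℂ (b j) (b k))
    have : C = star D * D := by
      ext1 j k
      have hn : (n : ℂ) ≠ 0 := by
        have := j.pos
        exact_mod_cast this.ne'
      have hs : ((Real.sqrt n : ℂ))⁻¹ * ((Real.sqrt n : ℂ))⁻¹ = (n : ℂ)⁻¹ := by
        rw [← mul_inv, ← Complex.ofReal_mul, Real.mul_self_sqrt (Nat.cast_nonneg n)]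
        simp
      simp only [CStarMatrix.mul_apply, CStarMatrix.star_apply, C, D, CStarMatrix.ofMatrix_apply,
        Matrix.of_apply, star_smul, star_rankOne, smul_mul_smul_comm, mul_rankOne,
        InnerProductSpace.rankOne_apply, b.inner_eq_one]
      simp [hs, hn, ← Nat.cast_smul_eq_nsmul ℂ]
    rw [this]
    exact star_mul_self_nonneg D
  obtain ⟨M, hM⟩ := exists_eq_star_mul_self (Ψ.map_cstarMatrix_nonneg C hC)
  have hM' : ∀ j k, Ψ (InnerProductSpace.rankOne ℂ (b j) (b k)) = ∑ l, star (M l j) * M l k := by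
    intro j k
    have := congrArg (fun A : CStarMatrix (Fin n) (Fin n) (Op H) => A j k) hM
    simpa [CStarMatrix.mul_apply, CStarMatrix.star_apply, C] using this
  let K : Fin n × Fin n → Op H := fun p =>
    ∑ j, InnerProductSpace.rankOne ℂ (star (M p.1 j) (b p.2)) (b j)
  have hone : ∑ s, (InnerProductSpace.rankOne ℂ (b s) (b s) : Op H) = 1 := by
    conv_rhs => rw [eq_sum_rankOne b (1 : Op H)]
    simp [orthonormal_iff_ite.mp b.orthonormal]
  have hKraus : Ψ.toLinearMap = krausMap K := by
    ext1 X
    have hX := eq_sum_rankOne b X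
    have h1 : Ψ.toLinearMap X = ∑ j, ∑ k, (inner ℂ (b j) (X (b k)) : ℂ) •
        ∑ l, star (M l j) * M l k := by
      conv_lhs => rw [hX]
      simp only [map_sum, map_smul]
      refine Finset.sum_congr rfl fun j _ => Finset.sum_congr rfl fun k _ => ?_
      exact congrArg _ (hM' j k)
    rw [h1, krausMap_apply, Fintype.sum_prod_type]
    have h2 : ∀ l s, K (l, s) * X * star (K (l, s)) = ∑ j, ∑ k, (inner ℂ (b j) (X (b k)) : ℂ) •
        (star (M l j) * InnerProductSpace.rankOne ℂ (b s) (b s) * M l k) := by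
      intro l s
      simp only [K, star_sum, star_rankOne, Finset.sum_mul, Finset.mul_sum, rankOne_mul,
        mul_rankOne, InnerProductSpace.rankOne_apply]
      rw [Finset.sum_comm]
      refine Finset.sum_congr rfl fun j _ => Finset.sum_congr rfl fun k _ => ?_
      rw [ContinuousLinearMap.star_eq_adjoint X, ContinuousLinearMap.adjoint_inner_left, map_smul]
      rfl
    simp only [h2]
    calc _ = ∑ j, ∑ k, ∑ l, ∑ s, (inner ℂ (b j) (X (b k)) : ℂ) •
        (star (M l j) * InnerProductSpace.rankOne ℂ (b s) (b s) * M l k) := by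
          refine Finset.sum_congr rfl fun j _ => Finset.sum_congr rfl fun k _ => ?_
          rw [Finset.smul_sum]
          refine Finset.sum_congr rfl fun l _ => ?_
          rw [← Finset.smul_sum, ← Finset.sum_mul, ← Finset.mul_sum, hone, mul_one]
      _ = ∑ l, ∑ s, ∑ j, ∑ k, (inner ℂ (b j) (X (b k)) : ℂ) •
        (star (M l j) * InnerProductSpace.rankOne ℂ (b s) (b s) * M l k) := by
          rw [Finset.sum_congr rfl fun j _ => Finset.sum_comm]
          rw [Finset.sum_comm]
          refine Finset.sum_congr rfl fun l _ => ?_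
          rw [Finset.sum_congr rfl fun j _ => Finset.sum_comm]
          rw [Finset.sum_comm]
  refine ⟨Fin n × Fin n, inferInstance, K, hKraus, ?_⟩
  -- nondegeneracy of the trace form, tested on the operators `|x⟩⟨y|`
  ext x
  refine ext_inner_left ℂ fun y => ?_
  have h := hT (InnerProductSpace.rankOne ℂ x y)
  rw [hKraus, krausMap_apply, trace_rankOne] at h
  have h3 : ((∑ i, K i * InnerProductSpace.rankOne ℂ x y * star (K i) : Op H) : H →ₗ[ℂ] H)
      = ∑ i, ((InnerProductSpace.rankOne ℂ (K i x) (K i y) : Op H) : H →ₗ[ℂ] H) := by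
    ext v
    simp [mul_rankOne, rankOne_mul, LinearMap.sum_apply]
  rw [h3, map_sum] at h
  simp only [trace_rankOne] at h
  rw [one_apply_eq_self, ← h, _root_.sum_apply, inner_sum]
  refine Finset.sum_congr rfl fun i _ => ?_
  rw [ContinuousLinearMap.star_eq_adjoint]
  exact ContinuousLinearMap.adjoint_inner_right (K i) y (K i x)

end Kraus

section MatrixChannels

open Matrix

variable {ι : Type*} [Fintype ι] [DecidableEq ι]

theorem isQuantumChannel_onOperators {κ : Type*} [Fintype κ] (T : Matrix ι ι ℂ →ₗ[ℂ] Matrix ι ι ℂ)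
    (K : κ → Matrix ι ι ℂ) (hT : ∀ X, T X = ∑ i, K i * X * (K i)ᴴ)
    (hK : ∑ i, (K i)ᴴ * K i = 1) : IsQuantumChannel (onOperators T) := by
  have h : onOperators T = krausMap fun i => toEuclideanCLM (n := ι) (𝕜 := ℂ) (K i) := by
    ext1 X
    obtain ⟨A, rfl⟩ : ∃ A, toEuclideanCLM (n := ι) (𝕜 := ℂ) A = X :=
      (toEuclideanCLM (n := ι) (𝕜 := ℂ)).surjective X
    have : onOperators T (toEuclideanCLM (n := ι) (𝕜 := ℂ) A)
        = toEuclideanCLM (n := ι) (𝕜 := ℂ) (T A) := by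
      rw [onOperators, LinearEquiv.conj_apply_apply]
      change toEuclideanCLM (n := ι) (𝕜 := ℂ) (T ((toEuclideanCLM (n := ι) (𝕜 := ℂ)).symm
        (toEuclideanCLM (n := ι) (𝕜 := ℂ) A))) = _
      rw [StarAlgEquiv.symm_apply_apply]
    rw [this, hT, krausMap_apply, map_sum]
    refine Finset.sum_congr rfl fun i _ => ?_
    rw [map_mul, map_mul, ← map_star, star_eq_conjTranspose]
  rw [h]
  apply isQuantumChannel_krausMap
  rw [← map_one (toEuclideanCLM (n := ι) (𝕜 := ℂ)), ← hK, map_sum]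
  refine Finset.sum_congr rfl fun i _ => ?_
  rw [map_mul, ← map_star, star_eq_conjTranspose]

theorem unitaryChannel_apply (U : unitaryGroup ι ℂ) (X : Matrix ι ι ℂ) :
    unitaryChannel U X = (U : Matrix ι ι ℂ) * X * (U : Matrix ι ι ℂ)ᴴ := by
  simp [unitaryChannel]

theorem isQuantumChannel_unitaryChannel (U : unitaryGroup ι ℂ) :
    IsQuantumChannel (onOperators (unitaryChannel U)) := by
  refine isQuantumChannel_onOperators _ (fun _ : Unit => (U : Matrix ι ι ℂ)) (fun X => ?_) ?_
  · simp [unitaryChannel_apply]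
  · simpa [star_eq_conjTranspose] using UnitaryGroup.star_mul_self U

variable {m : ℕ} {n : Fin m → ℕ}

theorem permChannel_apply (ρ : ∀ k, Matrix (Fin (n k)) (Fin (n k)) ℂ) (π : Equiv.Perm (Fin m))
    (Z : Matrix (Σ j, Fin (n j)) (Σ j, Fin (n j)) ℂ) :
    permChannel ρ π Z = blockDiagonal' fun k => (blockProj n (π k) * Z).trace • ρ k := rfl

theorem trace_blockProj_mul (k : Fin m) (Z : Matrix (Σ j, Fin (n j)) (Σ j, Fin (n j)) ℂ) :
    (blockProj n k * Z).trace = ∑ j : Fin (n k), Z ⟨k, j⟩ ⟨k, j⟩ := by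
  simp only [trace, diag, blockProj, diagonal_mul, Fintype.sum_sigma]
  rw [Finset.sum_eq_single k]
  · simp
  · intro l _ hl
    simp [hl]
  · simp

theorem trace_hatState (ρ : ∀ k, Matrix (Fin (n k)) (Fin (n k)) ℂ) (k : Fin m) :
    (hatState ρ k).trace = (ρ k).trace := by
  rw [hatState, trace_blockDiagonal', Finset.sum_eq_single k]
  · rw [Pi.single_eq_same]
  · intro j _ h
    rw [Pi.single_eq_of_ne h, trace_zero]
  · simp

theorem permChannel_hatState (ρ : ∀ k, Matrix (Fin (n k)) (Fin (n k)) ℂ)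
    (hρ : ∀ k, (ρ k).trace = 1) (π : Equiv.Perm (Fin m)) (k : Fin m) :
    permChannel ρ π (hatState ρ (π k)) = hatState ρ k := by
  rw [permChannel_apply, hatState]
  congr 1
  funext l
  rw [trace_blockProj_mul]
  simp only [blockDiagonal'_apply_eq]
  by_cases h : l = k
  · subst h
    have := hρ (π l)
    simp only [trace, diag] at this
    simp [this]
  · have h' : π l ≠ π k := fun e => h (π.injective e)
    simp [h, h']

theorem isQuantumChannel_permChannel (ρ : ∀ k, Matrix (Fin (n k)) (Fin (n k)) ℂ)
    (hρ : ∀ k, IsFaithfulState (ρ k)) (π : Equiv.Perm (Fin m)) :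
    IsQuantumChannel (onOperators (permChannel ρ π)) := by
  choose M u hu using fun k => posSemidef_iff_eq_sum_vecMulVec.mp (hρ k).1.posSemidef
  let w : (Σ k, Fin (M k)) → (Σ j, Fin (n j)) → ℂ := fun t x =>
    if h : x.1 = t.1 then u t.1 t.2 (h ▸ x.2) else 0
  have hw : ∀ k, ∑ s, vecMulVec (w ⟨k, s⟩) (star (w ⟨k, s⟩)) = hatState ρ k := by
    intro k
    ext ⟨a, x⟩ ⟨b, y⟩
    rw [Matrix.sum_apply]
    simp only [w, vecMulVec_apply, Pi.star_apply, hatState, blockDiagonal'_apply]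
    by_cases ha : a = k
    · subst ha
      by_cases hb : a = b
      · subst hb
        simp [hu a, Matrix.sum_apply, vecMulVec_apply]
      · have hb' : b ≠ a := fun h => hb h.symm
        simp [hb, hb']
    · simp [ha]
  have hw' : ∀ k, ∑ s, star (w ⟨k, s⟩) ⬝ᵥ w ⟨k, s⟩ = 1 := by
    intro k
    have h1 : (hatState ρ k).trace = 1 := (trace_hatState ρ k).trans (hρ k).2
    rw [← hw k, trace_sum] at h1
    rw [← h1]
    refine Finset.sum_congr rfl fun s _ => ?_
    rw [trace_vecMulVec, dotProduct_comm]
  -- the Kraus operators `|u⟩⟨π k, j|`, with `ρ k = ∑ |u⟩⟨u|`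
  let K : (Σ k, Fin (M k) × Fin (n (π k))) → Matrix (Σ j, Fin (n j)) (Σ j, Fin (n j)) ℂ :=
    fun t => vecMulVec (w ⟨t.1, t.2.1⟩) (Pi.single ⟨π t.1, t.2.2⟩ 1)
  have hKs : ∀ t, (K t)ᴴ = vecMulVec (Pi.single ⟨π t.1, t.2.2⟩ 1) (star (w ⟨t.1, t.2.1⟩)) := by
    intro t
    simp only [K, conjTranspose_vecMulVec]
    congr 1
    ext x
    simp [Pi.single_apply, apply_ite]
  refine isQuantumChannel_onOperators _ K (fun Z => ?_) ?_
  · have h1 : ∀ t, K t * Z * (K t)ᴴ = Z ⟨π t.1, t.2.2⟩ ⟨π t.1, t.2.2⟩ •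
        vecMulVec (w ⟨t.1, t.2.1⟩) (star (w ⟨t.1, t.2.1⟩)) := by
      intro t
      rw [hKs, vecMulVec_mul, vecMulVec_mul_vecMulVec]
      ext
      simp [vecMulVec_apply]
      ring
    simp only [h1]
    rw [Fintype.sum_sigma, permChannel_apply]
    have h2 : ∀ k, ∑ t : Fin (M k) × Fin (n (π k)), Z ⟨π k, t.2⟩ ⟨π k, t.2⟩ •
        vecMulVec (w ⟨k, t.1⟩) (star (w ⟨k, t.1⟩))
        = (blockProj n (π k) * Z).trace • hatState ρ k := by
      intro k
      rw [Fintype.sum_prod_type, trace_blockProj_mul, ← hw k, Finset.smul_sum]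
      refine Finset.sum_congr rfl fun s _ => ?_
      rw [Finset.sum_smul]
    simp only [h2]
    ext ⟨a, x⟩ ⟨b, y⟩
    simp only [Matrix.sum_apply, Matrix.smul_apply, hatState, blockDiagonal'_apply, smul_eq_mul]
    by_cases h : a = b
    · subst h
      rw [Finset.sum_eq_single a]
      · simp
      · intro k _ hk
        simp [hk.symm]
      · simp
    · simp [h]
  · have h1 : ∀ t, (K t)ᴴ * K t = (star (w ⟨t.1, t.2.1⟩) ⬝ᵥ w ⟨t.1, t.2.1⟩) •
        diagonal (Pi.single ⟨π t.1, t.2.2⟩ 1) := by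
      intro t
      rw [hKs, vecMulVec_mul_vecMulVec]
      ext x y
      simp only [vecMulVec_apply, Pi.smul_apply, Matrix.smul_apply, diagonal_apply, Pi.single_apply,
        smul_eq_mul]
      split_ifs <;> simp_all
    simp only [h1]
    have h2 : ∀ k, ∑ t : Fin (M k) × Fin (n (π k)), (star (w ⟨k, t.1⟩) ⬝ᵥ w ⟨k, t.1⟩) •
        (diagonal (Pi.single ⟨π k, t.2⟩ 1) : Matrix (Σ j, Fin (n j)) (Σ j, Fin (n j)) ℂ)
        = ∑ j : Fin (n (π k)), diagonal (Pi.single ⟨π k, j⟩ 1) := by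
      intro k
      rw [Fintype.sum_prod_type_right]
      refine Finset.sum_congr rfl fun j _ => ?_
      have := hw' k
      simp only [← Finset.sum_smul, this, one_smul]
    rw [Fintype.sum_sigma]
    simp only [h2]
    rw [Equiv.sum_comp π fun k => ∑ j : Fin (n k), (diagonal (Pi.single ⟨k, j⟩ 1) :
      Matrix (Σ j, Fin (n j)) (Σ j, Fin (n j)) ℂ), ← Fintype.sum_sigma']
    ext x y
    simp only [Matrix.sum_apply, diagonal_apply, one_apply]
    split_ifs <;> simp [Pi.single_apply]

end MatrixChannels
/-! ### The mean ergodic theorem and domination -/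

section Ergodic

open Filter Topology

theorem eigenprojection_mem {V : Type*} [AddCommGroup V] [Module ℂ V] [FiniteDimensional ℂ V]
    (f : V →ₗ[ℂ] V) (μ : ℂ) (v : V) :
    eigenprojection f μ v ∈ Module.End.maxGenEigenspace f μ := by
  rw [eigenprojection]
  exact Submodule.projection_apply_mem _ v

theorem sub_eigenprojection_mem {V : Type*} [AddCommGroup V] [Module ℂ V] [FiniteDimensional ℂ V]
    (f : V →ₗ[ℂ] V) (μ : ℂ) (v : V) : v - eigenprojection f μ v ∈
      ⨆ ν, ⨆ _ : ν ≠ μ, Module.End.maxGenEigenspace f ν := by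
  rw [eigenprojection]
  exact Submodule.sub_projection_mem _ v

variable {V : Type*} [NormedAddCommGroup V] [NormedSpace ℂ V]

/-- The Cesàro mean of the first `n` iterates of `f` at `v`. -/
noncomputable def cesaro (f : V →ₗ[ℂ] V) (n : ℕ) (v : V) : V :=
  (n : ℂ)⁻¹ • ∑ k ∈ Finset.range n, (f ^ k) v

theorem cesaro_add (f : V →ₗ[ℂ] V) (n : ℕ) (v w : V) :
    cesaro f n (v + w) = cesaro f n v + cesaro f n w := by
  simp [cesaro, Finset.sum_add_distrib]

theorem cesaro_of_fixed {f : V →ₗ[ℂ] V} {v : V} (hv : f v = v) {n : ℕ} (hn : n ≠ 0) :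
    cesaro f n v = v := by
  have h : ∀ k, (f ^ k) v = v := fun k => by
    induction k with
    | zero => simp
    | succ k ih => rw [pow_succ, Module.End.mul_apply, hv, ih]
  simp only [cesaro, h, Finset.sum_const, Finset.card_range]
  rw [← Nat.cast_smul_eq_nsmul ℂ, smul_smul, inv_mul_cancel₀ (by exact_mod_cast hn), one_smul]

/-- A vector killed by a power of `f - ν`, with `ν ≠ 1`, lies in the range of `f - 1`. -/
theorem maxGenEigenspace_le_range_sub_one (f : V →ₗ[ℂ] V) {ν : ℂ} (hν : ν ≠ 1) :
    Module.End.maxGenEigenspace f ν ≤ LinearMap.range (f - 1) := by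
  have key : ∀ k : ℕ, ∀ v, ((f - algebraMap ℂ (Module.End ℂ V) ν) ^ k) v = 0 →
      v ∈ LinearMap.range (f - 1) := by
    intro k
    induction k with
    | zero => intro v hv; simp at hv; simp [hv]
    | succ k ih =>
      intro v hv
      rw [pow_succ, Module.End.mul_apply] at hv
      have h1 := ih _ hv
      have h2 : (f - 1) v ∈ LinearMap.range (f - 1) := ⟨v, rfl⟩
      have h3 : v = (ν - 1)⁻¹ • ((f - 1) v - (f - algebraMap ℂ (Module.End ℂ V) ν) v) := by
        have : (f - 1) v - (f - algebraMap ℂ (Module.End ℂ V) ν) v = (ν - 1) • v := by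
          simp [sub_smul]
        rw [this, smul_smul, inv_mul_cancel₀ (sub_ne_zero.mpr hν), one_smul]
      rw [h3]
      exact Submodule.smul_mem _ _ (Submodule.sub_mem _ h2 h1)
  intro v hv
  obtain ⟨k, hk⟩ := (Module.End.mem_maxGenEigenspace f ν v).mp hv
  exact key k v hk

/-- If all orbits are bounded, generalized fixed vectors are fixed: a Jordan chain of length two for
the eigenvalue `1` would have a linearly growing orbit. -/
theorem apply_eq_self_of_bounded {f : V →ₗ[ℂ] V} (hf : ∀ v, ∃ C : ℝ, ∀ n : ℕ, ‖(f ^ n) v‖ ≤ C)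
    {v : V} (hv : v ∈ Module.End.maxGenEigenspace f 1) : f v = v := by
  have two : ∀ w, (f - 1) ((f - 1) w) = 0 → (f - 1) w = 0 := by
    intro w hw
    obtain ⟨C, hC⟩ := hf w
    have hz : f ((f - 1) w) = (f - 1) w := by simpa [sub_eq_zero] using hw
    have hn : ∀ n : ℕ, (f ^ n) w = w + (n : ℂ) • (f - 1) w := by
      intro n
      induction n with
      | zero => simp
      | succ n ih =>
        rw [pow_succ', Module.End.mul_apply, ih, map_add, map_smul, hz]
        push_cast
        rw [add_smul, one_smul, LinearMap.sub_apply, Module.End.one_apply]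
        abel
    by_contra h0
    have hpos : 0 < ‖(f - 1) w‖ := norm_pos_iff.mpr h0
    obtain ⟨n, hn'⟩ := exists_nat_gt ((C + ‖w‖) / ‖(f - 1) w‖)
    rw [div_lt_iff₀ hpos] at hn'
    have h1 : (n : ℂ) • (f - 1) w = (f ^ n) w - w := by rw [hn]; abel
    have h2 : (n : ℝ) * ‖(f - 1) w‖ ≤ ‖(f ^ n) w‖ + ‖w‖ := by
      calc (n : ℝ) * ‖(f - 1) w‖ = ‖(n : ℂ) • (f - 1) w‖ := by rw [norm_smul]; simp
        _ ≤ _ := by rw [h1]; exact norm_sub_le _ _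
    linarith [hC n]
  have key : ∀ k : ℕ, ((f - 1) ^ (k + 1)) v = 0 → (f - 1) v = 0 := by
    intro k
    induction k with
    | zero => simp
    | succ k ih =>
      intro h
      apply ih
      rw [pow_succ', Module.End.mul_apply]
      apply two
      rwa [← Module.End.mul_apply, ← Module.End.mul_apply, mul_assoc, ← pow_succ', ← pow_succ']
  obtain ⟨k, hk⟩ := (Module.End.mem_maxGenEigenspace f 1 v).mp hv
  rw [one_smul] at hk
  have := key k (by rw [pow_succ', Module.End.mul_apply, hk, map_zero])
  simpa [sub_eq_zero] using this

/-- The Cesàro means telescope on the range of `f - 1`. -/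
theorem tendsto_cesaro_of_mem_range {f : V →ₗ[ℂ] V}
    (hf : ∀ v, ∃ C : ℝ, ∀ n : ℕ, ‖(f ^ n) v‖ ≤ C) {v : V} (hv : v ∈ LinearMap.range (f - 1)) :
    Tendsto (fun n => cesaro f n v) atTop (𝓝 0) := by
  obtain ⟨w, rfl⟩ := hv
  obtain ⟨C, hC⟩ := hf w
  have h : ∀ n, cesaro f n ((f - 1) w) = (n : ℂ)⁻¹ • ((f ^ n) w - w) := by
    intro n
    rw [cesaro]
    congr 1
    induction n with
    | zero => simp
    | succ n ih =>
      rw [Finset.sum_range_succ, ih, pow_succ, Module.End.mul_apply, LinearMap.sub_apply,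
        Module.End.one_apply, map_sub]
      abel
  simp only [h]
  rw [tendsto_zero_iff_norm_tendsto_zero]
  have h2 : Tendsto (fun n : ℕ => (n : ℝ)⁻¹ * (C + ‖w‖)) atTop (𝓝 0) := by
    simpa using tendsto_inv_atTop_nhds_zero_nat.mul_const (C + ‖w‖)
  refine squeeze_zero (fun _ => norm_nonneg _) (fun n => ?_) h2
  rw [norm_smul, norm_inv, Complex.norm_natCast]
  gcongr
  exact (norm_sub_le _ _).trans (add_le_add (hC n) le_rfl)

variable [FiniteDimensional ℂ V]

/-- The mean ergodic theorem in finite dimension. -/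
theorem tendsto_cesaro {f : V →ₗ[ℂ] V} (hf : ∀ v, ∃ C : ℝ, ∀ n : ℕ, ‖(f ^ n) v‖ ≤ C) (v : V) :
    Tendsto (fun n => cesaro f n v) atTop (𝓝 (eigenprojection f 1 v)) := by
  have h₁ := eigenprojection_mem f 1 v
  have h₂ : v - eigenprojection f 1 v ∈ LinearMap.range (f - 1) := by
    have hle : (⨆ ν, ⨆ _ : ν ≠ (1 : ℂ), Module.End.maxGenEigenspace f ν) ≤
        LinearMap.range (f - 1) := iSup₂_le fun ν hν => maxGenEigenspace_le_range_sub_one f hν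
    exact hle (sub_eigenprojection_mem f 1 v)
  obtain ⟨v₂, hv₂⟩ : ∃ v₂, v₂ = v - eigenprojection f 1 v := ⟨_, rfl⟩
  rw [← hv₂] at h₂
  have hv : v = eigenprojection f 1 v + v₂ := by rw [hv₂, add_sub_cancel]
  generalize eigenprojection f 1 v = v₁ at h₁ hv ⊢
  have h : Tendsto (fun n => cesaro f n v₁ + cesaro f n v₂) atTop (𝓝 (v₁ + 0)) := by
    refine Tendsto.add ?_ (tendsto_cesaro_of_mem_range hf h₂)
    refine tendsto_const_nhds.congr' ?_
    filter_upwards [eventually_ne_atTop 0] with n hn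
    exact (cesaro_of_fixed (apply_eq_self_of_bounded hf h₁) hn).symm
  simpa [hv, cesaro_add] using h

theorem apply_eigenprojection {f : V →ₗ[ℂ] V} (hf : ∀ v, ∃ C : ℝ, ∀ n : ℕ, ‖(f ^ n) v‖ ≤ C)
    (v : V) : f (eigenprojection f 1 v) = eigenprojection f 1 v :=
  apply_eq_self_of_bounded hf (eigenprojection_mem f 1 v)

end Ergodic

section Domination

open Filter Topology

variable {H : Type*} [NormedAddCommGroup H] [InnerProductSpace ℂ H]

/-- `X` is dominated by `A` if the block operator with rows `(A, X)`, `(X†, A)` is positive; the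
phases of `v` and `w` being free, this is `2 |⟨v, X w⟩| ≤ ⟨v, A v⟩ + ⟨w, A w⟩`. -/
def Dominated (X A : Op H) : Prop :=
  ∀ v w : H, 2 * ‖(inner ℂ v (X w) : ℂ)‖ ≤ (inner ℂ v (A v) : ℂ).re + (inner ℂ w (A w) : ℂ).re

theorem dominated_norm_smul_one (X : Op H) : Dominated X ((‖X‖ : ℂ) • (1 : Op H)) := by
  intro v w
  have h1 : ‖(inner ℂ v (X w) : ℂ)‖ ≤ ‖v‖ * (‖X‖ * ‖w‖) :=
    (norm_inner_le_norm _ _).trans (by gcongr; exact X.le_opNorm w)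
  have h2 : ∀ u : H, (inner ℂ u (((‖X‖ : ℂ) • (1 : Op H)) u) : ℂ).re = ‖X‖ * ‖u‖ ^ 2 := by
    intro u
    have : (inner ℂ u (((‖X‖ : ℂ) • (1 : Op H)) u) : ℂ) = ((‖X‖ * ‖u‖ ^ 2 : ℝ) : ℂ) := by
      simp [inner_self_eq_norm_sq_to_K]
    rw [this, Complex.ofReal_re]
  rw [h2, h2]
  nlinarith [mul_nonneg (norm_nonneg X) (sq_nonneg (‖v‖ - ‖w‖))]

theorem Dominated.of_tendsto {X : Op H} {A : ℕ → Op H} {B : Op H}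
    (h : ∀ᶠ n in atTop, Dominated X (A n)) (hA : Tendsto A atTop (𝓝 B)) : Dominated X B := by
  intro v w
  have hlim : ∀ u : H, Tendsto (fun n => (inner ℂ u (A n u) : ℂ).re) atTop
      (𝓝 (inner ℂ u (B u) : ℂ).re) := by
    intro u
    have hc : Continuous fun T : Op H => (inner ℂ u (T u) : ℂ).re := by fun_prop
    exact (hc.tendsto B).comp hA
  exact ge_of_tendsto ((hlim v).add (hlim w)) (h.mono fun n hn => hn v w)

theorem Dominated.smul {X A : Op H} (h : Dominated X A) {c : ℂ} (hc : ‖c‖ = 1) :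
    Dominated (c • X) A := by
  intro v w
  simpa [inner_smul_right, hc] using h v w

/-- Rescaling `v` in the domination inequality shows that the kernel of `A` is orthogonal to the
range of `X`. -/
theorem Dominated.inner_eq_zero_left {X A : Op H} (h : Dominated X A) {v : H} (hv : A v = 0)
    (w : H) : inner ℂ v (X w) = (0 : ℂ) := by
  by_contra h0
  have hpos : 0 < ‖(inner ℂ v (X w) : ℂ)‖ := norm_pos_iff.mpr h0
  obtain ⟨n, hn⟩ := exists_nat_gt ((inner ℂ w (A w) : ℂ).re / ‖(inner ℂ v (X w) : ℂ)‖)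
  rw [div_lt_iff₀ hpos] at hn
  have := h ((n : ℂ) • v) w
  simp only [map_smul, hv, smul_zero, inner_zero_right, Complex.zero_re, zero_add,
    inner_smul_left, norm_mul, RCLike.norm_conj, Complex.norm_natCast] at this
  nlinarith [norm_nonneg (inner ℂ v (X w) : ℂ)]

theorem Dominated.inner_eq_zero_right {X A : Op H} (h : Dominated X A) {w : H} (hw : A w = 0)
    (v : H) : inner ℂ v (X w) = (0 : ℂ) := by
  by_contra h0
  have hpos : 0 < ‖(inner ℂ v (X w) : ℂ)‖ := norm_pos_iff.mpr h0
  obtain ⟨n, hn⟩ := exists_nat_gt ((inner ℂ v (A v) : ℂ).re / ‖(inner ℂ v (X w) : ℂ)‖)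
  rw [div_lt_iff₀ hpos] at hn
  have := h v ((n : ℂ) • w)
  simp only [map_smul, hw, smul_zero, inner_zero_right, Complex.zero_re, add_zero,
    inner_smul_right, norm_mul, Complex.norm_natCast] at this
  nlinarith [norm_nonneg (inner ℂ v (X w) : ℂ)]

variable [CompleteSpace H] {κ : Type*} [Fintype κ]

theorem inner_krausMap (K : κ → Op H) (X : Op H) (v w : H) :
    inner ℂ v (krausMap K X w) = ∑ i, (inner ℂ (star (K i) v) (X (star (K i) w)) : ℂ) := by
  rw [krausMap_apply, sum_apply, inner_sum]
  refine Finset.sum_congr rfl fun i _ => ?_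
  rw [ContinuousLinearMap.star_eq_adjoint, ContinuousLinearMap.adjoint_inner_left]
  rfl

/-- Domination is preserved because Kraus maps are completely positive. -/
theorem Dominated.krausMap {X A : Op H} (h : Dominated X A) (K : κ → Op H) :
    Dominated (krausMap K X) (krausMap K A) := by
  intro v w
  simp only [inner_krausMap, Complex.re_sum, ← Finset.sum_add_distrib]
  calc _ ≤ 2 * ∑ i, ‖(inner ℂ (star (K i) v) (X (star (K i) w)) : ℂ)‖ := by
        gcongr; exact norm_sum_le _ _
    _ ≤ _ := by
        rw [Finset.mul_sum]
        exact Finset.sum_le_sum fun i _ => h _ _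

theorem Dominated.krausMap_pow {X A : Op H} (h : Dominated X A) (K : κ → Op H) (n : ℕ) :
    Dominated ((QChannel.krausMap K ^ n) X) ((QChannel.krausMap K ^ n) A) := by
  induction n with
  | zero => simpa using h
  | succ n ih =>
    rw [pow_succ', Module.End.mul_apply, Module.End.mul_apply]
    exact ih.krausMap K

theorem krausMap_nonneg (K : κ → Op H) {X : Op H} (hX : 0 ≤ X) : 0 ≤ krausMap K X := by
  rw [krausMap_apply]
  exact Finset.sum_nonneg fun i _ => star_right_conjugate_nonneg hX (K i)

/-- If `A` dominates `X = μ⁻ᵏ Φᵏ X`, so does each `Φᵏ A`, and hence their mean. -/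
theorem Dominated.cesaro {μ : ℂ} (hμ : ‖μ‖ = 1) {X A : Op H} (K : κ → Op H)
    (hX : QChannel.krausMap K X = μ • X) (h : Dominated X A) {n : ℕ} (hn : n ≠ 0) :
    Dominated X (cesaro (QChannel.krausMap K) n A) := by
  have hk : ∀ k, Dominated X ((QChannel.krausMap K ^ k) A) := by
    intro k
    induction k with
    | zero => simpa using h
    | succ k ih =>
      rw [pow_succ', Module.End.mul_apply]
      have := (ih.krausMap K).smul (c := μ⁻¹) (by simp [hμ])
      have h0 : μ ≠ 0 := fun h => by simp [h] at hμ
      rwa [hX, smul_smul, inv_mul_cancel₀ h0, one_smul] at this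
  intro v w
  have hre : ∀ u : H, (inner ℂ u (QChannel.cesaro (QChannel.krausMap K) n A u) : ℂ).re
      = (n : ℝ)⁻¹ * ∑ k ∈ Finset.range n, (inner ℂ u (((QChannel.krausMap K ^ k) A) u) : ℂ).re := by
    intro u
    rw [QChannel.cesaro, smul_apply, inner_smul_right, sum_apply, inner_sum,
      ← Complex.ofReal_natCast, ← Complex.ofReal_inv, Complex.re_ofReal_mul, Complex.re_sum]
  rw [hre, hre, ← mul_add, ← Finset.sum_add_distrib]
  have hs : (n : ℝ) * (2 * ‖(inner ℂ v (X w) : ℂ)‖) ≤ ∑ k ∈ Finset.range n,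
      ((inner ℂ v (((QChannel.krausMap K ^ k) A) v) : ℂ).re
        + (inner ℂ w (((QChannel.krausMap K ^ k) A) w) : ℂ).re) := by
    calc _ = ∑ _k ∈ Finset.range n, (2 * ‖(inner ℂ v (X w) : ℂ)‖) := by simp
      _ ≤ _ := Finset.sum_le_sum fun k _ => hk k v w
  have hn' : (0 : ℝ) < n := by positivity
  rw [inv_mul_eq_div, le_div_iff₀ hn']
  linarith

variable [FiniteDimensional ℂ H]

theorem trace_krausMap_pow (K : κ → Op H) (hK : ∑ i, star (K i) * K i = 1) (n : ℕ) (X : Op H) :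
    LinearMap.trace ℂ H ((krausMap K ^ n) X : Op H) = LinearMap.trace ℂ H (X : H →ₗ[ℂ] H) := by
  induction n with
  | zero => simp
  | succ n ih => rw [pow_succ', Module.End.mul_apply, trace_krausMap K hK, ih]

/-- The orbits of a channel are bounded: the entries of `Φⁿ X` are controlled by the diagonal
entries of `Φⁿ 1`, which are nonnegative and sum to `dim H`. -/
theorem krausMap_bounded (K : κ → Op H) (hK : ∑ i, star (K i) * K i = 1) (X : Op H) :
    ∃ C : ℝ, ∀ n : ℕ, ‖(krausMap K ^ n) X‖ ≤ C := by
  set b := stdOrthonormalBasis ℂ H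
  have hd : ∀ n v, 0 ≤ (inner ℂ v (((krausMap K ^ n) 1) v) : ℂ).re := by
    intro n v
    have h2 : Dominated (0 : Op H) 1 := by
      intro v w
      have : ∀ u : H, 0 ≤ (inner ℂ u u : ℂ).re := fun u => inner_self_nonneg (𝕜 := ℂ)
      simpa using add_nonneg (this v) (this w)
    have := (h2.krausMap_pow K n) v v
    simp only [map_zero, zero_apply, inner_zero_right, norm_zero, mul_zero] at this
    linarith
  -- Trace preservation: the diagonal entries of `Φⁿ 1` sum to `dim H`.
  set N : ℝ := (Module.finrank ℂ H : ℝ)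
  have hs : ∀ n, ∑ i, (inner ℂ (b i) (((krausMap K ^ n) 1) (b i)) : ℂ).re = N := by
    intro n
    have := trace_krausMap_pow K hK n 1
    rw [LinearMap.trace_eq_sum_inner _ b] at this
    have h2 := congrArg Complex.re this
    rw [Complex.re_sum] at h2
    simp only [ContinuousLinearMap.coe_coe] at h2
    rw [h2]
    have h3 : ((1 : Op H) : H →ₗ[ℂ] H) = LinearMap.id := rfl
    rw [h3, LinearMap.trace_id]
    simp [N]
  have hle : ∀ n i, (inner ℂ (b i) (((krausMap K ^ n) 1) (b i)) : ℂ).re ≤ N := by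
    intro n i
    rw [← hs n]
    exact Finset.single_le_sum (f := fun i => (inner ℂ (b i) (((krausMap K ^ n) 1) (b i)) : ℂ).re)
      (fun j _ => hd n (b j)) (Finset.mem_univ i)
  have hent : ∀ n i j, ‖(inner ℂ (b i) (((krausMap K ^ n) X) (b j)) : ℂ)‖ ≤ ‖X‖ * N := by
    intro n i j
    have := ((dominated_norm_smul_one X).krausMap_pow K n) (b i) (b j)
    simp only [map_smul, smul_apply, inner_smul_right, Complex.re_ofReal_mul] at this
    nlinarith [hle n i, hle n j, norm_nonneg X]
  refine ⟨∑ _i : Fin (Module.finrank ℂ H), ∑ _j : Fin (Module.finrank ℂ H), ‖X‖ * N, fun n => ?_⟩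
  rw [eq_sum_rankOne b ((krausMap K ^ n) X)]
  refine (norm_sum_le _ _).trans (Finset.sum_le_sum fun i _ => ?_)
  refine (norm_sum_le _ _).trans (Finset.sum_le_sum fun j _ => ?_)
  rw [norm_smul, InnerProductSpace.norm_rankOne]
  simpa using hent n i j

/-- A peripheral eigenvector is dominated by a multiple of the ergodic mean of the identity. -/
theorem dominated_eigenprojection (K : κ → Op H) (hK : ∑ i, star (K i) * K i = 1) {μ : ℂ}
    (hμ : ‖μ‖ = 1) {X : Op H} (hX : krausMap K X = μ • X) :
    Dominated X ((‖X‖ : ℂ) • eigenprojection (krausMap K) 1 (1 : Op H)) := by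
  rw [← map_smul]
  refine Dominated.of_tendsto ?_ (tendsto_cesaro (krausMap_bounded K hK) _)
  filter_upwards [eventually_ne_atTop 0] with n hn
  exact (dominated_norm_smul_one X).cesaro hμ K hX hn

theorem eigenprojection_nonneg (K : κ → Op H) (hK : ∑ i, star (K i) * K i = 1) {X : Op H}
    (hX : 0 ≤ X) : 0 ≤ eigenprojection (krausMap K) 1 X := by
  refine ge_of_tendsto (tendsto_cesaro (krausMap_bounded K hK) X) (.of_forall fun n => ?_)
  have h : ∀ k, 0 ≤ (krausMap K ^ k) X := fun k => by
    induction k with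
    | zero => simpa using hX
    | succ k ih => rw [pow_succ', Module.End.mul_apply]; exact krausMap_nonneg K ih
  rw [cesaro, ← Complex.ofReal_natCast, ← Complex.ofReal_inv]
  rw [Complex.coe_smul]
  exact smul_nonneg (by positivity) (Finset.sum_nonneg fun k _ => h k)

end Domination

/-! ### Peripheral eigenvectors and twisted commutation -/

section Twisted

variable {H : Type*} [NormedAddCommGroup H] [InnerProductSpace ℂ H] [CompleteSpace H]
variable {κ : Type*}

/-- `x` intertwines the Kraus operators `Kᵢ` with `μ Kᵢ`, and their adjoints accordingly. Over
`|μ| = 1` these operators are the homogeneous components of a graded *-algebra. -/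
def Twisted (K : κ → Op H) (μ : ℂ) (x : Op H) : Prop :=
  ∀ i, K i * x = μ • (x * K i) ∧ star (K i) * x = star μ • (x * star (K i))

theorem star_mul_self_of_norm {μ : ℂ} (hμ : ‖μ‖ = 1) : star μ * μ = 1 := by
  have : star μ * μ = ((‖μ‖ ^ 2 : ℝ) : ℂ) := by
    rw [Complex.star_def, Complex.conj_mul']
    norm_cast
  rw [this, hμ]; simp

theorem mul_star_self_of_norm {μ : ℂ} (hμ : ‖μ‖ = 1) : μ * star μ = 1 := by
  rw [mul_comm, star_mul_self_of_norm hμ]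

namespace Twisted

variable {K : κ → Op H} {μ ν : ℂ} {x y : Op H}

theorem one : Twisted K 1 1 := fun i => by simp

theorem add (hx : Twisted K μ x) (hy : Twisted K μ y) : Twisted K μ (x + y) := fun i => by
  rw [mul_add, mul_add, (hx i).1, (hx i).2, (hy i).1, (hy i).2]
  simp [add_mul]

theorem smul (hx : Twisted K μ x) (c : ℂ) : Twisted K μ (c • x) := fun i => by
  rw [mul_smul_comm, mul_smul_comm, (hx i).1, (hx i).2]
  simp [smul_comm c]

theorem sub (hx : Twisted K μ x) (hy : Twisted K μ y) : Twisted K μ (x - y) := by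
  simpa [sub_eq_add_neg] using hx.add (hy.smul (-1))

theorem mul (hx : Twisted K μ x) (hy : Twisted K ν y) : Twisted K (μ * ν) (x * y) := fun i => by
  constructor
  · rw [← mul_assoc, (hx i).1, smul_mul_assoc, mul_assoc, (hy i).1, mul_smul_comm, smul_smul,
      mul_assoc]
  · rw [← mul_assoc, (hx i).2, smul_mul_assoc, mul_assoc, (hy i).2, mul_smul_comm, smul_smul,
      mul_assoc, star_mul, mul_comm (star ν)]

theorem mul_eq_left (hμ : ‖μ‖ = 1) (hx : Twisted K μ x) (i : κ) :
    x * K i = star μ • (K i * x) := by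
  rw [(hx i).1, smul_smul, star_mul_self_of_norm hμ, one_smul]

theorem mul_star_eq (hμ : ‖μ‖ = 1) (hx : Twisted K μ x) (i : κ) :
    x * star (K i) = μ • (star (K i) * x) := by
  rw [(hx i).2, smul_smul, mul_star_self_of_norm hμ, one_smul]

protected theorem star (hμ : ‖μ‖ = 1) (hx : Twisted K μ x) : Twisted K (star μ) (star x) :=
  fun i => by
  constructor
  · have := congrArg star (hx.mul_star_eq hμ i)
    simpa using this
  · have := congrArg star (hx.mul_eq_left hμ i)
    simpa using this

theorem pow (hx : Twisted K μ x) (n : ℕ) : Twisted K (μ ^ n) (x ^ n) := by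
  induction n with
  | zero => simpa using one
  | succ n ih => rw [pow_succ, pow_succ]; exact ih.mul hx

variable [Fintype κ]

theorem krausMap_mul (hx : Twisted K μ x) (X : Op H) :
    krausMap K (x * X) = μ • (x * krausMap K X) := by
  simp only [krausMap_apply, Finset.mul_sum, Finset.smul_sum]
  refine Finset.sum_congr rfl fun i _ => ?_
  rw [← mul_assoc, (hx i).1]
  simp [mul_assoc]

theorem krausMap_mul_right (hμ : ‖μ‖ = 1) (hx : Twisted K μ x) (X : Op H) :
    krausMap K (X * x) = μ • (krausMap K X * x) := by
  simp only [krausMap_apply, Finset.sum_mul, Finset.smul_sum]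
  refine Finset.sum_congr rfl fun i _ => ?_
  rw [mul_assoc, mul_assoc X, hx.mul_star_eq hμ i]
  simp [mul_assoc]

theorem commute_krausMap_pow (hμ : ‖μ‖ = 1) (hx : Twisted K μ x) (n : ℕ) :
    Commute x ((krausMap K ^ n) 1) := by
  have h1 : ∀ n, (krausMap K ^ n) x = μ ^ n • (x * (krausMap K ^ n) 1) := by
    intro n
    induction n with
    | zero => simp
    | succ n ih =>
      rw [pow_succ', Module.End.mul_apply, ih, map_smul, hx.krausMap_mul, smul_smul, pow_succ,
        Module.End.mul_apply]
  have h2 : ∀ n, (krausMap K ^ n) x = μ ^ n • ((krausMap K ^ n) 1 * x) := by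
    intro n
    induction n with
    | zero => simp
    | succ n ih =>
      rw [pow_succ', Module.End.mul_apply, ih, map_smul, hx.krausMap_mul_right hμ, smul_smul,
        pow_succ, Module.End.mul_apply]
  have h0 : μ ^ n ≠ 0 := pow_ne_zero n fun h => by simp [h] at hμ
  have h := (h1 n).symm.trans (h2 n)
  exact smul_right_injective (Op H) h0 h

/-- Homogeneous elements commute with the ergodic mean of the identity, since they commute with
every iterate of the identity. -/
theorem commute_eigenprojection [FiniteDimensional ℂ H] (hK : ∑ i, star (K i) * K i = 1)
    (hμ : ‖μ‖ = 1) (hx : Twisted K μ x) :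
    Commute x (eigenprojection (krausMap K) 1 (1 : Op H)) := by
  have hlim := tendsto_cesaro (krausMap_bounded K hK) (1 : Op H)
  have h1 := hlim.const_mul x
  have h2 := hlim.mul_const x
  refine tendsto_nhds_unique h1 (h2.congr fun n => ?_)
  rw [cesaro, smul_mul_assoc, mul_smul_comm, Finset.sum_mul, Finset.mul_sum]
  congr 1
  exact Finset.sum_congr rfl fun k _ => (hx.commute_krausMap_pow hμ k).symm

end Twisted

end Twisted

section Positivity

variable {H : Type*} [NormedAddCommGroup H] [InnerProductSpace ℂ H]

theorem re_inner_nonneg {A : Op H} (hA : 0 ≤ A) (v : H) : 0 ≤ (inner ℂ v (A v) : ℂ).re :=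
  ((ContinuousLinearMap.nonneg_iff_isPositive A).mp hA).re_inner_nonneg_right v

variable [CompleteSpace H]

theorem apply_eq_zero_of_nonneg {A : Op H} (hA : 0 ≤ A) {v : H}
    (hv : (inner ℂ v (A v) : ℂ).re ≤ 0) : A v = 0 := by
  obtain ⟨B, rfl⟩ := exists_eq_star_mul_self hA
  have h : (inner ℂ v ((star B * B) v) : ℂ) = inner ℂ (B v) (B v) := by
    rw [ContinuousLinearMap.star_eq_adjoint]
    exact ContinuousLinearMap.adjoint_inner_right B v (B v)
  rw [h] at hv
  have h0 : B v = 0 := by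
    rw [← norm_eq_zero, ← sq_eq_zero_iff]
    have := inner_self_eq_norm_sq (𝕜 := ℂ) (B v)
    exact le_antisymm (this ▸ hv) (sq_nonneg _)
  change star B (B v) = 0
  rw [h0, map_zero]

theorem trace_mul_star_self {ι : Type*} [Fintype ι] (b : OrthonormalBasis ι ℂ H) (Z : Op H) :
    LinearMap.trace ℂ H ((Z * star Z : Op H) : H →ₗ[ℂ] H)
      = ((∑ j, ‖star Z (b j)‖ ^ 2 : ℝ) : ℂ) := by
  rw [LinearMap.trace_eq_sum_inner _ b]
  push_cast
  refine Finset.sum_congr rfl fun j _ => ?_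
  have h := ContinuousLinearMap.adjoint_inner_left Z (star Z (b j)) (b j)
  rw [← ContinuousLinearMap.star_eq_adjoint] at h
  refine h.symm.trans ?_
  rw [inner_self_eq_norm_sq_to_K]
  rfl

variable [FiniteDimensional ℂ H]

theorem isUnit_of_ker {A : Op H} (hA : ∀ v, A v = 0 → v = 0) : IsUnit A := by
  rw [ContinuousLinearMap.isUnit_iff_bijective]
  have hi : Function.Injective (A : H →ₗ[ℂ] H) := (injective_iff_map_eq_zero _).mpr hA
  exact ⟨hi, LinearMap.injective_iff_surjective.mp hi⟩

/-- Faithfulness of the trace. -/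
theorem eq_zero_of_trace_sum_mul_star_self {κ : Type*} [Fintype κ] (Z : κ → Op H)
    (h : LinearMap.trace ℂ H ((∑ i, Z i * star (Z i) : Op H) : H →ₗ[ℂ] H) = 0) (i : κ) :
    Z i = 0 := by
  set b := stdOrthonormalBasis ℂ H
  rw [ContinuousLinearMap.toLinearMap_sum, map_sum] at h
  simp only [trace_mul_star_self b] at h
  rw [← Complex.ofReal_sum, Complex.ofReal_eq_zero,
    Finset.sum_eq_zero_iff_of_nonneg fun _ _ => by positivity] at h
  have h1 := h i (Finset.mem_univ i)
  rw [Finset.sum_eq_zero_iff_of_nonneg fun _ _ => by positivity] at h1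
  have h2 : star (Z i) = 0 := by
    have : ((star (Z i) : Op H) : H →ₗ[ℂ] H) = 0 := b.toBasis.ext fun j => by
      simpa using h1 j (Finset.mem_univ j)
    ext v
    exact LinearMap.congr_fun this v
  simpa using congrArg star h2

/-- Faithfulness of an invertible positive functional. -/
theorem eq_zero_of_trace_sum_conj {κ : Type*} [Fintype κ] {τ : Op H} (hτ : 0 ≤ τ) (hu : IsUnit τ)
    (Z : κ → Op H)
    (h : LinearMap.trace ℂ H ((∑ i, Z i * τ * star (Z i) : Op H) : H →ₗ[ℂ] H) = 0) (i : κ) :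
    Z i = 0 := by
  obtain ⟨B, hB⟩ := exists_eq_star_mul_self hτ
  have h1 := eq_zero_of_trace_sum_mul_star_self (fun i => Z i * star B)
    (by simpa [hB, mul_assoc] using h) i
  have h2 : Z i * τ = 0 := by rw [hB, ← mul_assoc, h1, zero_mul]
  exact hu.mul_left_eq_zero.mp h2

end Positivity

section Faithful

variable {H : Type*} [NormedAddCommGroup H] [InnerProductSpace ℂ H] [CompleteSpace H]
  [FiniteDimensional ℂ H] {κ : Type*} [Fintype κ] {K : κ → Op H}

theorem eigenprojection_of_fixed (hK : ∑ i, star (K i) * K i = 1) {X : Op H}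
    (hX : krausMap K X = X) : eigenprojection (krausMap K) 1 X = X := by
  refine tendsto_nhds_unique (tendsto_cesaro (krausMap_bounded K hK) X)
    (tendsto_const_nhds.congr' ?_)
  filter_upwards [Filter.eventually_ne_atTop 0] with n hn
  exact (cesaro_of_fixed hX hn).symm

theorem krausMap_eigenprojection (hK : ∑ i, star (K i) * K i = 1) (X : Op H) :
    krausMap K (eigenprojection (krausMap K) 1 X) = eigenprojection (krausMap K) 1 X :=
  apply_eigenprojection (krausMap_bounded K hK) X

/-- If some fixed point is positive and invertible, so is the ergodic mean of the identity. -/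
theorem isUnit_eigenprojection_one (hK : ∑ i, star (K i) * K i = 1) {σ : Op H} (hσ : 0 ≤ σ)
    (hu : IsUnit σ) (hfix : krausMap K σ = σ) :
    IsUnit (eigenprojection (krausMap K) 1 (1 : Op H)) := by
  refine isUnit_of_ker fun v hv => ?_
  have h1 : 0 ≤ (‖σ‖ : ℂ) • (1 : Op H) - σ := by
    rw [sub_nonneg]
    have := IsSelfAdjoint.le_algebraMap_norm_self (a := σ) (IsSelfAdjoint.of_nonneg hσ)
    rwa [Algebra.algebraMap_eq_smul_one, ← Complex.coe_smul] at this
  have h2 := eigenprojection_nonneg K hK h1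
  rw [map_sub, map_smul, eigenprojection_of_fixed hK hfix] at h2
  have h3 := re_inner_nonneg h2 v
  rw [sub_apply, smul_apply, hv, smul_zero, zero_sub, inner_neg_right, Complex.neg_re] at h3
  have h4 : σ v = 0 := apply_eq_zero_of_nonneg hσ (by linarith)
  have hinj := ((ContinuousLinearMap.isUnit_iff_bijective).mp hu).1
  exact hinj (by rw [h4, map_zero])

/-- The peripheral eigenvectors are the homogeneous elements times a fixed faithful state `τ`:
if `Φ X = μ X` and `x = X τ⁻¹`, then
`∑ (Kᵢ x - μ x Kᵢ) τ (Kᵢ x - μ x Kᵢ)† = Φ (x τ x†) - x τ x†` has trace zero, which forces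
`Kᵢ x = μ x Kᵢ`. The relation with `Kᵢ†` comes from the Schwarz inequality for the dual map
`Ψ A = ∑ Kᵢ† A Kᵢ`: the defect `Ψ (x x†) - Ψ x Ψ (x†)` has trace zero against `τ`. -/
theorem exists_twisted_of_eigenvector (hK : ∑ i, star (K i) * K i = 1) {τ : Op H} (hτ : 0 ≤ τ)
    (hu : IsUnit τ) (hfix : krausMap K τ = τ) {μ : ℂ} (hμ : ‖μ‖ = 1) {X : Op H}
    (hX : krausMap K X = μ • X) : ∃ x, Twisted K μ x ∧ X = x * τ := by
  have hμ1 := mul_star_self_of_norm hμ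
  have hμ2 := star_mul_self_of_norm hμ
  obtain ⟨u, rfl⟩ := hu
  obtain ⟨x, hXx⟩ : ∃ x : Op H, X = x * u :=
    ⟨X * (↑u⁻¹ : Op H), by rw [mul_assoc, Units.inv_mul, mul_one]⟩
  have hsa : star (u : Op H) = u := (IsSelfAdjoint.of_nonneg hτ).star_eq
  have hXs : star X = u * star x := by rw [hXx, star_mul, hsa]
  have hXs' : krausMap K (star X) = star μ • star X := by rw [← star_krausMap, hX, star_smul]
  have h1 : ∀ i, K i * x = μ • (x * K i) := by
    have hsum : (∑ i, (K i * x - μ • (x * K i)) * u * star (K i * x - μ • (x * K i)) : Op H)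
        = krausMap K (x * u * star x) - x * u * star x := by
      have e : ∀ i, (K i * x - μ • (x * K i)) * u * star (K i * x - μ • (x * K i))
          = K i * (x * u * star x) * star (K i) - star μ • ((K i * X * star (K i)) * star x)
            - μ • (x * (K i * star X * star (K i))) + x * (K i * u * star (K i)) * star x := by
        intro i
        simp only [star_sub, star_smul, star_mul, sub_mul, mul_sub, smul_mul_assoc, mul_smul_comm,
          hXx, mul_assoc, hsa]
        rw [smul_sub, smul_smul, hμ2, one_smul]
        abel
      simp only [e, Finset.sum_add_distrib, Finset.sum_sub_distrib, ← Finset.smul_sum,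
        ← Finset.sum_mul, ← Finset.mul_sum]
      simp only [← krausMap_apply, hX, hXs', hfix, smul_mul_assoc, mul_smul_comm, smul_smul, hμ1,
        hμ2, one_smul]
      rw [hXs, hXx]
      simp only [mul_assoc]
      abel
    intro i
    refine sub_eq_zero.mp (eq_zero_of_trace_sum_conj hτ u.isUnit
      (fun i => K i * x - μ • (x * K i)) ?_ i)
    rw [hsum, ContinuousLinearMap.toLinearMap_sub, map_sub, trace_krausMap K hK, sub_self]
  -- Hence `x` and `x†` are eigenvectors of the dual map `Ψ`.
  have h1s : ∀ i, star (K i) * star x = μ • (star x * star (K i)) := by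
    intro i
    have h := congrArg star (h1 i)
    rw [star_smul, star_mul, star_mul] at h
    rw [h, smul_smul, hμ1, one_smul]
  have hΨ : ∑ i, star (K i) * star x * K i = μ • star x := by
    simp only [h1s, smul_mul_assoc, ← Finset.smul_sum, mul_assoc, ← Finset.mul_sum, hK, mul_one]
  have hΨs : ∑ i, star (K i) * x * K i = star μ • x := by
    have h := congrArg star hΨ
    simpa [star_sum, mul_assoc] using h
  have h2 : ∀ i, star x * K i = μ • (K i * star x) := by
    have hsum : (∑ i, star (star x * K i - μ • (K i * star x)) * (star x * K i - μ • (K i * star x))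
        : Op H) = ∑ i, star (K i) * (x * star x) * K i - x * star x := by
      have e : ∀ i, star (star x * K i - μ • (K i * star x)) * (star x * K i - μ • (K i * star x))
          = star (K i) * (x * star x) * K i - μ • ((star (K i) * x * K i) * star x)
            - star μ • (x * (star (K i) * star x * K i)) + x * (star (K i) * K i) * star x := by
        intro i
        simp only [star_sub, star_smul, star_mul, sub_mul, mul_sub, smul_mul_assoc, mul_smul_comm,
          mul_assoc, star_star]
        rw [smul_sub, smul_smul, hμ1, one_smul]
        abel
      simp only [e, Finset.sum_add_distrib, Finset.sum_sub_distrib, ← Finset.smul_sum,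
        ← Finset.sum_mul, ← Finset.mul_sum, hΨ, hΨs, hK, smul_mul_assoc, mul_smul_comm, smul_smul,
        hμ1, hμ2, one_smul, mul_one]
      abel
    -- Invariance of `τ = B† B` makes the trace of the right-hand side against `τ` vanish.
    obtain ⟨B, hB⟩ := exists_eq_star_mul_self hτ
    have htr : LinearMap.trace ℂ H ((∑ i, (B * star (star x * K i - μ • (K i * star x))) *
        star (B * star (star x * K i - μ • (K i * star x))) : Op H) : H →ₗ[ℂ] H) = 0 := by
      have e1 : (∑ i, (B * star (star x * K i - μ • (K i * star x))) *
          star (B * star (star x * K i - μ • (K i * star x))) : Op H)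
          = B * ((∑ i, star (K i) * (x * star x) * K i - x * star x) * star B) := by
        rw [← hsum]
        simp only [star_mul, star_star, Finset.mul_sum, Finset.sum_mul, mul_assoc]
      have e2 : LinearMap.trace ℂ H ((B * ((∑ i, star (K i) * (x * star x) * K i - x * star x)
            * star B) : Op H) : H →ₗ[ℂ] H)
          = LinearMap.trace ℂ H (((∑ i, star (K i) * (x * star x) * K i - x * star x) *
              (u : Op H) : Op H) : H →ₗ[ℂ] H) := by
        rw [hB, ← mul_assoc _ (star B) B]
        exact LinearMap.trace_mul_comm ℂ (B : H →ₗ[ℂ] H)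
          (((∑ i, star (K i) * (x * star x) * K i - x * star x) * star B : Op H) : H →ₗ[ℂ] H)
      have e3 : LinearMap.trace ℂ H ((∑ i, star (K i) * (x * star x) * K i * (u : Op H) : Op H) :
          H →ₗ[ℂ] H) = LinearMap.trace ℂ H ((x * star x * (u : Op H) : Op H) : H →ₗ[ℂ] H) := by
        conv_rhs => rw [← hfix, krausMap_apply, Finset.mul_sum]
        rw [ContinuousLinearMap.toLinearMap_sum, ContinuousLinearMap.toLinearMap_sum, map_sum,
          map_sum]
        refine Finset.sum_congr rfl fun i _ => ?_
        rw [mul_assoc, mul_assoc, ← mul_assoc (x * star x) (K i * (u : Op H))]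
        exact LinearMap.trace_mul_comm ℂ ((star (K i) : Op H) : H →ₗ[ℂ] H)
          ((x * star x * (K i * u) : Op H) : H →ₗ[ℂ] H)
      rw [e1, e2, sub_mul, Finset.sum_mul, ContinuousLinearMap.toLinearMap_sub, map_sub, e3,
        sub_self]
    intro i
    have hz := eq_zero_of_trace_sum_mul_star_self
      (fun i => B * star (star x * K i - μ • (K i * star x))) htr i
    have hz2 : (u : Op H) * star (star x * K i - μ • (K i * star x)) = 0 := by
      rw [hB, mul_assoc, hz, mul_zero]
    have hz3 := u.isUnit.mul_right_eq_zero.mp hz2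
    exact sub_eq_zero.mp (star_eq_zero.mp hz3)
  refine ⟨x, fun i => ⟨h1 i, ?_⟩, hXx⟩
  have h := congrArg star (h2 i)
  simpa using h

end Faithful

/-! ### Irreducible projections -/

section Irreducible

variable {H : Type*} [NormedAddCommGroup H] [InnerProductSpace ℂ H]

theorem finrank_range_lt [FiniteDimensional ℂ H] {e f : Op H} (hff : f * f = f)
    (hef : e * f = f) (hne : f ≠ e) (hfe : f * e = f) :
    Module.finrank ℂ (LinearMap.range (f : H →ₗ[ℂ] H)) <
      Module.finrank ℂ (LinearMap.range (e : H →ₗ[ℂ] H)) := by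
  apply Submodule.finrank_lt_finrank_of_lt
  refine lt_of_le_of_ne ?_ fun h => hne ?_
  · rintro _ ⟨v, rfl⟩
    refine ⟨f v, ?_⟩
    change (e * f) v = f v
    rw [hef]
  · rw [← hfe]
    ext v
    have : e v ∈ LinearMap.range (f : H →ₗ[ℂ] H) := by rw [h]; exact ⟨v, rfl⟩
    obtain ⟨w, hw⟩ := this
    change f (e v) = e v
    rw [← hw]
    change (f * f) w = f w
    rw [hff]

variable [CompleteSpace H] {κ : Type*}

/-- The projection `e` onto an irreducible reducing subspace of the Kraus operators: `e` commutes
with all `Kᵢ` and `Kᵢ†`, and is minimal among the nonzero projections that do. Minimality is encoded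
through Schur's lemma: the commutant compresses to scalars. -/
structure IrreducibleProjection (K : κ → Op H) (e : Op H) : Prop where
  isStarProjection : IsStarProjection e
  twisted : Twisted K 1 e
  ne_zero : e ≠ 0
  schur : ∀ x, Twisted K 1 x → ∃ c : ℂ, e * x * e = c • e

/-- The algebra spanned by the homogeneous elements of unimodular degree. -/
def gradedAlgebra (K : κ → Op H) : Submodule ℂ (Op H) :=
  Submodule.span ℂ {x | ∃ μ : ℂ, ‖μ‖ = 1 ∧ Twisted K μ x}

theorem Twisted.mem_gradedAlgebra {K : κ → Op H} {μ : ℂ} {x : Op H} (hx : Twisted K μ x)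
    (hμ : ‖μ‖ = 1) : x ∈ gradedAlgebra K :=
  Submodule.subset_span ⟨μ, hμ, hx⟩

theorem gradedAlgebra_mul {K : κ → Op H} {x y : Op H} (hx : x ∈ gradedAlgebra K)
    (hy : y ∈ gradedAlgebra K) : x * y ∈ gradedAlgebra K := by
  induction hx using Submodule.span_induction with
  | zero => simp
  | add x x' _ _ hx hx' => rw [add_mul]; exact add_mem hx hx'
  | smul c x _ hx => rw [smul_mul_assoc]; exact Submodule.smul_mem _ _ hx
  | mem x hx =>
    obtain ⟨μ, hμ, hx⟩ := hx
    induction hy using Submodule.span_induction with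
    | zero => simp
    | add y y' _ _ hy hy' => rw [mul_add]; exact add_mem hy hy'
    | smul c y _ hy => rw [mul_smul_comm]; exact Submodule.smul_mem _ _ hy
    | mem y hy =>
      obtain ⟨ν, hν, hy⟩ := hy
      exact (hx.mul hy).mem_gradedAlgebra (by simp [hμ, hν])

theorem commute_of_mem_gradedAlgebra [FiniteDimensional ℂ H] [Fintype κ] {K : κ → Op H}
    (hK : ∑ i, star (K i) * K i = 1) {x : Op H} (hx : x ∈ gradedAlgebra K) :
    Commute x (eigenprojection (krausMap K) 1 (1 : Op H)) := by
  induction hx using Submodule.span_induction with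
  | zero => exact Commute.zero_left _
  | add x x' _ _ hx hx' => exact hx.add_left hx'
  | smul c x _ hx => exact hx.smul_left c
  | mem x hx =>
    obtain ⟨μ, hμ, hx⟩ := hx
    exact hx.commute_eigenprojection hK hμ

/-- A nonzero element of unimodular degree between irreducible projections is a multiple of a
unitary between their ranges. -/
theorem exists_partial_isometry {K : κ → Op H} {e f : Op H} (he : IrreducibleProjection K e)
    (hf : IrreducibleProjection K f) {μ : ℂ} (hμ : ‖μ‖ = 1) {x : Op H} (hx : Twisted K μ x)
    (h0 : f * x * e ≠ 0) : ∃ u : Op H, Twisted K μ u ∧ f * u = u ∧ u * e = u ∧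
      star u * u = e ∧ u * star u = f := by
  have hee : e * e = e := he.isStarProjection.isIdempotentElem
  have hff : f * f = f := hf.isStarProjection.isIdempotentElem
  have hes : star e = e := he.isStarProjection.isSelfAdjoint.star_eq
  have hfs : star f = f := hf.isStarProjection.isSelfAdjoint.star_eq
  have hμ' : star μ * μ = 1 := star_mul_self_of_norm hμ
  have hy : Twisted K μ (f * x * e) := by simpa using (hf.twisted.mul hx).mul he.twisted
  have hfy : f * (f * x * e) = f * x * e := by rw [← mul_assoc, ← mul_assoc, hff]
  have hye : (f * x * e) * e = f * x * e := by rw [mul_assoc, hee]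
  generalize f * x * e = y at h0 hy hfy hye
  have hey : e * star y = star y := by rw [← hes, ← star_mul, hye]
  have hyf : star y * f = star y := by rw [← hfs, ← star_mul, hfy]
  obtain ⟨c, hc⟩ := he.schur (star y * y) (by rw [← hμ']; exact (hy.star hμ).mul hy)
  rw [← mul_assoc, hey, mul_assoc, hye] at hc
  obtain ⟨v, hv⟩ : ∃ v, e v ≠ 0 := by
    by_contra! h
    exact he.ne_zero (by ext v; exact h v)
  -- The scalar `c` in `y† y = c e` is real and positive, so `y / √c` is a partial isometry.
  have hcv : ((‖y (e v)‖ ^ 2 : ℝ) : ℂ) = c * ((‖e v‖ ^ 2 : ℝ) : ℂ) := by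
    have h1 : (inner ℂ (e v) ((star y * y) (e v)) : ℂ) = inner ℂ (y (e v)) (y (e v)) := by
      rw [ContinuousLinearMap.star_eq_adjoint]
      exact ContinuousLinearMap.adjoint_inner_right y (e v) (y (e v))
    have h2 : e (e v) = e v := by
      change (e * e) v = e v
      rw [hee]
    rw [hc, smul_apply, inner_smul_right, h2, inner_self_eq_norm_sq_to_K,
      inner_self_eq_norm_sq_to_K] at h1
    push_cast
    exact h1.symm
  have hev : 0 < ‖e v‖ ^ 2 := by positivity
  have hcr : c = ((‖y (e v)‖ ^ 2 / ‖e v‖ ^ 2 : ℝ) : ℂ) := by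
    rw [Complex.ofReal_div, hcv, mul_div_assoc, div_self, mul_one]
    exact_mod_cast hev.ne'
  have hc0 : c ≠ 0 := by
    rintro rfl
    rw [zero_smul] at hc
    exact h0 ((CStarRing.star_mul_self_eq_zero_iff y).mp hc)
  set r : ℝ := ‖y (e v)‖ ^ 2 / ‖e v‖ ^ 2
  have hr : 0 < r := by
    refine lt_of_le_of_ne (by positivity) fun h => hc0 ?_
    rw [hcr, ← h, Complex.ofReal_zero]
  set u : Op H := ((Real.sqrt r)⁻¹ : ℂ) • y with hu
  have hss : (star ((Real.sqrt r)⁻¹ : ℂ)) * ((Real.sqrt r)⁻¹ : ℂ) * c = 1 := by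
    rw [hcr]
    simp only [Complex.star_def, map_inv₀, Complex.conj_ofReal]
    norm_cast
    rw [← mul_inv, Real.mul_self_sqrt hr.le, inv_mul_cancel₀ hr.ne']
  have huT : Twisted K μ u := hy.smul _
  have hfu : f * u = u := by rw [hu, mul_smul_comm, hfy]
  have hue : u * e = u := by rw [hu, smul_mul_assoc, hye]
  have huu : star u * u = e := by
    rw [hu, star_smul, smul_mul_smul_comm, hc, smul_smul, hss, one_smul]
  refine ⟨u, huT, hfu, hue, huu, ?_⟩
  -- Likewise `u u† = d f`; being idempotent and nonzero, it is `f`.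
  obtain ⟨d, hd⟩ := hf.schur (u * star u) (by
    rw [← mul_star_self_of_norm hμ]; exact huT.mul (huT.star hμ))
  have huf : star u * f = star u := by rw [← hfs, ← star_mul, hfu]
  rw [← mul_assoc, hfu, mul_assoc, huf] at hd
  have hdd : (d * d) • f = d • f := by
    have h1 : (u * star u) * (u * star u) = u * star u := by
      rw [mul_assoc, ← mul_assoc (star u), huu, ← mul_assoc, hue]
    rwa [hd, smul_mul_smul_comm, hff] at h1
  have hd1 := smul_left_injective ℂ hf.ne_zero hdd
  have hd2 : d = 0 ∨ d = 1 := by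
    have h3 : d * (d - 1) = 0 := by
      have h4 : d * d = d := hd1
      rw [mul_sub, h4, mul_one, sub_self]
    exact (mul_eq_zero.mp h3).imp id sub_eq_zero.mp
  rcases hd2 with h | h
  · exfalso
    rw [h, zero_smul] at hd
    have hu0 : u = 0 := (CStarRing.mul_star_self_eq_zero_iff u).mp hd
    rw [hu0] at huu
    exact he.ne_zero (by simpa using huu.symm)
  · rw [hd, h, one_smul]

/-- Elements of equal degree between irreducible projections are proportional. -/
theorem eq_smul_of_twisted {K : κ → Op H} {e f : Op H} (he : IrreducibleProjection K e)
    {μ : ℂ} (hμ : ‖μ‖ = 1) {x u : Op H} (hx : Twisted K μ x)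
    (hu : Twisted K μ u) (hue : u * e = u) (huu : u * star u = f) :
    ∃ c : ℂ, f * x * e = c • u := by
  obtain ⟨c, hc⟩ := he.schur (star u * x) (by
    rw [← star_mul_self_of_norm hμ]; exact (hu.star hμ).mul hx)
  have hes : star e = e := he.isStarProjection.isSelfAdjoint.star_eq
  have heu : e * star u = star u := by rw [← hes, ← star_mul, hue]
  refine ⟨c, ?_⟩
  rw [← mul_assoc, heu] at hc
  rw [← huu, mul_assoc u, mul_assoc u, hc, mul_smul_comm, hue]

variable [FiniteDimensional ℂ H]

/-- The projection onto a subspace reducing the Kraus operators has degree `1`. -/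
theorem twisted_one_starProjection {K : κ → Op H} {W : Submodule ℂ H}
    (h₁ : ∀ i, ∀ v ∈ W, K i v ∈ W) (h₂ : ∀ i, ∀ v ∈ W, star (K i) v ∈ W) :
    Twisted K 1 W.starProjection := by
  have key : ∀ A : Op H, (∀ v ∈ W, A v ∈ W) → (∀ v ∈ W, star A v ∈ W) →
      A * W.starProjection = W.starProjection * A := by
    intro A hA hA'
    ext v
    change A (W.starProjection v) = W.starProjection (A v)
    have h3 : A v = A (W.starProjection v) + A (v - W.starProjection v) := by
      rw [← map_add, add_sub_cancel]
    have h4 : A (v - W.starProjection v) ∈ Wᗮ := by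
      rw [Submodule.mem_orthogonal]
      intro w hw
      rw [← ContinuousLinearMap.adjoint_inner_left, ← ContinuousLinearMap.star_eq_adjoint]
      exact Submodule.inner_right_of_mem_orthogonal (hA' w hw)
        (Submodule.sub_starProjection_mem_orthogonal v)
    rw [h3, map_add, Submodule.starProjection_eq_self_iff.mpr
      (hA _ (Submodule.starProjection_apply_mem W v)),
      (Submodule.starProjection_apply_eq_zero_iff W).mpr h4, add_zero]
  intro i
  simp only [one_smul, star_one]
  exact ⟨key _ (h₁ i) (h₂ i), key _ (h₂ i) (by simpa using h₁ i)⟩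

/-- If `e` is not irreducible, an eigenspace of a compression `e x e` that is not a multiple of `e`
is a smaller reducing subspace. -/
theorem exists_smaller_projection {K : κ → Op H} {e : Op H} (he : IsStarProjection e)
    (hT : Twisted K 1 e) (h0 : e ≠ 0) (hirr : ¬ IrreducibleProjection K e) :
    ∃ f : Op H, IsStarProjection f ∧ Twisted K 1 f ∧ e * f = f ∧ f ≠ 0 ∧ f ≠ e := by
  have hidem : e * e = e := he.isIdempotentElem
  have : ∃ x, Twisted K 1 x ∧ ∀ c : ℂ, e * x * e ≠ c • e := by
    by_contra! h
    exact hirr ⟨he, hT, h0, h⟩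
  obtain ⟨x, hx, hne⟩ := this
  have hy : Twisted K 1 (e * x * e) := by simpa using (hT.mul hx).mul hT
  have heye : e * (e * x * e) = e * x * e := by rw [← mul_assoc, ← mul_assoc, hidem]
  have hyee : e * x * e * e = e * x * e := by rw [mul_assoc, hidem]
  generalize e * x * e = y at hne hy heye hyee
  -- an eigenvector of `y` in the range of `e`
  have hmaps : ∀ v ∈ LinearMap.range (e : H →ₗ[ℂ] H), (y : H →ₗ[ℂ] H) v ∈
      LinearMap.range (e : H →ₗ[ℂ] H) := by
    intro v _
    exact ⟨y v, by change (e * y) v = y v; rw [heye]⟩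
  have hnt : Nontrivial (LinearMap.range (e : H →ₗ[ℂ] H)) := by
    rw [Submodule.nontrivial_iff_ne_bot]
    intro h
    apply h0
    ext v
    have : e v ∈ LinearMap.range (e : H →ₗ[ℂ] H) := ⟨v, rfl⟩
    rw [h] at this
    simpa using this
  obtain ⟨c, hc⟩ := Module.End.exists_eigenvalue ((y : H →ₗ[ℂ] H).restrict hmaps)
  obtain ⟨⟨v, hvr⟩, hv⟩ := hc.exists_hasEigenvector
  have hv1 : y v = c • v := by
    have := congrArg Subtype.val hv.apply_eq_smul
    simpa using this
  have hv0 : v ≠ 0 := fun h => hv.2 (by simp [h])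
  have hev : e v = v := by
    obtain ⟨w, rfl⟩ := hvr
    change (e * e) w = e w
    rw [hidem]
  let W : Submodule ℂ H := LinearMap.eqLocus (e : H →ₗ[ℂ] H) LinearMap.id ⊓
    LinearMap.eqLocus (y : H →ₗ[ℂ] H) (c • LinearMap.id)
  have hW : ∀ w, w ∈ W ↔ e w = w ∧ y w = c • w := fun w => by
    simp [W, Submodule.mem_inf, LinearMap.mem_eqLocus]
  have hinv : ∀ A : Op H, A * e = e * A → A * y = y * A → ∀ w ∈ W, A w ∈ W := by
    intro A hA1 hA2 w hw
    rw [hW] at hw ⊢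
    constructor
    · change (e * A) w = A w
      rw [← hA1]
      change A (e w) = A w
      rw [hw.1]
    · change (y * A) w = c • A w
      rw [← hA2]
      change A (y w) = c • A w
      rw [hw.2, map_smul]
  refine ⟨W.starProjection, isStarProjection_starProjection, ?_, ?_, ?_, ?_⟩
  · refine twisted_one_starProjection (fun i => hinv _ ?_ ?_) (fun i => hinv _ ?_ ?_)
    · simpa using (hT i).1
    · simpa using (hy i).1
    · simpa using (hT i).2
    · simpa using (hy i).2
  · ext w
    exact ((hW _).mp (Submodule.starProjection_apply_mem W w)).1
  · intro h
    have h1 : W.starProjection v = v :=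
      Submodule.starProjection_eq_self_iff.mpr ((hW v).mpr ⟨hev, hv1⟩)
    rw [h] at h1
    exact hv0 h1.symm
  · intro h
    refine hne c ?_
    rw [← hyee]
    ext w
    have hw : e w ∈ W := by
      rw [← h]
      exact Submodule.starProjection_apply_mem W w
    exact ((hW _).mp hw).2

/-- Every projection commuting with the Kraus operators and their adjoints is an orthogonal sum of
irreducible ones. -/
theorem exists_irreducible_decomposition (K : κ → Op H) (N : ℕ) : ∀ e : Op H, IsStarProjection e →
    Twisted K 1 e → Module.finrank ℂ (LinearMap.range (e : H →ₗ[ℂ] H)) < N →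
    ∃ (ι : Type) (_ : Fintype ι) (f : ι → Op H), (∀ a, IrreducibleProjection K (f a)) ∧
      (∀ a b, a ≠ b → f a * f b = 0) ∧ ∑ a, f a = e := by
  induction N with
  | zero => intro e _ _ h; exact absurd h (Nat.not_lt_zero _)
  | succ N ih =>
    intro e he hT hN
    by_cases h0 : e = 0
    · exact ⟨Empty, inferInstance, fun a => a.elim, fun a => a.elim, fun a => a.elim, by simp [h0]⟩
    by_cases hirr : IrreducibleProjection K e
    · refine ⟨Unit, inferInstance, fun _ => e, fun _ => hirr, fun a b h => (h rfl).elim, by simp⟩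
    obtain ⟨f, hf, hfT, hef, hf0, hfe⟩ := exists_smaller_projection he hT h0 hirr
    have hee : e * e = e := he.isIdempotentElem
    have hff : f * f = f := hf.isIdempotentElem
    have hes : star e = e := he.isSelfAdjoint.star_eq
    have hfs : star f = f := hf.isSelfAdjoint.star_eq
    have hfe' : f * e = f := by
      have := congrArg star hef
      rwa [star_mul, hes, hfs] at this
    have hgg : (e - f) * (e - f) = e - f := by
      rw [sub_mul, mul_sub, mul_sub, hee, hef, hfe', hff]; abel
    have hg : IsStarProjection (e - f) :=
      ⟨hgg, by rw [IsSelfAdjoint, star_sub, hes, hfs]⟩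
    have hlt1 := finrank_range_lt hff hef hfe hfe'
    have hlt2 : Module.finrank ℂ (LinearMap.range ((e - f : Op H) : H →ₗ[ℂ] H)) <
        Module.finrank ℂ (LinearMap.range (e : H →ₗ[ℂ] H)) :=
      finrank_range_lt hgg (by rw [mul_sub, hee, hef]) (fun h => hf0 (by simpa using h))
        (by rw [sub_mul, hee, hfe'])
    obtain ⟨ι₁, i₁, f₁, h₁, o₁, s₁⟩ := ih f hf hfT (by omega)
    obtain ⟨ι₂, i₂, f₂, h₂, o₂, s₂⟩ := ih (e - f) hg (hT.sub hfT) (by omega)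
    -- summands of `f` and of `e - f` are orthogonal
    have habs₁ : ∀ a, f₁ a * f = f₁ a := fun a => by
      rw [← s₁, Finset.mul_sum, Finset.sum_eq_single a (fun b _ hb => o₁ a b hb.symm) (by simp)]
      exact (h₁ a).isStarProjection.isIdempotentElem
    have habs₂ : ∀ a, (e - f) * f₂ a = f₂ a := fun a => by
      rw [← s₂, Finset.sum_mul, Finset.sum_eq_single a (fun b _ hb => o₂ b a hb) (by simp)]
      exact (h₂ a).isStarProjection.isIdempotentElem
    have h12 : ∀ a b, f₁ a * f₂ b = 0 := fun a b => by
      rw [← habs₁, ← habs₂, mul_assoc, ← mul_assoc f, mul_sub, hfe', hff, sub_self, zero_mul,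
        mul_zero]
    have h21 : ∀ a b, f₂ b * f₁ a = 0 := fun a b => by
      have := congrArg star (h12 a b)
      rwa [star_mul, star_zero, (h₁ a).isStarProjection.isSelfAdjoint.star_eq,
        (h₂ b).isStarProjection.isSelfAdjoint.star_eq] at this
    refine ⟨ι₁ ⊕ ι₂, inferInstance, Sum.elim f₁ f₂, ?_, ?_, ?_⟩
    · rintro (a | a)
      · exact h₁ a
      · exact h₂ a
    · rintro (a | a) (b | b) hab
      · exact o₁ a b fun h => hab (by rw [h])
      · exact h12 a b
      · exact h21 b a
      · exact o₂ a b fun h => hab (by rw [h])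
    · simp [s₁, s₂]

end Irreducible

/-! ### The cyclic structure of an irreducible corner -/

section Cyclic

variable {H : Type*} [NormedAddCommGroup H] [InnerProductSpace ℂ H] [CompleteSpace H]
  [FiniteDimensional ℂ H] {κ : Type*} [Fintype κ]

/-- Only finitely many degrees occur: a homogeneous element of degree `μ` is an eigenvector of the
dual map for `star μ`. -/
theorem finite_twisted {K : κ → Op H} (hK : ∑ i, star (K i) * K i = 1) :
    {μ : ℂ | ∃ x, Twisted K μ x ∧ x ≠ 0}.Finite := by
  have h := Set.Finite.preimage (f := (star : ℂ → ℂ)) star_injective.injOn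
    (Module.End.finite_hasEigenvalue (krausMap fun i => star (K i)))
  refine h.subset ?_
  rintro μ ⟨x, hx, h0⟩
  change Module.End.HasEigenvalue _ (star μ)
  refine Module.End.hasEigenvalue_of_hasEigenvector (x := x)
    ⟨Module.End.mem_eigenspace_iff.mpr ?_, h0⟩
  rw [krausMap_apply]
  simp only [(hx _).2, star_star, smul_mul_assoc, mul_assoc, ← Finset.smul_sum, ← Finset.mul_sum,
    hK, mul_one]

/-- The degrees occurring in the corner of an irreducible projection form a finite, hence cyclic,
group of roots of unity, and a generator is the degree of a unitary of order `m`. -/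
theorem exists_cyclic_unitary {K : κ → Op H} (hK : ∑ i, star (K i) * K i = 1) {e : Op H}
    (he : IrreducibleProjection K e) :
    ∃ (m : ℕ) (ω : ℂ) (u : Op H), 0 < m ∧ IsPrimitiveRoot ω m ∧ Twisted K ω u ∧ e * u = u ∧
      u * e = u ∧ star u * u = e ∧ u * star u = e ∧ u ^ m * e = e ∧
      ∀ μ x, ‖μ‖ = 1 → Twisted K μ x → ∃ (j : ℕ) (c : ℂ), e * x * e = c • (u ^ j * e) := by
  have hee : e * e = e := he.isStarProjection.isIdempotentElem
  have hes : star e = e := he.isStarProjection.isSelfAdjoint.star_eq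
  let Γ : Subgroup ℂˣ :=
    { carrier := {z | ‖(z : ℂ)‖ = 1 ∧ ∃ x, Twisted K (z : ℂ) x ∧ e * x * e ≠ 0}
      one_mem' := ⟨by simp, 1, by simpa using Twisted.one, by simpa [hee] using he.ne_zero⟩
      mul_mem' := by
        rintro z w ⟨hz, x, hx, hx0⟩ ⟨hw, y, hy, hy0⟩
        obtain ⟨u, hu, heu, hue, huu, -⟩ := exists_partial_isometry he he hz hx hx0
        obtain ⟨v, hv, hev, hve, hvv, -⟩ := exists_partial_isometry he he hw hy hy0
        refine ⟨by simp [hz, hw], u * v, by simpa using hu.mul hv, fun h => he.ne_zero ?_⟩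
        rw [← mul_assoc, heu, mul_assoc, hve] at h
        rw [← hvv, ← hev, ← huu, mul_assoc, h, mul_zero, mul_zero]
      inv_mem' := by
        rintro z ⟨hz, x, hx, hx0⟩
        have hinv : ((z⁻¹ : ℂˣ) : ℂ) = star (z : ℂ) := by
          rw [Units.val_inv_eq_inv_val]
          exact (eq_inv_of_mul_eq_one_left (star_mul_self_of_norm hz)).symm
        refine ⟨by simp [hz], star x, by rw [hinv]; exact hx.star hz, fun h => hx0 ?_⟩
        have := congrArg star h
        simpa [hes, mul_assoc] using this }
  have hfin : Finite Γ := by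
    have h := Set.Finite.preimage (f := (Units.val : ℂˣ → ℂ)) Units.val_injective.injOn
      (finite_twisted hK)
    refine Set.Finite.to_subtype (h.subset ?_)
    rintro z ⟨hz, x, hx, hx0⟩
    exact ⟨x, hx, fun h => hx0 (by simp [h])⟩
  obtain ⟨g, hg⟩ := IsCyclic.exists_generator (α := Γ)
  set m := orderOf g with hm
  have hmpos : 0 < m := orderOf_pos g
  set ω : ℂ := ((g : ℂˣ) : ℂ) with hω
  have hprim : IsPrimitiveRoot ω m := by
    have h1 : IsPrimitiveRoot (g : ℂˣ) m := by
      rw [hm, ← Subgroup.orderOf_coe]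
      exact IsPrimitiveRoot.orderOf _
    exact IsPrimitiveRoot.coe_units_iff.mpr h1
  obtain ⟨hω1, x, hx, hx0⟩ := g.2
  obtain ⟨u, hu, heu, hue, huu, huu'⟩ := exists_partial_isometry he he hω1 hx hx0
  -- The power `uᵐ` has degree `1`, so it is a phase times `e`; an `m`-th root of the inverse phase
  -- rescales `u` so that `uᵐ = e`.
  have hcomm : ∀ j : ℕ, e * u ^ j = u ^ j * e := fun j =>
    (show Commute e u by rw [Commute, SemiconjBy, heu, hue]).pow_right j
  have hunit : ∀ j : ℕ, star (u ^ j * e) * (u ^ j * e) = e := by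
    intro j
    induction j with
    | zero => simp [hes, hee]
    | succ j ih =>
      have h1 : u ^ (j + 1) * e = u * (u ^ j * e) := by rw [pow_succ', mul_assoc]
      rw [h1, star_mul, mul_assoc, ← mul_assoc (star u), huu, ← mul_assoc e, hcomm, mul_assoc, hee,
        ih]
  obtain ⟨c, hc⟩ := he.schur (u ^ m) (by
    have := hu.pow m
    rwa [show ((g : ℂˣ) : ℂ) ^ m = 1 from hprim.pow_eq_one] at this)
  rw [hcomm, mul_assoc, hee] at hc
  have hcc : star c * c = 1 := by
    have h := hunit m
    rw [hc, star_smul, hes, smul_mul_smul_comm, hee] at h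
    have h' : (star c * c) • e = (1 : ℂ) • e := by rw [h, one_smul]
    exact smul_left_injective ℂ he.ne_zero h'
  obtain ⟨d, hd⟩ := IsAlgClosed.exists_pow_nat_eq (star c) hmpos
  have hdn : ‖d‖ = 1 := by
    have h1 : ‖c‖ * ‖c‖ = 1 := by
      have := congrArg norm hcc
      simpa using this
    have h2 : ‖c‖ = 1 := by nlinarith [norm_nonneg c]
    have h3 : ‖d‖ ^ m = 1 := by rw [← norm_pow, hd, norm_star, h2]
    exact (pow_eq_one_iff_of_nonneg (norm_nonneg d) hmpos.ne').mp h3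
  have hds := star_mul_self_of_norm hdn
  have hds' := mul_star_self_of_norm hdn
  set w : Op H := d • u with hw
  have hwT : Twisted K ω w := hu.smul d
  have hew : e * w = w := by rw [hw, mul_smul_comm, heu]
  have hwe : w * e = w := by rw [hw, smul_mul_assoc, hue]
  have hww : star w * w = e := by rw [hw, star_smul, smul_mul_smul_comm, hds, huu, one_smul]
  have hww' : w * star w = e := by rw [hw, star_smul, smul_mul_smul_comm, hds', huu', one_smul]
  have hunitw : ∀ j : ℕ, (w ^ j * e) * star (w ^ j * e) = e := by
    intro j
    have hcw : Commute e w := by rw [Commute, SemiconjBy, hew, hwe]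
    induction j with
    | zero => simp [hes, hee]
    | succ j ih =>
      have h1 : w ^ (j + 1) * e = w * (w ^ j * e) := by rw [pow_succ', mul_assoc]
      rw [h1, star_mul, mul_assoc, ← mul_assoc (w ^ j * e), ih, ← mul_assoc, hwe, hww']
  refine ⟨m, ω, w, hmpos, hprim, hwT, hew, hwe, hww, hww', ?_, ?_⟩
  · rw [hw, smul_pow, smul_mul_assoc, hc, smul_smul, hd, hcc, one_smul]
  · intro μ x hμ hx
    by_cases h0 : e * x * e = 0
    · exact ⟨0, 0, by simp [h0]⟩
    · have hμ0 : μ ≠ 0 := fun h => by simp [h] at hμ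
      have hmem : Units.mk0 μ hμ0 ∈ Γ := ⟨by simpa using hμ, x, by simpa using hx, h0⟩
      obtain ⟨j, hj⟩ := (isOfFinOrder_of_finite g).mem_powers_iff_mem_zpowers.mpr (hg ⟨_, hmem⟩)
      have hjω : ω ^ j = μ := by
        have := congrArg (fun z : Γ => ((z : ℂˣ) : ℂ)) hj
        simpa using this
      have hT : Twisted K μ (w ^ j * e) := by
        have := (hwT.pow j).mul he.twisted
        rwa [mul_one, hjω] at this
      obtain ⟨c, hc⟩ := eq_smul_of_twisted he hμ hx hT (by rw [mul_assoc, hee]) (hunitw j)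
      exact ⟨j, c, hc⟩

/-- The corner of an irreducible projection is spanned by orthogonal projections that the channel
permutes cyclically: the spectral projections `(1/m) ∑ⱼ ω^(-jk) uʲ` of the unitary `u` generating
the corner. -/
theorem exists_cyclic_projections {K : κ → Op H} (hK : ∑ i, star (K i) * K i = 1) {e : Op H}
    (he : IrreducibleProjection K e) :
    ∃ (m : ℕ) (q : ℕ → Op H), 0 < m ∧ q m = q 0 ∧ (∀ k, star (q k) = q k) ∧
      (∀ k < m, ∀ l < m, q k * q l = if k = l then q k else 0) ∧
      ∑ k ∈ Finset.range m, q k = e ∧ (∀ k i, K i * q (k + 1) = q k * K i) ∧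
      (∀ k < m, q k ≠ 0) ∧ (∀ k, q k ∈ gradedAlgebra K) ∧
      ∀ μ x, ‖μ‖ = 1 → Twisted K μ x →
        ∃ c : ℕ → ℂ, e * x * e = ∑ k ∈ Finset.range m, c k • q k := by
  obtain ⟨m, ω, u, hm, hω, hu, heu, hue, huu, huu', hum, hspan⟩ := exists_cyclic_unitary hK he
  have hee : e * e = e := he.isStarProjection.isIdempotentElem
  have hes : star e = e := he.isStarProjection.isSelfAdjoint.star_eq
  have hω0 : ω ≠ 0 := hω.ne_zero hm.ne'
  have hωn : ‖ω‖ = 1 := hω.norm'_eq_one hm.ne'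
  have hmC : (m : ℂ) ≠ 0 := by exact_mod_cast hm.ne'
  have hcomm : Commute e u := by rw [Commute, SemiconjBy, heu, hue]
  -- For an `m`-th root of unity `z`, the spectral projection of `u` for the eigenvalue `z⁻¹`.
  let p : ℂ → Op H := fun z => (m : ℂ)⁻¹ • ∑ j ∈ Finset.range m, z ^ j • (u ^ j * e)
  have hgeom : ∀ y : ℂ, y ^ m = 1 → ∑ j ∈ Finset.range m, y ^ j = if y = 1 then (m : ℂ) else 0 := by
    intro y hy
    split_ifs with h
    · simp [h]
    · have := geom_sum_mul y m
      rw [hy, sub_self] at this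
      exact (mul_eq_zero.mp this).resolve_right (sub_ne_zero.mpr h)
  have hup : ∀ z : ℂ, z ^ m = 1 → u * p z = z⁻¹ • p z := by
    intro z hz
    have hz0 : z ≠ 0 := fun h => by simp [h, hm.ne'] at hz
    simp only [p, mul_smul_comm, Finset.mul_sum]
    rw [smul_comm z⁻¹]
    congr 1
    have h1 : ∀ j, z ^ j • (u * (u ^ j * e)) = z⁻¹ • (z ^ (j + 1) • (u ^ (j + 1) * e)) := by
      intro j
      rw [smul_smul, pow_succ' z, ← mul_assoc z⁻¹, inv_mul_cancel₀ hz0, one_mul, pow_succ',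
        mul_assoc]
    simp only [h1]
    rw [← Finset.smul_sum]
    congr 1
    have h2 := Finset.sum_range_succ (fun j => z ^ j • (u ^ j * e)) m
    rw [Finset.sum_range_succ'] at h2
    simpa [hz, hum] using h2
  have hep : ∀ z, e * p z = p z := by
    intro z
    simp only [p, mul_smul_comm, Finset.mul_sum]
    congr 1
    refine Finset.sum_congr rfl fun j _ => ?_
    rw [← mul_assoc, (hcomm.pow_right j).eq, mul_assoc, hee]
  have husp : ∀ z : ℂ, z ^ m = 1 → ∀ j : ℕ, star (u ^ j * e) * p z = z ^ j • p z := by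
    intro z hz
    have hz0 : z ≠ 0 := fun h => by simp [h, hm.ne'] at hz
    have h1 : star u * p z = z • p z := by
      have h2 : star u * (u * p z) = p z := by rw [← mul_assoc, huu, hep]
      rw [hup z hz, mul_smul_comm] at h2
      rw [← h2, smul_smul, mul_inv_cancel₀ hz0, one_smul, h2]
    intro j
    rw [star_mul, hes, mul_assoc]
    have h3 : star (u ^ j) * p z = z ^ j • p z := by
      induction j with
      | zero => simp
      | succ j ih =>
        rw [pow_succ', star_mul, mul_assoc, h1, mul_smul_comm, ih, smul_smul, pow_succ']
    rw [h3, mul_smul_comm, hep]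
  have horth : ∀ z w : ℂ, z ^ m = 1 → w ^ m = 1 →
      star (p z) * p w = if z = w then p w else 0 := by
    intro z w hz hw
    have hzn : ‖z‖ = 1 := Complex.norm_eq_one_of_pow_eq_one hz hm.ne'
    have h1 : star (p z) * p w = (m : ℂ)⁻¹ • ((∑ j ∈ Finset.range m, (star z * w) ^ j) • p w) := by
      have e1 : star (p z) = (m : ℂ)⁻¹ • ∑ j ∈ Finset.range m, star z ^ j • star (u ^ j * e) := by
        simp only [p, star_smul, star_sum, star_pow]
        congr 1
        simp
      rw [e1, smul_mul_assoc, Finset.sum_mul, Finset.sum_smul]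
      congr 1
      refine Finset.sum_congr rfl fun j _ => ?_
      rw [smul_mul_assoc, husp w hw, smul_smul, mul_pow]
    have hy : (star z * w) ^ m = 1 := by rw [mul_pow, ← star_pow, hz, hw, star_one, one_mul]
    have hiff : star z * w = 1 ↔ z = w := by
      constructor
      · intro h
        have : z * (star z * w) = z := by rw [h, mul_one]
        rwa [← mul_assoc, mul_star_self_of_norm hzn, one_mul, eq_comm] at this
      · rintro rfl
        exact star_mul_self_of_norm hzn
    rw [h1, hgeom _ hy]
    simp only [hiff]
    split_ifs with h
    · rw [smul_smul, inv_mul_cancel₀ hmC, one_smul]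
    · simp
  have hsa : ∀ z : ℂ, z ^ m = 1 → star (p z) = p z := by
    intro z hz
    have h1 := horth z z hz hz
    rw [if_pos rfl] at h1
    have h2 := congrArg star h1
    rw [star_mul, star_star, h1] at h2
    exact h2.symm
  have hζ : ∀ k : ℕ, (ω⁻¹ ^ k) ^ m = 1 := fun k => by
    rw [← pow_mul, mul_comm, pow_mul, inv_pow, hω.pow_eq_one, inv_one, one_pow]
  have hζprim : IsPrimitiveRoot ω⁻¹ m := hω.inv
  have hsum : ∑ k ∈ Finset.range m, p (ω⁻¹ ^ k) = e := by
    simp only [p]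
    rw [← Finset.smul_sum, Finset.sum_comm]
    have h1 : ∀ j ∈ Finset.range m, ∑ k ∈ Finset.range m, (ω⁻¹ ^ k) ^ j • (u ^ j * e)
        = if j = 0 then (m : ℂ) • e else 0 := by
      intro j hj
      have h2 : ∑ k ∈ Finset.range m, (ω⁻¹ ^ k) ^ j = ∑ k ∈ Finset.range m, (ω⁻¹ ^ j) ^ k :=
        Finset.sum_congr rfl fun k _ => by rw [← pow_mul, ← pow_mul, mul_comm]
      rw [← Finset.sum_smul, h2, hgeom _ (hζ j)]
      by_cases h0 : j = 0
      · simp [h0]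
      · have : ω⁻¹ ^ j ≠ 1 := hζprim.pow_ne_one_of_pos_of_lt h0 (Finset.mem_range.mp hj)
        rw [if_neg this, if_neg h0, zero_smul]
    rw [Finset.sum_congr rfl h1, Finset.sum_ite_eq' (Finset.range m) 0,
      if_pos (Finset.mem_range.mpr hm), smul_smul, inv_mul_cancel₀ hmC, one_smul]
  have hKp : ∀ k i, K i * p (ω⁻¹ ^ (k + 1)) = p (ω⁻¹ ^ k) * K i := by
    intro k i
    simp only [p, mul_smul_comm, smul_mul_assoc, Finset.mul_sum, Finset.sum_mul]
    congr 1
    refine Finset.sum_congr rfl fun j _ => ?_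
    have hT := ((hu.pow j).mul he.twisted i).1
    rw [hT, smul_smul, mul_one, ← mul_pow, pow_succ, mul_assoc, inv_mul_cancel₀ hω0, mul_one]
  refine ⟨m, fun k => p (ω⁻¹ ^ k), hm, ?_, fun k => hsa _ (hζ k), ?_, hsum, hKp, ?_, ?_, ?_⟩
  · simp only [pow_zero, hζprim.pow_eq_one]
  · intro k hk l hl
    have h1 := horth _ _ (hζ k) (hζ l)
    rw [hsa _ (hζ k)] at h1
    simp only [h1]
    have hiff : ω⁻¹ ^ k = ω⁻¹ ^ l ↔ k = l := ⟨fun h => hζprim.pow_inj hk hl h, fun h => by rw [h]⟩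
    by_cases h : k = l
    · simp [h]
    · rw [if_neg (fun h' => h (hiff.mp h')), if_neg h]
  · intro k hk h0
    -- As the Kraus operators shift the projections, if one of them vanishes, all do.
    have hstep : ∀ k, p (ω⁻¹ ^ k) = 0 → p (ω⁻¹ ^ (k + 1)) = 0 := by
      intro k hk
      rw [← one_mul (p _), ← hK, Finset.sum_mul]
      refine Finset.sum_eq_zero fun i _ => ?_
      rw [mul_assoc, hKp, hk, zero_mul, mul_zero]
    have hall : ∀ n, p (ω⁻¹ ^ (k + n)) = 0 := by
      intro n
      induction n with
      | zero => exact h0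
      | succ n ih => exact hstep _ ih
    apply he.ne_zero
    rw [← hsum]
    refine Finset.sum_eq_zero fun l _ => ?_
    have hl := hall (m * k - k + l)
    rwa [← add_assoc, Nat.add_sub_cancel' (Nat.le_mul_of_pos_left k hm), pow_add, pow_mul,
      hζprim.pow_eq_one, one_pow, one_mul] at hl
  · intro k
    refine Submodule.smul_mem _ _ (Submodule.sum_mem _ fun j _ => Submodule.smul_mem _ _ ?_)
    exact ((hu.pow j).mul he.twisted).mem_gradedAlgebra (by simp [hωn])
  · intro μ x hμ hx
    obtain ⟨j, c, hc⟩ := hspan μ x hμ hx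
    refine ⟨fun k => c * (ω ^ k) ^ j, ?_⟩
    rw [hc, ← hsum, Finset.mul_sum, Finset.smul_sum]
    refine Finset.sum_congr rfl fun k _ => ?_
    have h1 : ∀ j : ℕ, u ^ j * p (ω⁻¹ ^ k) = (ω ^ k) ^ j • p (ω⁻¹ ^ k) := by
      intro j
      induction j with
      | zero => simp
      | succ j ih =>
        rw [pow_succ', mul_assoc, ih, mul_smul_comm, hup _ (hζ k), smul_smul, pow_succ, inv_pow,
          inv_inv]
    rw [h1, smul_smul]

end Cyclic

/-! ### Cyclic systems of matrix units -/

section Frame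

variable {H : Type*} [NormedAddCommGroup H] [InnerProductSpace ℂ H] [CompleteSpace H]
variable {κ : Type*}

/-- A system of matrix units for the graded algebra of the Kraus operators `K` on which the channel
acts by phases and cyclic shifts: with `vₐ = shift ℓ a` and `qₖ = proj ℓ k`, the matrix units are
`vₐ qₖ v_b†`. The label `ℓ` is a class of twisted-equivalent irreducible projections `vₐ vₐ†`, and
the `qₖ` are the minimal projections of the corner of a representative of that class. The last two
fields say that homogeneous elements are spanned by the matrix units. -/
structure CyclicFrame (K : κ → Op H) {L : ℕ} (d m : Fin L → ℕ) where
  phase : ∀ ℓ, Fin (d ℓ) → ℂ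
  shift : ∀ ℓ, Fin (d ℓ) → Op H
  proj : ∀ ℓ, Fin (m ℓ) → Op H
  d_pos : ∀ ℓ, 0 < d ℓ
  m_pos : ∀ ℓ, 0 < m ℓ
  norm_phase : ∀ ℓ a, ‖phase ℓ a‖ = 1
  twisted : ∀ ℓ a, Twisted K (phase ℓ a) (shift ℓ a)
  shift_mul_proj : ∀ ℓ a, shift ℓ a * ∑ k, proj ℓ k = shift ℓ a
  star_shift_mul_self : ∀ ℓ a, star (shift ℓ a) * shift ℓ a = ∑ k, proj ℓ k
  star_shift_mul : ∀ p p' : Σ ℓ, Fin (d ℓ), p ≠ p' →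
    star (shift p.1 p.2) * shift p'.1 p'.2 = 0
  sum_shift : ∑ p : Σ ℓ, Fin (d ℓ), shift p.1 p.2 * star (shift p.1 p.2) = 1
  star_proj : ∀ ℓ k, star (proj ℓ k) = proj ℓ k
  proj_mul : ∀ ℓ k l, proj ℓ k * proj ℓ l = if k = l then proj ℓ k else 0
  proj_ne_zero : ∀ ℓ k, proj ℓ k ≠ 0
  proj_mem : ∀ ℓ k, proj ℓ k ∈ gradedAlgebra K
  proj_intertwine : ∀ ℓ k i, K i * proj ℓ (finRotate (m ℓ) k) = proj ℓ k * K i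
  compress_same : ∀ μ x, ‖μ‖ = 1 → Twisted K μ x → ∀ ℓ a b,
    ∃ c : Fin (m ℓ) → ℂ, star (shift ℓ a) * x * shift ℓ b = ∑ k, c k • proj ℓ k
  compress_ne : ∀ μ x, ‖μ‖ = 1 → Twisted K μ x → ∀ ℓ ℓ' a b, ℓ ≠ ℓ' →
    star (shift ℓ a) * x * shift ℓ' b = 0

/-- Two irreducible projections are equivalent if some element of unimodular degree connects
them. -/
def TwistedEquiv (K : κ → Op H) (f g : Op H) : Prop :=
  ∃ μ : ℂ, ‖μ‖ = 1 ∧ ∃ x, Twisted K μ x ∧ f * x * g ≠ 0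

theorem twistedEquiv_equivalence {K : κ → Op H} {ι : Type*} {f : ι → Op H}
    (hf : ∀ a, IrreducibleProjection K (f a)) :
    Equivalence fun a b => TwistedEquiv K (f a) (f b) := by
  refine ⟨fun a => ⟨1, by simp, 1, Twisted.one, ?_⟩, ?_, ?_⟩
  · rw [mul_one, show f a * f a = f a from (hf a).isStarProjection.isIdempotentElem]
    exact (hf a).ne_zero
  · rintro a b ⟨μ, hμ, x, hx, h0⟩
    refine ⟨star μ, by simpa using hμ, star x, hx.star hμ, fun h => h0 ?_⟩
    have := congrArg star h
    simpa [(hf a).isStarProjection.isSelfAdjoint.star_eq,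
      (hf b).isStarProjection.isSelfAdjoint.star_eq, mul_assoc] using this
  · rintro a b c ⟨μ, hμ, x, hx, hx0⟩ ⟨ν, hν, y, hy, hy0⟩
    obtain ⟨u, hu, hau, hub, huu, -⟩ := exists_partial_isometry (hf b) (hf a) hμ hx hx0
    obtain ⟨v, hv, hbv, hvc, hvv, -⟩ := exists_partial_isometry (hf c) (hf b) hν hy hy0
    refine ⟨μ * ν, by simp [hμ, hν], u * v, hu.mul hv, fun h => (hf c).ne_zero ?_⟩
    rw [← mul_assoc, hau, mul_assoc, hvc] at h
    rw [← hvv, ← hbv, ← huu, mul_assoc, h, mul_zero, mul_zero]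

namespace CyclicFrame

variable {K : κ → Op H} {L : ℕ} {d m : Fin L → ℕ} (F : CyclicFrame K d m)

/-- The matrix unit `vₐ qₖ v_b†`. -/
noncomputable def unit (ℓ : Fin L) (k : Fin (m ℓ)) (a b : Fin (d ℓ)) : Op H :=
  F.shift ℓ a * F.proj ℓ k * star (F.shift ℓ b)

theorem unit_mem (ℓ : Fin L) (k : Fin (m ℓ)) (a b : Fin (d ℓ)) :
    F.unit ℓ k a b ∈ gradedAlgebra K :=
  gradedAlgebra_mul (gradedAlgebra_mul
    ((F.twisted ℓ a).mem_gradedAlgebra (F.norm_phase ℓ a)) (F.proj_mem ℓ k))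
    (((F.twisted ℓ b).star (F.norm_phase ℓ b)).mem_gradedAlgebra (by simp [F.norm_phase ℓ b]))

/-- Cut a homogeneous element by the resolution of the identity `∑ vₐ vₐ† = 1`. -/
theorem gradedAlgebra_le_span : gradedAlgebra K ≤ Submodule.span ℂ
    {x | ∃ ℓ k a b, x = F.unit ℓ k a b} := by
  refine Submodule.span_le.mpr ?_
  rintro x ⟨μ, hμ, hx⟩
  have h1 : x = ∑ p : Σ ℓ, Fin (d ℓ), ∑ p' : Σ ℓ, Fin (d ℓ), F.shift p.1 p.2 *
      (star (F.shift p.1 p.2) * x * F.shift p'.1 p'.2) * star (F.shift p'.1 p'.2) := by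
    conv_lhs => rw [← one_mul x, ← mul_one (1 * x), ← F.sum_shift, Finset.sum_mul,
      Finset.sum_mul_sum]
    simp only [mul_assoc]
  rw [SetLike.mem_coe, h1]
  refine Submodule.sum_mem _ fun p _ => Submodule.sum_mem _ fun p' _ => ?_
  obtain ⟨ℓ, a⟩ := p
  obtain ⟨ℓ', b⟩ := p'
  by_cases h : ℓ = ℓ'
  · subst h
    obtain ⟨c, hc⟩ := F.compress_same μ x hμ hx ℓ a b
    simp only [hc, Finset.mul_sum, Finset.sum_mul, mul_smul_comm, smul_mul_assoc]
    exact Submodule.sum_mem _ fun k _ => Submodule.smul_mem _ _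
      (Submodule.subset_span ⟨ℓ, k, a, b, rfl⟩)
  · simp only [F.compress_ne μ x hμ hx ℓ ℓ' a b h, mul_zero, zero_mul, Submodule.zero_mem]

variable [Fintype κ]

/-- The channel shifts the projections cyclically and multiplies matrix units by phases. -/
theorem krausMap_unit_mul (ℓ : Fin L) (k : Fin (m ℓ)) (a b : Fin (d ℓ)) (X : Op H) :
    krausMap K (F.unit ℓ (finRotate (m ℓ) k) a b * X) =
      (F.phase ℓ a * star (F.phase ℓ b)) • (F.unit ℓ k a b * krausMap K X) := by
  simp only [krausMap_apply, Finset.mul_sum, Finset.smul_sum]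
  refine Finset.sum_congr rfl fun i _ => ?_
  have h1 : K i * F.unit ℓ (finRotate (m ℓ) k) a b =
      (F.phase ℓ a * star (F.phase ℓ b)) • (F.unit ℓ k a b * K i) := by
    rw [unit, unit, ← mul_assoc, ← mul_assoc, (F.twisted ℓ a i).1, smul_mul_assoc,
      mul_assoc _ (K i),
      F.proj_intertwine, smul_mul_assoc, mul_assoc, mul_assoc _ (K i),
      ((F.twisted ℓ b).star (F.norm_phase ℓ b) i).1]
    simp only [mul_smul_comm, smul_smul, mul_assoc]
  rw [← mul_assoc, h1]
  simp only [smul_mul_assoc, mul_assoc]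

end CyclicFrame

variable [FiniteDimensional ℂ H] [Fintype κ]

/-- Group an orthogonal decomposition of `1` into irreducible projections by twisted equivalence,
and transport the cyclic projections of one representative to its whole class. -/
theorem exists_cyclicFrame {K : κ → Op H} (hK : ∑ i, star (K i) * K i = 1) :
    ∃ (L : ℕ) (d m : Fin L → ℕ), Nonempty (CyclicFrame K d m) := by
  classical
  obtain ⟨ι, _, f, hf, horth, hsum⟩ := exists_irreducible_decomposition K _ 1
    ⟨mul_one 1, star_one _⟩ Twisted.one (Nat.lt_succ_self _)
  have hfs : ∀ a, star (f a) = f a := fun a => (hf a).isStarProjection.isSelfAdjoint.star_eq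
  let s : Setoid ι := ⟨fun a b => TwistedEquiv K (f a) (f b), twistedEquiv_equivalence hf⟩
  have hrel : ∀ a b : ι, (Quotient.mk s a = Quotient.mk s b) ↔ TwistedEquiv K (f a) (f b) :=
    fun a b => Quotient.eq
  let rep : Quotient s → ι := Quotient.out
  have hv : ∀ a : ι, ∃ (μ : ℂ) (v : Op H), ‖μ‖ = 1 ∧ Twisted K μ v ∧ f a * v = v ∧
      v * f (rep (Quotient.mk s a)) = v ∧ star v * v = f (rep (Quotient.mk s a)) ∧
      v * star v = f a := by
    intro a
    obtain ⟨μ, hμ, x, hx, h0⟩ := (hrel a (rep (Quotient.mk s a))).mp (Quotient.out_eq _).symm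
    obtain ⟨v, h1, h2, h3, h4, h5⟩ := exists_partial_isometry (hf _) (hf a) hμ hx h0
    exact ⟨μ, v, hμ, h1, h2, h3, h4, h5⟩
  choose μ v hμ hvT hfv hvf hvv hvv' using hv
  choose m q hm hqm hqs hqq hqsum hqK hq0 hqN hqspan using
    fun c : Quotient s => exists_cyclic_projections hK (hf (rep c))
  let eL : Fin (Fintype.card (Quotient s)) ≃ Quotient s := (Fintype.equivFin _).symm
  let ed : ∀ ℓ, Fin (Fintype.card {a // Quotient.mk s a = eL ℓ}) ≃ {a // Quotient.mk s a = eL ℓ} :=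
    fun ℓ => (Fintype.equivFin _).symm
  let e : (Σ ℓ, Fin (Fintype.card {a // Quotient.mk s a = eL ℓ})) ≃ ι :=
    (Equiv.sigmaCongr eL ed).trans (Equiv.sigmaFiberEquiv (Quotient.mk s))
  have hcls : ∀ ℓ a, Quotient.mk s (ed ℓ a).1 = eL ℓ := fun ℓ a => (ed ℓ a).2
  have hvf' : ∀ ℓ a, v (ed ℓ a) * f (rep (eL ℓ)) = v (ed ℓ a) := fun ℓ a =>
    (congrArg (fun c => v (ed ℓ a) * f (rep c)) (hcls ℓ a)).symm.trans (hvf _)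
  have hqfin : ∀ c : Quotient s, ∑ k : Fin (m c), q c k = f (rep c) := fun c => by
    rw [← hqsum c, Finset.sum_range]
  -- `finRotate` is `k ↦ k + 1`, with wrap-around because `q m = q 0`.
  have hrot : ∀ (c : Quotient s) (k : Fin (m c)), q c (finRotate (m c) k : Fin (m c)) =
      q c (k + 1) := by
    intro c k
    obtain ⟨n, hn⟩ : ∃ n, m c = n + 1 := ⟨m c - 1, (Nat.succ_pred_eq_of_pos (hm c)).symm⟩
    have hqm' := hqm c
    generalize q c = q at hqm'
    generalize m c = M at hn hqm' k
    subst hn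
    rw [coe_finRotate]
    split_ifs with h
    · rw [h, Fin.val_last, hqm']
    · rfl
  refine ⟨_, fun ℓ => Fintype.card {a // Quotient.mk s a = eL ℓ}, fun ℓ => m (eL ℓ), ⟨{
    phase := fun ℓ a => μ (ed ℓ a)
    shift := fun ℓ a => v (ed ℓ a)
    proj := fun ℓ k => q (eL ℓ) k
    d_pos := fun ℓ => ?_
    m_pos := fun ℓ => hm _
    norm_phase := fun ℓ a => hμ _
    twisted := fun ℓ a => hvT _
    shift_mul_proj := fun ℓ a => ?_
    star_shift_mul_self := fun ℓ a => ?_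
    star_shift_mul := ?_
    sum_shift := ?_
    star_proj := fun ℓ k => hqs _ _
    proj_mul := fun ℓ k l => ?_
    proj_ne_zero := fun ℓ k => hq0 _ _ k.2
    proj_mem := fun ℓ k => hqN _ _
    proj_intertwine := fun ℓ k i => ?_
    compress_same := fun ν x hν hx ℓ a b => ?_
    compress_ne := fun ν x hν hx ℓ ℓ' a b hne => ?_ }⟩⟩
  · rw [Fintype.card_pos_iff]
    exact ⟨⟨rep (eL ℓ), Quotient.out_eq _⟩⟩
  · rw [hqfin]
    exact hvf' ℓ a
  · rw [hqfin]
    exact (hvv _).trans (congrArg (fun c => f (rep c)) (hcls ℓ a))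
  · rintro ⟨ℓ, a⟩ ⟨ℓ', a'⟩ hne
    have hne' : (ed ℓ a).1 ≠ (ed ℓ' a').1 := fun h => hne (e.injective h)
    change star (v (ed ℓ a)) * v (ed ℓ' a') = 0
    rw [← hfv (ed ℓ a), ← hfv (ed ℓ' a'), star_mul, hfs, mul_assoc, ← mul_assoc (f _),
      horth _ _ hne', zero_mul, mul_zero]
  · rw [← hsum]
    refine Fintype.sum_equiv e _ _ fun p => ?_
    exact hvv' _
  · rw [hqq _ _ k.2 _ l.2]
    simp only [Fin.val_inj]
  · rw [hrot, hqK]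
  · have hT : Twisted K (star (μ (ed ℓ a)) * ν * μ (ed ℓ b)) (star (v (ed ℓ a)) * x * v (ed ℓ b)) :=
      (((hvT _).star (hμ _)).mul hx).mul (hvT _)
    obtain ⟨c, hc⟩ := hqspan (eL ℓ) _ _ (by simp [hμ, hν]) hT
    refine ⟨fun k => c k, ?_⟩
    have h1 : f (rep (eL ℓ)) * star (v (ed ℓ a)) = star (v (ed ℓ a)) := by
      rw [← hfs, ← star_mul, hvf']
    rw [← mul_assoc, ← mul_assoc, h1, mul_assoc, hvf', Finset.sum_range] at hc
    exact hc
  · have hne' : ¬ TwistedEquiv K (f (ed ℓ a)) (f (ed ℓ' b)) := fun h => hne (eL.injective (by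
      rw [← hcls ℓ a, ← hcls ℓ' b]; exact (hrel _ _).mpr h))
    have h0 : f (ed ℓ a) * x * f (ed ℓ' b) = 0 := by
      by_contra h
      exact hne' ⟨ν, hν, x, hx, h⟩
    change star (v (ed ℓ a)) * x * v (ed ℓ' b) = 0
    rw [← hfv (ed ℓ a), ← hfv (ed ℓ' b), star_mul, hfs]
    calc _ = star (v (ed ℓ a)) * (f (ed ℓ a) * x * f (ed ℓ' b)) * v (ed ℓ' b) := by
          simp only [mul_assoc]
      _ = 0 := by rw [h0, mul_zero, zero_mul]

end Frame

/-! ### The adapted orthonormal basis -/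

section Coordinates

open Matrix

variable {H : Type*} [NormedAddCommGroup H] [InnerProductSpace ℂ H]

theorem mat_apply {ι : Type*} [Fintype ι] [DecidableEq ι] (b : OrthonormalBasis ι ℂ H) (X : Op H)
    (i j : ι) : mat b X i j = inner ℂ (b i) (X (b j)) := by
  rw [mat, LinearMap.toMatrix_apply, OrthonormalBasis.coe_toBasis_repr_apply,
    OrthonormalBasis.repr_apply_apply, OrthonormalBasis.coe_toBasis]
  rfl

theorem span_range_coe {S : Submodule ℂ H} {ι : Type*} [Fintype ι] (b : OrthonormalBasis ι ℂ S) :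
    Submodule.span ℂ (Set.range fun i => (b i : H)) = S := by
  have h : (Set.range fun i => (b i : H)) = S.subtype '' Set.range b := by
    rw [← Set.range_comp]
    rfl
  rw [h, Submodule.span_image, ← b.coe_toBasis, b.toBasis.span_eq, Submodule.map_top,
    Submodule.range_subtype]

namespace CyclicFrame

variable [CompleteSpace H] {κ : Type*}
variable {K : κ → Op H} {L : ℕ} {d m : Fin L → ℕ} (F : CyclicFrame K d m)

theorem inner_proj_left (ℓ : Fin L) (k : Fin (m ℓ)) (v w : H) :
    inner ℂ (F.proj ℓ k v) w = (inner ℂ v (F.proj ℓ k w) : ℂ) := by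
  conv_lhs => rw [← F.star_proj ℓ k, ContinuousLinearMap.star_eq_adjoint]
  exact ContinuousLinearMap.adjoint_inner_left _ _ _

theorem inner_shift (p p' : Σ ℓ, Fin (d ℓ)) (v w : H) :
    inner ℂ (F.shift p.1 p.2 v) (F.shift p'.1 p'.2 w) =
      (inner ℂ v ((star (F.shift p.1 p.2) * F.shift p'.1 p'.2) w) : ℂ) := by
  rw [ContinuousLinearMap.star_eq_adjoint]
  exact (ContinuousLinearMap.adjoint_inner_right (F.shift p.1 p.2) v _).symm

variable [FiniteDimensional ℂ H]

/-- The rank of the projection `qₖ`. -/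
noncomputable def rank (ℓ : Fin L) (k : Fin (m ℓ)) : ℕ :=
  Module.finrank ℂ (LinearMap.range (F.proj ℓ k : H →ₗ[ℂ] H))

/-- An orthonormal basis of the range of `qₖ`. -/
noncomputable def rangeVec (ℓ : Fin L) (k : Fin (m ℓ)) (j : Fin (F.rank ℓ k)) : H :=
  stdOrthonormalBasis ℂ (LinearMap.range (F.proj ℓ k : H →ₗ[ℂ] H)) j

theorem proj_rangeVec (ℓ : Fin L) (k : Fin (m ℓ)) (j : Fin (F.rank ℓ k)) :
    F.proj ℓ k (F.rangeVec ℓ k j) = F.rangeVec ℓ k j := by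
  obtain ⟨w, hw⟩ := (stdOrthonormalBasis ℂ (LinearMap.range (F.proj ℓ k : H →ₗ[ℂ] H)) j).2
  have h1 : F.rangeVec ℓ k j = F.proj ℓ k w := hw.symm
  have h2 := F.proj_mul ℓ k k
  rw [if_pos rfl] at h2
  rw [h1]
  change (F.proj ℓ k * F.proj ℓ k) w = _
  rw [h2]

theorem proj_rangeVec_of_ne (ℓ : Fin L) {k k' : Fin (m ℓ)} (h : k' ≠ k) (j : Fin (F.rank ℓ k)) :
    F.proj ℓ k' (F.rangeVec ℓ k j) = 0 := by
  rw [← proj_rangeVec]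
  change (F.proj ℓ k' * F.proj ℓ k) _ = _
  rw [F.proj_mul, if_neg h]
  rfl

theorem sum_proj_rangeVec (ℓ : Fin L) (k : Fin (m ℓ)) (j : Fin (F.rank ℓ k)) :
    (∑ k', F.proj ℓ k') (F.rangeVec ℓ k j) = F.rangeVec ℓ k j := by
  rw [_root_.sum_apply, Finset.sum_eq_single k, proj_rangeVec]
  · exact fun k' _ h => F.proj_rangeVec_of_ne ℓ h j
  · simp

theorem orthonormal_rangeVec (ℓ : Fin L) (k : Fin (m ℓ)) : Orthonormal ℂ (F.rangeVec ℓ k) :=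
  (stdOrthonormalBasis ℂ (LinearMap.range (F.proj ℓ k : H →ₗ[ℂ] H))).orthonormal.comp_linearIsometry
    (LinearMap.range (F.proj ℓ k : H →ₗ[ℂ] H)).subtypeₗᵢ

theorem inner_rangeVec (ℓ : Fin L) (x y : Σ k, Fin (F.rank ℓ k)) :
    inner ℂ (F.rangeVec ℓ x.1 x.2) (F.rangeVec ℓ y.1 y.2) = if x = y then (1 : ℂ) else 0 := by
  obtain ⟨k, i⟩ := x
  obtain ⟨k', j⟩ := y
  by_cases h : k = k'
  · subst h
    refine (orthonormal_iff_ite.mp (F.orthonormal_rangeVec ℓ k) i j).trans ?_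
    by_cases hij : i = j
    · rw [if_pos hij, if_pos (by rw [hij])]
    · rw [if_neg hij]
      exact (if_neg fun e : (⟨k, i⟩ : Σ k, Fin (F.rank ℓ k)) = ⟨k, j⟩ =>
        hij (eq_of_heq (Sigma.mk.inj_iff.mp e).2)).symm
  · rw [if_neg fun e => h (congrArg Sigma.fst e)]
    simp only
    rw [← F.proj_rangeVec ℓ k i, inner_proj_left, F.proj_rangeVec_of_ne ℓ h j, inner_zero_right]

/-- The orthonormal basis vector `vₐ f`, with `f` in the chosen basis of the range of `qₖ`. -/
noncomputable def basisVec (p : Σ ℓ, Fin (d ℓ) × Σ k, Fin (F.rank ℓ k)) : H :=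
  F.shift p.1 p.2.1 (F.rangeVec p.1 p.2.2.1 p.2.2.2)

theorem orthonormal_basisVec : Orthonormal ℂ F.basisVec := by
  classical
  rw [orthonormal_iff_ite]
  rintro ⟨ℓ, a, x⟩ ⟨ℓ', a', y⟩
  have h1 := F.inner_shift ⟨ℓ, a⟩ ⟨ℓ', a'⟩ (F.rangeVec ℓ x.1 x.2) (F.rangeVec ℓ' y.1 y.2)
  simp only [basisVec]
  rw [h1]
  by_cases h : (⟨ℓ, a⟩ : Σ ℓ, Fin (d ℓ)) = ⟨ℓ', a'⟩
  · obtain ⟨rfl, ha⟩ := Sigma.mk.inj_iff.mp h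
    obtain rfl := eq_of_heq ha
    simp only
    rw [F.star_shift_mul_self, F.sum_proj_rangeVec, inner_rangeVec]
    by_cases hxy : x = y
    · simp [hxy]
    · rw [if_neg hxy, if_neg]
      intro e
      obtain ⟨-, e⟩ := Sigma.mk.inj_iff.mp e
      exact hxy (congrArg Prod.snd (eq_of_heq e))
  · rw [F.star_shift_mul _ _ h, if_neg]
    · simp
    · intro e
      obtain ⟨rfl, e⟩ := Sigma.mk.inj_iff.mp e
      have e' := congrArg Prod.fst (eq_of_heq e)
      simp only at e'
      exact h (by rw [e'])

theorem proj_apply_mem_span (ℓ : Fin L) (k : Fin (m ℓ)) (v : H) :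
    F.proj ℓ k v ∈ Submodule.span ℂ (Set.range (F.rangeVec ℓ k)) := by
  have h : F.proj ℓ k v ∈ LinearMap.range (F.proj ℓ k : H →ₗ[ℂ] H) := ⟨v, rfl⟩
  rw [← span_range_coe (stdOrthonormalBasis ℂ (LinearMap.range (F.proj ℓ k : H →ₗ[ℂ] H)))] at h
  exact h

theorem span_basisVec : ⊤ ≤ Submodule.span ℂ (Set.range F.basisVec) := by
  intro x _
  have h1 : x = ∑ p : Σ ℓ, Fin (d ℓ), ∑ k, F.shift p.1 p.2 (F.proj p.1 k
      (star (F.shift p.1 p.2) x)) := by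
    have h2 : ∀ p : Σ ℓ, Fin (d ℓ), F.shift p.1 p.2 * star (F.shift p.1 p.2) =
        ∑ k, F.shift p.1 p.2 * F.proj p.1 k * star (F.shift p.1 p.2) := fun p => by
      rw [← Finset.sum_mul, ← Finset.mul_sum, F.shift_mul_proj]
    have h3 : x = (∑ p : Σ ℓ, Fin (d ℓ), F.shift p.1 p.2 * star (F.shift p.1 p.2)) x := by
      rw [F.sum_shift]; rfl
    conv_lhs => rw [h3]
    simp only [h2, _root_.sum_apply]
    rfl
  rw [h1]
  refine Submodule.sum_mem _ fun p _ => Submodule.sum_mem _ fun k _ => ?_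
  have h4 : Submodule.span ℂ (Set.range (F.rangeVec p.1 k)) ≤
      (Submodule.span ℂ (Set.range F.basisVec)).comap (F.shift p.1 p.2 : H →ₗ[ℂ] H) := by
    rw [Submodule.span_le]
    rintro _ ⟨j, rfl⟩
    exact Submodule.subset_span ⟨⟨p.1, p.2, k, j⟩, rfl⟩
  exact h4 (F.proj_apply_mem_span p.1 k _)

/-- The orthonormal basis adapted to a cyclic frame. -/
noncomputable def basis : OrthonormalBasis (Σ ℓ, Fin (d ℓ) × Σ k, Fin (F.rank ℓ k)) ℂ H :=
  OrthonormalBasis.mk F.orthonormal_basisVec F.span_basisVec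

theorem basis_apply (ℓ : Fin L) (a : Fin (d ℓ)) (x : Σ k, Fin (F.rank ℓ k)) :
    F.basis ⟨ℓ, a, x⟩ = F.shift ℓ a (F.rangeVec ℓ x.1 x.2) := by
  rw [basis, OrthonormalBasis.coe_mk]
  rfl

/-- The compression of `τ` to the range of `qₖ`, as a matrix. -/
noncomputable def gram (τ : Op H) (ℓ : Fin L) (k : Fin (m ℓ)) :
    Matrix (Fin (F.rank ℓ k)) (Fin (F.rank ℓ k)) ℂ :=
  of fun i j => inner ℂ (F.rangeVec ℓ k i) (τ (F.rangeVec ℓ k j))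

theorem gram_posDef {τ : Op H} (hτ : 0 ≤ τ) (hu : IsUnit τ) (ℓ : Fin L) (k : Fin (m ℓ)) :
    (F.gram τ ℓ k).PosDef := by
  have hsa : star τ = τ := (IsSelfAdjoint.of_nonneg hτ).star_eq
  have hform : ∀ x : Fin (F.rank ℓ k) → ℂ, star x ⬝ᵥ (F.gram τ ℓ k *ᵥ x) =
      inner ℂ (∑ i, x i • F.rangeVec ℓ k i) (τ (∑ i, x i • F.rangeVec ℓ k i)) := by
    intro x
    simp only [dotProduct, mulVec, gram, of_apply, map_sum, map_smul, sum_inner, inner_sum,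
      inner_smul_left, inner_smul_right, Finset.mul_sum, Pi.star_apply]
    rw [Finset.sum_comm]
    refine Finset.sum_congr rfl fun i _ => Finset.sum_congr rfl fun j _ => ?_
    rw [RCLike.star_def]
    ring
  refine PosDef.of_dotProduct_mulVec_pos ?_ fun x hx => ?_
  · ext i j
    simp only [gram, conjTranspose_apply, of_apply]
    rw [RCLike.star_def, inner_conj_symm]
    conv_lhs => rw [← hsa, ContinuousLinearMap.star_eq_adjoint]
    exact ContinuousLinearMap.adjoint_inner_left τ _ _
  · rw [hform]
    have hv : ∑ i, x i • F.rangeVec ℓ k i ≠ 0 := by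
      intro h
      apply hx
      ext i
      have h2 : ∀ j, (inner ℂ (F.rangeVec ℓ k i) (F.rangeVec ℓ k j) : ℂ) =
          if i = j then 1 else 0 := fun j => by
        simpa using F.inner_rangeVec ℓ ⟨k, i⟩ ⟨k, j⟩
      have h3 := congrArg (fun v => (inner ℂ (F.rangeVec ℓ k i) v : ℂ)) h
      simpa [inner_sum, inner_smul_right, h2] using h3
    generalize ∑ i, x i • F.rangeVec ℓ k i = v at hv ⊢
    have hnn : 0 ≤ (inner ℂ v (τ v) : ℂ) :=
      ((ContinuousLinearMap.nonneg_iff_isPositive τ).mp hτ).inner_nonneg_right v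
    refine lt_of_le_of_ne hnn fun h => hv ?_
    have h0 : τ v = 0 := apply_eq_zero_of_nonneg hτ (by rw [← h]; simp)
    exact ((ContinuousLinearMap.isUnit_iff_bijective).mp hu).1 (by rw [h0, map_zero])

theorem rank_pos (ℓ : Fin L) (k : Fin (m ℓ)) : 0 < F.rank ℓ k := by
  rw [rank, Module.finrank_pos_iff, Submodule.nontrivial_iff_ne_bot]
  intro h
  apply F.proj_ne_zero ℓ k
  ext v
  have h1 : F.proj ℓ k v ∈ LinearMap.range (F.proj ℓ k : H →ₗ[ℂ] H) := ⟨v, rfl⟩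
  rw [h] at h1
  simpa using h1

/-- In the adapted basis, `vₐ qₖ v_b† τ` is `|a⟩⟨b| ⊗ (0 ⊕ ⋯ ⊕ τₖ ⊕ ⋯ ⊕ 0)`. -/
theorem mat_unit_mul {τ : Op H} (hτ : ∀ x ∈ gradedAlgebra K, Commute x τ) (ℓ : Fin L)
    (k : Fin (m ℓ)) (a b : Fin (d ℓ)) :
    mat F.basis (F.unit ℓ k a b * τ) =
      blockDiagonal' (Pi.single ℓ (Matrix.single a b 1 ⊗ₖ hatState (F.gram τ ℓ) k)) := by
  ext ⟨ℓ₁, a₁, k₁, j₁⟩ ⟨ℓ₂, a₂, k₂, j₂⟩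
  rw [mat_apply, basis_apply, basis_apply]
  have hcs : F.shift ℓ₂ a₂ * τ = τ * F.shift ℓ₂ a₂ :=
    hτ _ ((F.twisted ℓ₂ a₂).mem_gradedAlgebra (F.norm_phase ℓ₂ a₂))
  have e1 : (inner ℂ (F.shift ℓ₁ a₁ (F.rangeVec ℓ₁ k₁ j₁))
      ((F.unit ℓ k a b * τ) (F.shift ℓ₂ a₂ (F.rangeVec ℓ₂ k₂ j₂))) : ℂ) =
      inner ℂ (F.rangeVec ℓ₁ k₁ j₁) ((star (F.shift ℓ₁ a₁) * F.shift ℓ a * F.proj ℓ k *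
        (star (F.shift ℓ b) * F.shift ℓ₂ a₂) * τ) (F.rangeVec ℓ₂ k₂ j₂)) := by
    have e2 : star (F.shift ℓ₁ a₁) * F.shift ℓ a * F.proj ℓ k *
        (star (F.shift ℓ b) * F.shift ℓ₂ a₂) * τ =
        star (F.shift ℓ₁ a₁) * (F.unit ℓ k a b * τ * F.shift ℓ₂ a₂) := by
      rw [unit]
      simp only [mul_assoc, hcs]
    rw [e2, ContinuousLinearMap.star_eq_adjoint (F.shift ℓ₁ a₁)]
    exact (ContinuousLinearMap.adjoint_inner_right (F.shift ℓ₁ a₁) _ _).symm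
  rw [e1]
  by_cases h1 : (⟨ℓ₁, a₁⟩ : Σ ℓ, Fin (d ℓ)) = ⟨ℓ, a⟩
  swap
  · have h0 := F.star_shift_mul _ _ h1
    simp only at h0
    rw [h0]
    simp only [zero_mul, _root_.zero_apply, inner_zero_right]
    by_cases h : ℓ₁ = ℓ₂
    · subst h
      rw [blockDiagonal'_apply_eq]
      by_cases hl : ℓ₁ = ℓ
      · subst hl
        have ha : a ≠ a₁ := fun e => h1 (by rw [e])
        simp [kroneckerMap_apply, Matrix.single, ha]
      · simp [Pi.single_eq_of_ne hl]
    · rw [blockDiagonal'_apply_ne _ _ _ h]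
  obtain ⟨rfl, ha⟩ := Sigma.mk.inj_iff.mp h1
  obtain rfl := eq_of_heq ha
  by_cases h2 : (⟨ℓ₁, b⟩ : Σ ℓ, Fin (d ℓ)) = ⟨ℓ₂, a₂⟩
  swap
  · have h0 := F.star_shift_mul _ _ h2
    simp only at h0
    rw [h0]
    simp only [mul_zero, zero_mul, _root_.zero_apply, inner_zero_right]
    by_cases h : ℓ₁ = ℓ₂
    · subst h
      have hb : b ≠ a₂ := fun e => h2 (by rw [e])
      rw [blockDiagonal'_apply_eq]
      simp [kroneckerMap_apply, Matrix.single, hb]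
    · rw [blockDiagonal'_apply_ne _ _ _ h]
  obtain ⟨rfl, hb⟩ := Sigma.mk.inj_iff.mp h2
  obtain rfl := eq_of_heq hb
  have hqτ : F.proj ℓ₁ k * τ = τ * F.proj ℓ₁ k := hτ _ (F.proj_mem ℓ₁ k)
  have hsum : (∑ k', F.proj ℓ₁ k') * F.proj ℓ₁ k = F.proj ℓ₁ k := by
    rw [Finset.sum_mul, Finset.sum_eq_single k]
    · rw [F.proj_mul, if_pos rfl]
    · intro k' _ h
      rw [F.proj_mul, if_neg h]
    · simp
  have hsum' : F.proj ℓ₁ k * (∑ k', F.proj ℓ₁ k') = F.proj ℓ₁ k := by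
    have := congrArg star hsum
    simpa [star_sum, F.star_proj] using this
  rw [F.star_shift_mul_self, F.star_shift_mul_self, hsum, hsum', blockDiagonal'_apply_eq,
    Pi.single_eq_same, kroneckerMap_apply, Matrix.single_apply_same, one_mul, hatState]
  by_cases hk₁ : k₁ = k
  swap
  · have h0 : (inner ℂ (F.rangeVec ℓ₁ k₁ j₁)
        ((F.proj ℓ₁ k * τ) (F.rangeVec ℓ₁ k₂ j₂)) : ℂ) = 0 := by
      change (inner ℂ _ (F.proj ℓ₁ k (τ _)) : ℂ) = 0
      rw [← inner_proj_left, F.proj_rangeVec_of_ne ℓ₁ (Ne.symm hk₁), inner_zero_left]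
    rw [h0]
    by_cases h : k₁ = k₂
    · subst h
      rw [blockDiagonal'_apply_eq, Pi.single_eq_of_ne hk₁, Matrix.zero_apply]
    · rw [blockDiagonal'_apply_ne _ _ _ h]
  subst hk₁
  by_cases hk₂ : k₁ = k₂
  swap
  · rw [blockDiagonal'_apply_ne _ _ _ hk₂, hqτ]
    change (inner ℂ _ (τ (F.proj ℓ₁ k₁ _)) : ℂ) = 0
    rw [F.proj_rangeVec_of_ne ℓ₁ hk₂, map_zero, inner_zero_right]
  subst hk₂
  rw [blockDiagonal'_apply_eq, Pi.single_eq_same, hqτ]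
  change (inner ℂ _ (τ (F.proj ℓ₁ k₁ _)) : ℂ) = _
  rw [F.proj_rangeVec]
  rfl

end CyclicFrame

end Coordinates

/-! ### Channels with an invertible invariant state -/

section FaithfulChannel

open Matrix

theorem isCycleOn_finRotate (n : ℕ) : (finRotate n).IsCycleOn Set.univ := by
  match n with
  | 0 => exact Equiv.Perm.isCycleOn_of_subsingleton _ _
  | 1 => exact Equiv.Perm.isCycleOn_of_subsingleton _ _
  | n + 2 =>
    have h := (isCycle_finRotate (n := n)).isCycleOn
    convert h using 1
    ext x
    simp

theorem mem_attr_of_apply_eq {V : Type*} [AddCommGroup V] [Module ℂ V] {Φ : V →ₗ[ℂ] V} {μ : ℂ}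
    (hμ : ‖μ‖ = 1) {X : V} (hX : Φ X = μ • X) : X ∈ attr Φ := by
  by_cases hz : X = 0
  · rw [hz]
    exact Submodule.zero_mem _
  · have he := Module.End.mem_eigenspace_iff.mpr hX
    exact le_iSup₂ (f := fun ν (_ : ν ∈ peripheralSpectrum Φ) => Module.End.eigenspace Φ ν) μ
      ⟨Module.End.hasEigenvalue_of_hasEigenvector ⟨he, hz⟩, hμ⟩ he

/-- Reading off the matrix in an orthonormal basis, as a linear equivalence. -/
noncomputable def matEquiv {ι H : Type*} [Fintype ι] [DecidableEq ι] [NormedAddCommGroup H]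
    [InnerProductSpace ℂ H] [FiniteDimensional ℂ H] (b : OrthonormalBasis ι ℂ H) :
    Op H ≃ₗ[ℂ] Matrix ι ι ℂ :=
  LinearMap.toContinuousLinearMap.symm.trans (LinearMap.toMatrix b.toBasis b.toBasis)

theorem matEquiv_apply {ι H : Type*} [Fintype ι] [DecidableEq ι] [NormedAddCommGroup H]
    [InnerProductSpace ℂ H] [FiniteDimensional ℂ H] (b : OrthonormalBasis ι ℂ H) (X : Op H) :
    matEquiv b X = mat b X := rfl

/-- `X ↦ ⨁ X ℓ`, as a linear map. -/
def directSum {L : ℕ} {ι : Fin L → Type*} [∀ ℓ, DecidableEq (ι ℓ)] :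
    (∀ ℓ, Matrix (ι ℓ) (ι ℓ) ℂ) →ₗ[ℂ] Matrix (Σ ℓ, ι ℓ) (Σ ℓ, ι ℓ) ℂ where
  toFun := blockDiagonal'
  map_add' := blockDiagonal'_add
  map_smul' := blockDiagonal'_smul

theorem directSum_apply {L : ℕ} {ι : Fin L → Type*} [∀ ℓ, DecidableEq (ι ℓ)]
    (X : ∀ ℓ, Matrix (ι ℓ) (ι ℓ) ℂ) : directSum X = blockDiagonal' X := rfl

section CycleSpace

variable {m : ℕ} {n : Fin m → ℕ}

theorem hatState_smul (c : ℂ) (ρ : ∀ k, Matrix (Fin (n k)) (Fin (n k)) ℂ) (k : Fin m) :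
    hatState (fun k => c • ρ k) k = c • hatState ρ k := by
  rw [hatState, hatState, ← blockDiagonal'_smul]
  congr 1
  exact Pi.single_smul (f := fun j => Matrix (Fin (n j)) (Fin (n j)) ℂ) k c (ρ k)

theorem single_kronecker_hatState_mem (d : ℕ) (ρ : ∀ k, Matrix (Fin (n k)) (Fin (n k)) ℂ)
    (k : Fin m) (a b : Fin d) : Matrix.single a b 1 ⊗ₖ hatState ρ k ∈ cycleSpace d ρ :=
  Submodule.subset_span ⟨_, _, Submodule.subset_span ⟨k, rfl⟩, rfl⟩

/-- The matrix units tensored with the embedded states span the block. -/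
theorem cycleSpace_le_span (d : ℕ) (ρ : ∀ k, Matrix (Fin (n k)) (Fin (n k)) ℂ) :
    cycleSpace d ρ ≤ Submodule.span ℂ
      {X | ∃ (k : Fin m) (a b : Fin d), X = Matrix.single a b 1 ⊗ₖ hatState ρ k} := by
  refine Submodule.span_le.mpr ?_
  rintro _ ⟨A, R, hR, rfl⟩
  rw [SetLike.mem_coe]
  induction hR using Submodule.span_induction with
  | mem R h =>
    obtain ⟨k, rfl⟩ := h
    induction A using Matrix.induction_on' with
    | h_zero => rw [zero_kronecker]; exact Submodule.zero_mem _
    | h_add A B hA hB => rw [add_kronecker]; exact Submodule.add_mem _ hA hB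
    | h_std_basis a b c =>
      have h : Matrix.single a b c = c • Matrix.single a b (1 : ℂ) := by
        rw [Matrix.smul_single, smul_eq_mul, mul_one]
      rw [h, smul_kronecker]
      exact Submodule.smul_mem _ _ (Submodule.subset_span ⟨k, a, b, rfl⟩)
  | zero => rw [kronecker_zero]; exact Submodule.zero_mem _
  | add R S _ _ hR hS => rw [kronecker_add]; exact Submodule.add_mem _ hR hS
  | smul c R _ hR => rw [kronecker_smul]; exact Submodule.smul_mem _ _ hR

end CycleSpace

/-- The diagonal unitary with the given phases. -/
noncomputable def phaseUnitary {d : ℕ} (θ : Fin d → ℂ) (hθ : ∀ a, ‖θ a‖ = 1) :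
    Matrix.unitaryGroup (Fin d) ℂ :=
  ⟨diagonal θ, by
    rw [mem_unitaryGroup_iff, star_eq_conjTranspose, diagonal_conjTranspose, diagonal_mul_diagonal,
      ← diagonal_one]
    congr 1
    funext a
    exact mul_star_self_of_norm (hθ a)⟩

theorem unitaryChannel_phaseUnitary_single {d : ℕ} (θ : Fin d → ℂ) (hθ : ∀ a, ‖θ a‖ = 1)
    (a b : Fin d) : unitaryChannel (phaseUnitary θ hθ) (Matrix.single a b 1) =
      (θ a * star (θ b)) • Matrix.single a b 1 := by
  rw [unitaryChannel_apply]
  change diagonal θ * _ * (diagonal θ)ᴴ = _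
  rw [diagonal_conjTranspose]
  ext i j
  rw [mul_diagonal, diagonal_mul, Matrix.smul_apply, Matrix.single_apply]
  split_ifs with h
  · rw [← h.1, ← h.2]
    simp
  · simp

namespace CyclicFrame

variable {H : Type*} [NormedAddCommGroup H] [InnerProductSpace ℂ H] [CompleteSpace H]
  {κ : Type*}
variable {K : κ → Op H} {L : ℕ} {d m : Fin L → ℕ} (F : CyclicFrame K d m)

theorem trace_unit_mul [FiniteDimensional ℂ H] {τ : Op H}
    (hτ : ∀ x ∈ gradedAlgebra K, Commute x τ) (ℓ : Fin L) (k : Fin (m ℓ)) (a : Fin (d ℓ)) :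
    LinearMap.trace ℂ H ((F.unit ℓ k a a * τ : Op H) : H →ₗ[ℂ] H) = (F.gram τ ℓ k).trace := by
  have h : LinearMap.trace ℂ H ((F.unit ℓ k a a * τ : Op H) : H →ₗ[ℂ] H) =
      (mat F.basis (F.unit ℓ k a a * τ)).trace :=
    LinearMap.trace_eq_matrix_trace ℂ F.basis.toBasis _
  rw [h, F.mat_unit_mul hτ, trace_blockDiagonal', Finset.sum_eq_single ℓ]
  · rw [Pi.single_eq_same, trace_kronecker, trace_hatState, Matrix.trace_single_eq_same, one_mul]
  · intro j _ h
    rw [Pi.single_eq_of_ne h, trace_zero]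
  · simp

variable [Fintype κ]

theorem krausMap_unit_mul_of_fixed {τ : Op H} (hfix : krausMap K τ = τ) (ℓ : Fin L)
    (k : Fin (m ℓ)) (a b : Fin (d ℓ)) : krausMap K (F.unit ℓ (finRotate (m ℓ) k) a b * τ) =
      (F.phase ℓ a * star (F.phase ℓ b)) • (F.unit ℓ k a b * τ) := by
  rw [F.krausMap_unit_mul, hfix]

variable [FiniteDimensional ℂ H]

/-- Trace preservation makes the blocks along a cycle carry equal weights. -/
theorem trace_gram_eq (hK : ∑ i, star (K i) * K i = 1) {τ : Op H} (hfix : krausMap K τ = τ)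
    (hτ : ∀ x ∈ gradedAlgebra K, Commute x τ) (ℓ : Fin L) (k k' : Fin (m ℓ)) :
    (F.gram τ ℓ k).trace = (F.gram τ ℓ k').trace := by
  have step : ∀ l, (F.gram τ ℓ (finRotate (m ℓ) l)).trace = (F.gram τ ℓ l).trace := fun l => by
    have h := trace_krausMap K hK (F.unit ℓ (finRotate (m ℓ) l) ⟨0, F.d_pos ℓ⟩ ⟨0, F.d_pos ℓ⟩ * τ)
    rw [F.krausMap_unit_mul_of_fixed hfix, mul_star_self_of_norm (F.norm_phase ℓ _), one_smul,
      F.trace_unit_mul hτ, F.trace_unit_mul hτ] at h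
    exact h.symm
  obtain ⟨N, -, rfl⟩ := (isCycleOn_finRotate (m ℓ)).exists_pow_eq' Set.finite_univ
    (Set.mem_univ k) (Set.mem_univ k')
  clear * - step
  induction N with
  | zero => rfl
  | succ N ih => rw [ih, pow_succ', Equiv.Perm.mul_apply, step]

/-- The attractor subspace is spanned by the matrix units times the invariant state. -/
theorem attr_krausMap (hK : ∑ i, star (K i) * K i = 1) {τ : Op H} (h0 : 0 ≤ τ) (hu : IsUnit τ)
    (hfix : krausMap K τ = τ) :
    attr (krausMap K) = Submodule.span ℂ {X | ∃ ℓ k a b, X = F.unit ℓ k a b * τ} := by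
  apply le_antisymm
  · refine iSup₂_le fun μ hμ X hX => ?_
    obtain ⟨x, hx, rfl⟩ := exists_twisted_of_eigenvector hK h0 hu hfix hμ.2
      (Module.End.mem_eigenspace_iff.mp hX)
    have h1 : gradedAlgebra K ≤ (Submodule.span ℂ {X | ∃ ℓ k a b, X = F.unit ℓ k a b * τ}).comap
        (LinearMap.mulRight ℂ τ) := by
      refine F.gradedAlgebra_le_span.trans (Submodule.span_le.mpr ?_)
      rintro _ ⟨ℓ, k, a, b, rfl⟩
      exact Submodule.subset_span ⟨ℓ, k, a, b, rfl⟩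
    exact h1 (hx.mem_gradedAlgebra hμ.2)
  · have h1 : gradedAlgebra K ≤ (attr (krausMap K)).comap (LinearMap.mulRight ℂ τ) := by
      refine Submodule.span_le.mpr ?_
      rintro x ⟨μ, hμ, hx⟩
      rw [SetLike.mem_coe, Submodule.mem_comap, LinearMap.mulRight_apply]
      exact mem_attr_of_apply_eq hμ (by rw [hx.krausMap_mul, hfix])
    refine Submodule.span_le.mpr ?_
    rintro _ ⟨ℓ, k, a, b, rfl⟩
    exact h1 (F.unit_mem ℓ k a b)

end CyclicFrame

/-- The normal form when there is an invertible positive fixed point `σ`; there is then no transient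
part. The states `ρ ℓ k` are the corners `qₖ τ` of the ergodic mean `τ` of the identity, normalised
by their common trace, and the unitaries are the diagonal matrices of phases. -/
theorem exists_normal_form_of_isUnit {G : Type*} [NormedAddCommGroup G] [InnerProductSpace ℂ G]
    [CompleteSpace G] [FiniteDimensional ℂ G] {κ : Type*} [Fintype κ] {K : κ → Op G}
    (hK : ∑ i, star (K i) * K i = 1) {σ : Op G} (h0 : 0 ≤ σ) (hu : IsUnit σ)
    (hfix : krausMap K σ = σ) :
    ∃ (L : ℕ) (d m : Fin L → ℕ) (n : ∀ ℓ, Fin (m ℓ) → ℕ)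
      (b : OrthonormalBasis (Σ ℓ, Fin (d ℓ) × Σ k, Fin (n ℓ k)) ℂ G)
      (ρ : ∀ ℓ k, Matrix (Fin (n ℓ k)) (Fin (n ℓ k)) ℂ)
      (U : ∀ ℓ, Matrix.unitaryGroup (Fin (d ℓ)) ℂ) (π : ∀ ℓ, Equiv.Perm (Fin (m ℓ))),
      (∀ ℓ, 0 < d ℓ ∧ 0 < m ℓ) ∧ (∀ ℓ k, IsFaithfulState (ρ ℓ k)) ∧
      (∀ ℓ, (π ℓ).IsCycleOn Set.univ) ∧
      (∀ X : Op G, X ∈ attr (krausMap K) ↔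
        ∃ X₀ : ∀ ℓ, Matrix (Fin (d ℓ) × Σ k, Fin (n ℓ k)) (Fin (d ℓ) × Σ k, Fin (n ℓ k)) ℂ,
          (∀ ℓ, X₀ ℓ ∈ cycleSpace (d ℓ) (ρ ℓ)) ∧ mat b X = blockDiagonal' X₀) ∧
      (∀ (X : Op G)
        (X₀ : ∀ ℓ, Matrix (Fin (d ℓ) × Σ k, Fin (n ℓ k)) (Fin (d ℓ) × Σ k, Fin (n ℓ k)) ℂ),
        (∀ ℓ, X₀ ℓ ∈ cycleSpace (d ℓ) (ρ ℓ)) → mat b X = blockDiagonal' X₀ →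
        mat b (krausMap K X) = blockDiagonal' fun ℓ =>
          tensorMap (unitaryChannel (U ℓ)) (permChannel (ρ ℓ) (π ℓ)) (X₀ ℓ)) := by
  obtain ⟨L, d, m, ⟨F⟩⟩ := exists_cyclicFrame hK
  set τ : Op G := eigenprojection (krausMap K) 1 1 with hτ
  have hτ0 : 0 ≤ τ := eigenprojection_nonneg K hK zero_le_one
  have hτu : IsUnit τ := isUnit_eigenprojection_one hK h0 hu hfix
  have hτf : krausMap K τ = τ := krausMap_eigenprojection hK 1
  have hτc : ∀ x ∈ gradedAlgebra K, Commute x τ := fun x hx => commute_of_mem_gradedAlgebra hK hx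
  have hpd := F.gram_posDef hτ0 hτu
  let c : Fin L → ℂ := fun ℓ => (F.gram τ ℓ ⟨0, F.m_pos ℓ⟩).trace
  have hc : ∀ ℓ k, (F.gram τ ℓ k).trace = c ℓ := fun ℓ k => F.trace_gram_eq hK hτf hτc ℓ _ _
  have hcpos : ∀ ℓ, 0 < c ℓ := fun ℓ => by
    have : Nonempty (Fin (F.rank ℓ ⟨0, F.m_pos ℓ⟩)) := ⟨⟨0, F.rank_pos ℓ _⟩⟩
    exact (hpd ℓ _).trace_pos
  let ρ : ∀ ℓ k, Matrix (Fin (F.rank ℓ k)) (Fin (F.rank ℓ k)) ℂ := fun ℓ k =>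
    (c ℓ)⁻¹ • F.gram τ ℓ k
  have hρ : ∀ ℓ k, IsFaithfulState (ρ ℓ k) := fun ℓ k =>
    ⟨(hpd ℓ k).smul (inv_pos.mpr (hcpos ℓ)), by
      rw [trace_smul, hc, smul_eq_mul, inv_mul_cancel₀ (hcpos ℓ).ne']⟩
  have hmat : ∀ ℓ k a b, matEquiv F.basis ((c ℓ)⁻¹ • (F.unit ℓ k a b * τ)) =
      directSum (Pi.single ℓ (Matrix.single a b 1 ⊗ₖ hatState (ρ ℓ) k)) := fun ℓ k a b => by
    rw [map_smul, matEquiv_apply, F.mat_unit_mul hτc, ← directSum_apply, ← map_smul,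
      ← Pi.single_smul, ← kronecker_smul, ← hatState_smul]
  have hattr := F.attr_krausMap hK hτ0 hτu hτf
  have hsum : ∀ X₀ : ∀ ℓ, Matrix (Fin (d ℓ) × Σ k, Fin (F.rank ℓ k))
      (Fin (d ℓ) × Σ k, Fin (F.rank ℓ k)) ℂ, X₀ = ∑ ℓ, LinearMap.single ℂ _ ℓ (X₀ ℓ) :=
    fun X₀ => (Finset.univ_sum_single X₀).symm
  let U : ∀ ℓ, Matrix.unitaryGroup (Fin (d ℓ)) ℂ := fun ℓ =>
    phaseUnitary (F.phase ℓ) (F.norm_phase ℓ)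
  refine ⟨L, d, m, F.rank, F.basis, ρ, U, fun ℓ => finRotate (m ℓ),
    fun ℓ => ⟨F.d_pos ℓ, F.m_pos ℓ⟩, hρ, fun ℓ => isCycleOn_finRotate (m ℓ), fun X => ?_,
    fun X X₀ hX₀ hX => ?_⟩
  · constructor
    · intro hX
      rw [hattr] at hX
      have h1 : Submodule.span ℂ {X | ∃ ℓ k a b, X = F.unit ℓ k a b * τ} ≤
          ((Submodule.pi Set.univ fun ℓ => cycleSpace (d ℓ) (ρ ℓ)).map directSum).comap
            (matEquiv F.basis : Op G →ₗ[ℂ] _) := by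
        refine Submodule.span_le.mpr ?_
        rintro _ ⟨ℓ, k, a, b, rfl⟩
        rw [SetLike.mem_coe, Submodule.mem_comap]
        have h2 : F.unit ℓ k a b * τ = c ℓ • ((c ℓ)⁻¹ • (F.unit ℓ k a b * τ)) := by
          rw [smul_smul, mul_inv_cancel₀ (hcpos ℓ).ne', one_smul]
        rw [h2, map_smul]
        refine Submodule.smul_mem _ _ ⟨Pi.single ℓ (Matrix.single a b 1 ⊗ₖ hatState (ρ ℓ) k),
          ?_, (hmat ℓ k a b).symm⟩
        intro ℓ' _
        by_cases h : ℓ' = ℓ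
        · subst h
          rw [Pi.single_eq_same]
          exact single_kronecker_hatState_mem _ _ k a b
        · rw [Pi.single_eq_of_ne h]
          exact Submodule.zero_mem _
      obtain ⟨X₀, hX₀, h⟩ := h1 hX
      exact ⟨X₀, fun ℓ => hX₀ ℓ (Set.mem_univ ℓ), h.symm⟩
    · rintro ⟨X₀, hX₀, h⟩
      have h1 : ∀ ℓ, cycleSpace (d ℓ) (ρ ℓ) ≤ (attr (krausMap K)).comap
          ((matEquiv F.basis).symm.toLinearMap ∘ₗ directSum ∘ₗ LinearMap.single ℂ _ ℓ) := by
        intro ℓ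
        refine (cycleSpace_le_span (d ℓ) (ρ ℓ)).trans (Submodule.span_le.mpr ?_)
        rintro _ ⟨k, a, b, rfl⟩
        change (matEquiv F.basis).symm (directSum (Pi.single ℓ _)) ∈ attr (krausMap K)
        rw [← hmat, LinearEquiv.symm_apply_apply, hattr]
        exact Submodule.smul_mem _ _ (Submodule.subset_span ⟨ℓ, k, a, b, rfl⟩)
      have h2 : X = ∑ ℓ, (matEquiv F.basis).symm (directSum (LinearMap.single ℂ _ ℓ (X₀ ℓ))) := by
        rw [← map_sum, ← map_sum, ← hsum, LinearEquiv.eq_symm_apply]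
        exact h
      rw [h2]
      exact Submodule.sum_mem _ fun ℓ _ => h1 ℓ (hX₀ ℓ)
  · have h1 : ∀ ℓ, Set.EqOn
        ((matEquiv F.basis).toLinearMap ∘ₗ krausMap K ∘ₗ (matEquiv F.basis).symm.toLinearMap ∘ₗ
          directSum ∘ₗ LinearMap.single ℂ _ ℓ)
        (directSum ∘ₗ LinearMap.single ℂ _ ℓ ∘ₗ
          tensorMap (unitaryChannel (U ℓ)) (permChannel (ρ ℓ) (finRotate (m ℓ))))
        (cycleSpace (d ℓ) (ρ ℓ)) := by
      intro ℓ
      refine Set.EqOn.mono (cycleSpace_le_span (d ℓ) (ρ ℓ)) (LinearMap.eqOn_span ?_)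
      rintro _ ⟨k, a, b, rfl⟩
      obtain ⟨k, rfl⟩ := (finRotate (m ℓ)).surjective k
      change matEquiv F.basis (krausMap K ((matEquiv F.basis).symm (directSum (Pi.single ℓ _)))) =
        directSum (Pi.single ℓ (tensorMap _ _ _))
      rw [← hmat, LinearEquiv.symm_apply_apply, map_smul, F.krausMap_unit_mul_of_fixed hτf,
        smul_comm, map_smul, hmat, tensorMap_kronecker, permChannel_hatState _ fun k => (hρ ℓ k).2,
        unitaryChannel_phaseUnitary_single, smul_kronecker, Pi.single_smul, map_smul]
    have h2 : X = ∑ ℓ, (matEquiv F.basis).symm (directSum (LinearMap.single ℂ _ ℓ (X₀ ℓ))) := by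
      rw [← map_sum, ← map_sum, ← hsum, LinearEquiv.eq_symm_apply]
      exact hX
    rw [← matEquiv_apply, h2, map_sum, map_sum, ← directSum_apply,
      hsum fun ℓ => tensorMap (unitaryChannel (U ℓ)) (permChannel (ρ ℓ) (finRotate (m ℓ))) (X₀ ℓ),
      map_sum]
    exact Finset.sum_congr rfl fun ℓ _ => h1 ℓ (hX₀ ℓ)

end FaithfulChannel

/-! ### Reduction to the recurrent space -/

section Recurrent

variable {H : Type*} [NormedAddCommGroup H] [InnerProductSpace ℂ H] [FiniteDimensional ℂ H]

/-- Extension by zero: `Y ↦ ι Y ι†`, with `ι` the inclusion of a subspace. -/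
noncomputable def extend (G : Submodule ℂ H) : Op G →ₗ[ℂ] Op H where
  toFun Y := G.subtypeL ∘L Y ∘L G.orthogonalProjectionOnto
  map_add' Y Z := by ext; simp
  map_smul' c Y := by ext; simp

theorem extend_apply (G : Submodule ℂ H) (Y : Op G) (v : H) :
    extend G Y v = Y (G.orthogonalProjectionOnto v) := rfl

/-- Compression `X ↦ ι† X ι` to a subspace, with `ι` its inclusion. -/
noncomputable def compress (G : Submodule ℂ H) (X : Op H) : Op G :=
  G.orthogonalProjectionOnto ∘L X ∘L G.subtypeL

theorem compress_apply (G : Submodule ℂ H) (X : Op H) (v : G) :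
    compress G X v = G.orthogonalProjectionOnto (X v) := rfl

theorem compress_extend (G : Submodule ℂ H) (Y : Op G) : compress G (extend G Y) = Y := by
  ext v
  simp [compress_apply, extend_apply]

theorem extend_injective (G : Submodule ℂ H) : Function.Injective (extend G) :=
  Function.LeftInverse.injective (compress_extend G)

theorem extend_compress (G : Submodule ℂ H) {X : Op H} (h1 : ∀ v, X v ∈ G)
    (h2 : ∀ v ∈ Gᗮ, X v = 0) : extend G (compress G X) = X := by
  ext v
  rw [extend_apply, compress_apply, Submodule.coe_orthogonalProjectionOnto_apply,
    Submodule.starProjection_eq_self_iff.mpr (h1 _)]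
  have h := h2 _ (G.sub_starProjection_mem_orthogonal v)
  rw [map_sub, sub_eq_zero] at h
  exact h.symm

/-- The matrix of `ι Y ι†` in a basis adapted to `H = Gᗮ ⊕ G`. -/
theorem mat_extend {G : Submodule ℂ H} {ι₀ ι : Type*} [Fintype ι₀] [DecidableEq ι₀] [Fintype ι]
    [DecidableEq ι] (b : OrthonormalBasis (ι₀ ⊕ ι) ℂ H) (bG : OrthonormalBasis ι ℂ G)
    (h1 : ∀ i, b (Sum.inl i) ∈ Gᗮ) (h2 : ∀ i, b (Sum.inr i) = bG i) (Y : Op G) :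
    mat b (extend G Y) = Matrix.fromBlocks 0 0 0 (mat bG Y) := by
  have h3 : ∀ i (w : G), inner ℂ (b (Sum.inl i)) (w : H) = (0 : ℂ) := fun i w =>
    (Submodule.mem_orthogonal' G _).mp (h1 i) w w.2
  have h4 : ∀ i, G.orthogonalProjectionOnto (b (Sum.inl i)) = 0 := fun i =>
    Submodule.orthogonalProjectionOnto_eq_zero_iff.mpr (h1 i)
  ext (i | i) (j | j)
  · rw [mat_apply, extend_apply, h3, Matrix.fromBlocks_apply₁₁, Matrix.zero_apply]
  · rw [mat_apply, extend_apply, h3, Matrix.fromBlocks_apply₁₂, Matrix.zero_apply]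
  · rw [mat_apply, extend_apply, h4, map_zero, Matrix.fromBlocks_apply₂₁, Matrix.zero_apply]
    simp
  · rw [mat_apply, extend_apply, Matrix.fromBlocks_apply₂₂, mat_apply, h2, h2,
      Submodule.orthogonalProjectionOnto_mem_subspace_eq_self, Submodule.coe_inner]

/-- Any orthonormal basis of `G` extends to one of `H = Gᗮ ⊕ G`. -/
theorem exists_adapted_basis (G : Submodule ℂ H) {ι : Type*} [Fintype ι]
    (bG : OrthonormalBasis ι ℂ G) :
    ∃ b : OrthonormalBasis (Fin (Module.finrank ℂ Gᗮ) ⊕ ι) ℂ H,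
      (∀ i, b (Sum.inl i) ∈ Gᗮ) ∧ (∀ i, b (Sum.inr i) = bG i) ∧
      Submodule.span ℂ (Set.range fun i => b (Sum.inl i)) = Gᗮ := by
  set b₀ := stdOrthonormalBasis ℂ Gᗮ
  let v : Fin (Module.finrank ℂ Gᗮ) ⊕ ι → H := Sum.elim (fun i => b₀ i) fun i => bG i
  have hv : Orthonormal ℂ v := by
    have h0 : Orthonormal ℂ fun i => (b₀ i : H) := b₀.orthonormal.comp_linearIsometry Gᗮ.subtypeₗᵢ
    have hG : Orthonormal ℂ fun i => (bG i : H) := bG.orthonormal.comp_linearIsometry G.subtypeₗᵢ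
    refine ⟨?_, ?_⟩
    · rintro (i | i)
      · exact h0.1 i
      · exact hG.1 i
    · rintro (i | i) (j | j) hij
      · exact h0.2 fun e => hij (by rw [e])
      · exact (Submodule.mem_orthogonal' G _).mp (b₀ i).2 _ (bG j).2
      · exact (Submodule.mem_orthogonal G _).mp (b₀ j).2 _ (bG i).2
      · exact hG.2 fun e => hij (by rw [e])
  have hs : ⊤ ≤ Submodule.span ℂ (Set.range v) := by
    rw [Set.Sum.elim_range, Submodule.span_union, span_range_coe, span_range_coe, sup_comm,
      Submodule.sup_orthogonal_of_hasOrthogonalProjection]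
  refine ⟨OrthonormalBasis.mk hv hs, fun i => ?_, fun i => ?_, ?_⟩
  · rw [OrthonormalBasis.coe_mk]
    exact (b₀ i).2
  · rw [OrthonormalBasis.coe_mk]
    rfl
  · rw [OrthonormalBasis.coe_mk]
    exact span_range_coe b₀

theorem compress_mul_of_invariant {G : Submodule ℂ H} {A : Op H} (hA : ∀ v ∈ G, A v ∈ G)
    (B : Op H) :
    compress G (B * A) = compress G B * compress G A := by
  ext v
  change _ = ((compress G B (compress G A v) : G) : H)
  simp only [compress_apply, Submodule.coe_orthogonalProjectionOnto_apply]
  rw [Submodule.starProjection_eq_self_iff.mpr (hA v v.2)]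
  rfl

section Invariant

variable [CompleteSpace H] {κ : Type*} [Fintype κ] {K : κ → Op H} {G : Submodule ℂ H}

theorem star_compress (X : Op H) : star (compress G X) = compress G (star X) := by
  rw [ContinuousLinearMap.star_eq_adjoint, ContinuousLinearMap.star_eq_adjoint]
  refine (ContinuousLinearMap.eq_adjoint_iff _ _).mpr (fun v w => ?_) |>.symm
  rw [compress_apply, compress_apply, Submodule.inner_orthogonalProjectionOnto_eq_of_mem_right,
    Submodule.inner_orthogonalProjectionOnto_eq_of_mem_left]
  exact ContinuousLinearMap.adjoint_inner_left X _ _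

/-- The compressed Kraus operators are again those of a channel. -/
theorem sum_compress (hK : ∑ i, star (K i) * K i = 1) (hG : ∀ i, ∀ v ∈ G, K i v ∈ G) :
    ∑ i, star (compress G (K i)) * compress G (K i) = 1 := by
  simp only [star_compress]
  simp only [← compress_mul_of_invariant (hG _)]
  have h : compress G (∑ i, star (K i) * K i) = ∑ i, compress G (star (K i) * K i) := by
    ext v
    simp [compress_apply]
  rw [← h, hK]
  ext v
  simp [compress_apply]

/-- On an invariant subspace the channel restricts to the channel of the compressed Kraus
operators. -/
theorem krausMap_extend (hG : ∀ i, ∀ v ∈ G, K i v ∈ G) (Y : Op G) :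
    krausMap K (extend G Y) = extend G (krausMap (fun i => compress G (K i)) Y) := by
  have h1 : ∀ i v, G.orthogonalProjectionOnto (star (K i) v) =
      star (compress G (K i)) (G.orthogonalProjectionOnto v) := by
    intro i v
    refine ext_inner_left ℂ fun w => ?_
    rw [ContinuousLinearMap.star_eq_adjoint, ContinuousLinearMap.star_eq_adjoint,
      ContinuousLinearMap.adjoint_inner_right,
      Submodule.inner_orthogonalProjectionOnto_eq_of_mem_left,
      Submodule.inner_orthogonalProjectionOnto_eq_of_mem_left,
      ContinuousLinearMap.adjoint_inner_right, compress_apply,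
      Submodule.coe_orthogonalProjectionOnto_apply,
      Submodule.starProjection_eq_self_iff.mpr (hG i w w.2)]
  ext v
  rw [extend_apply, krausMap_apply, krausMap_apply, sum_apply, sum_apply,
    AddSubmonoidClass.coe_finsetSum]
  refine Finset.sum_congr rfl fun i _ => ?_
  change K i (Y (G.orthogonalProjectionOnto (star (K i) v))) =
    (compress G (K i) (Y (star (compress G (K i)) (G.orthogonalProjectionOnto v))) : G)
  rw [h1, compress_apply, Submodule.coe_orthogonalProjectionOnto_apply,
    Submodule.starProjection_eq_self_iff.mpr (hG i _ (Submodule.coe_mem _))]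

/-- If every peripheral eigenvector lives on an invariant subspace, the attractor subspace is that
of the compressed channel. -/
theorem attr_eq_map_extend (hG : ∀ i, ∀ v ∈ G, K i v ∈ G)
    (hX : ∀ (μ : ℂ) (X : Op H), ‖μ‖ = 1 → krausMap K X = μ • X → extend G (compress G X) = X) :
    attr (krausMap K) = (attr (krausMap fun i => compress G (K i))).map (extend G) := by
  apply le_antisymm
  · refine iSup₂_le fun μ hμ X h => ?_
    have h1 := Module.End.mem_eigenspace_iff.mp h
    have h2 := hX μ X hμ.2 h1
    refine ⟨compress G X, mem_attr_of_apply_eq hμ.2 (extend_injective G ?_), h2⟩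
    rw [← krausMap_extend hG, h2, h1, map_smul, h2]
  · rw [Submodule.map_le_iff_le_comap]
    refine iSup₂_le fun μ hμ Y h => ?_
    refine mem_attr_of_apply_eq hμ.2 ?_
    rw [krausMap_extend hG, Module.End.mem_eigenspace_iff.mp h, map_smul]

end Invariant

end Recurrent

section Support

variable {H : Type*} [NormedAddCommGroup H] [InnerProductSpace ℂ H] [CompleteSpace H] {σ : Op H}

theorem mem_orthogonal_range_iff (hσ : 0 ≤ σ) (v : H) :
    v ∈ (LinearMap.range (σ : H →ₗ[ℂ] H))ᗮ ↔ σ v = 0 := by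
  have hsa : ∀ x y, inner ℂ (σ x) y = (inner ℂ x (σ y) : ℂ) := fun x y => by
    conv_lhs => rw [← (IsSelfAdjoint.of_nonneg hσ).star_eq, ContinuousLinearMap.star_eq_adjoint]
    exact ContinuousLinearMap.adjoint_inner_left σ y x
  rw [Submodule.mem_orthogonal]
  constructor
  · intro h
    refine ext_inner_left ℂ fun w => ?_
    rw [inner_zero_right, ← hsa]
    exact h _ ⟨w, rfl⟩
  · rintro h _ ⟨w, rfl⟩
    change (inner ℂ (σ w) v : ℂ) = 0
    rw [hsa, h, inner_zero_right]

/-- The range of a positive fixed point is invariant under the Kraus operators: if `σ u = 0` then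
`0 = ⟨u, σ u⟩ = ∑ ⟨Kᵢ† u, σ Kᵢ† u⟩`, so the `Kᵢ†` preserve the kernel of `σ`. -/
theorem kraus_mem_range [FiniteDimensional ℂ H] {κ : Type*} [Fintype κ] {K : κ → Op H} (hσ : 0 ≤ σ)
    (hfix : krausMap K σ = σ) (i : κ) (v : H) (hv : v ∈ LinearMap.range (σ : H →ₗ[ℂ] H)) :
    K i v ∈ LinearMap.range (σ : H →ₗ[ℂ] H) := by
  rw [← Submodule.orthogonal_orthogonal (LinearMap.range (σ : H →ₗ[ℂ] H)), Submodule.mem_orthogonal]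
  intro u hu
  have h0 := (mem_orthogonal_range_iff hσ u).mp hu
  have h1 : ∑ j, (inner ℂ (star (K j) u) (σ (star (K j) u)) : ℂ).re = 0 := by
    rw [← Complex.re_sum, ← inner_krausMap, hfix, h0, inner_zero_right, Complex.zero_re]
  have h2 := (Finset.sum_eq_zero_iff_of_nonneg fun j _ => re_inner_nonneg hσ _).mp h1 i
    (Finset.mem_univ i)
  have h3 := (mem_orthogonal_range_iff hσ _).mpr (apply_eq_zero_of_nonneg hσ h2.le)
  rw [ContinuousLinearMap.star_eq_adjoint] at h3
  rw [← ContinuousLinearMap.adjoint_inner_left]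
  exact (Submodule.mem_orthogonal' _ _).mp h3 v hv

end Support

end QChannel

theorem theorem3p1 {H : Type*} [NormedAddCommGroup H] [InnerProductSpace ℂ H] [CompleteSpace H]
    [FiniteDimensional ℂ H] (Φ : QChannel.Op H →ₗ[ℂ] QChannel.Op H)
    (hΦ : QChannel.IsQuantumChannel Φ) :
    ∃ (L d₀ : ℕ) (d m : Fin L → ℕ) (n : ∀ ℓ, Fin (m ℓ) → ℕ)
      (b : OrthonormalBasis (QChannel.Label d₀ d m n) ℂ H)
      (ρ : ∀ ℓ k, Matrix (Fin (n ℓ k)) (Fin (n ℓ k)) ℂ)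
      (U : ∀ ℓ, Matrix.unitaryGroup (Fin (d ℓ)) ℂ)
      (π : ∀ ℓ, Equiv.Perm (Fin (m ℓ))),
      -- no block is trivial, each `ρ ℓ k` is a positive definite density matrix,
      -- and each `π ℓ` is an `m ℓ`-cycle
      (∀ ℓ, 0 < d ℓ ∧ 0 < m ℓ) ∧
      (∀ ℓ k, QChannel.IsFaithfulState (ρ ℓ k)) ∧
      (∀ ℓ, (π ℓ).IsCycleOn Set.univ) ∧
      -- the first summand of the decomposition of `H` is the orthogonal complement of `H₀`
      Submodule.span ℂ (Set.range fun i : Fin d₀ => b (Sum.inl i)) =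
        (QChannel.recurrentSpace Φ)ᗮ ∧
      -- the attractor subspace
      (∀ X : QChannel.Op H, X ∈ QChannel.attr Φ ↔
        ∃ X₀ : ∀ ℓ, Matrix (Fin (d ℓ) × Σ k, Fin (n ℓ k)) (Fin (d ℓ) × Σ k, Fin (n ℓ k)) ℂ,
          (∀ ℓ, X₀ ℓ ∈ QChannel.cycleSpace (d ℓ) (ρ ℓ)) ∧
          QChannel.mat b X = QChannel.zeroPlus d₀ X₀) ∧
      -- the asymptotic map
      (∀ (X : QChannel.attr Φ)
        (X₀ : ∀ ℓ, Matrix (Fin (d ℓ) × Σ k, Fin (n ℓ k)) (Fin (d ℓ) × Σ k, Fin (n ℓ k)) ℂ),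
        QChannel.mat b (X : QChannel.Op H) = QChannel.zeroPlus d₀ X₀ →
        QChannel.mat b (QChannel.asymptoticMap Φ X : QChannel.Op H) =
          QChannel.zeroPlus d₀ fun ℓ =>
            QChannel.tensorMap (QChannel.unitaryChannel (U ℓ))
              (QChannel.permChannel (ρ ℓ) (π ℓ)) (X₀ ℓ)) ∧
      -- the two tensor factors are channels, and the second one cyclically permutes the states
      (∀ ℓ, QChannel.IsQuantumChannel (QChannel.onOperators (QChannel.unitaryChannel (U ℓ)))) ∧
      (∀ ℓ, QChannel.IsQuantumChannel
        (QChannel.onOperators (QChannel.permChannel (ρ ℓ) (π ℓ)))) ∧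
      (∀ ℓ k, QChannel.permChannel (ρ ℓ) (π ℓ) (QChannel.hatState (ρ ℓ) (π ℓ k)) =
        QChannel.hatState (ρ ℓ) k) := by
  open QChannel in
  obtain ⟨κ, _, K, rfl, hK⟩ := hΦ.exists_krausMap
  set σ : Op H := eigenprojection (krausMap K) 1 1 with hσ
  have hσ0 : 0 ≤ σ := eigenprojection_nonneg K hK zero_le_one
  have hσf : krausMap K σ = σ := krausMap_eigenprojection hK 1
  set G : Submodule ℂ H := recurrentSpace (krausMap K) with hG
  have hker : ∀ v, v ∈ Gᗮ ↔ σ v = 0 := mem_orthogonal_range_iff hσ0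
  have hinv : ∀ i, ∀ v ∈ G, K i v ∈ G := kraus_mem_range hσ0 hσf
  -- Peripheral eigenvectors are dominated by a multiple of `σ`, so they live on its support `G`.
  have hper : ∀ (μ : ℂ) (X : Op H), ‖μ‖ = 1 → krausMap K X = μ • X →
      extend G (compress G X) = X := by
    intro μ X hμ hX
    have hdom := dominated_eigenprojection K hK hμ hX
    have h0 : ∀ v ∈ Gᗮ, ((‖X‖ : ℂ) • σ) v = 0 := fun v hv => by
      rw [smul_apply, (hker v).mp hv, smul_zero]
    refine extend_compress G (fun w => ?_) fun v hv => ?_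
    · rw [← Submodule.orthogonal_orthogonal G, Submodule.mem_orthogonal]
      exact fun v hv => hdom.inner_eq_zero_left (h0 v hv) w
    · refine ext_inner_left ℂ fun w => ?_
      rw [hdom.inner_eq_zero_right (h0 v hv), inner_zero_right]
  have hattr := attr_eq_map_extend hinv hper
  have hK₀ := sum_compress hK hinv
  have hσe : extend G (compress G σ) = σ :=
    hper 1 σ norm_one (by rw [hσf, one_smul])
  have hσ₀f : krausMap (fun i => compress G (K i)) (compress G σ) = compress G σ :=
    extend_injective G (by rw [← krausMap_extend hinv, hσe, hσf])
  have hσ₀0 : 0 ≤ compress G σ := by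
    have h := ((ContinuousLinearMap.nonneg_iff_isPositive σ).mp hσ0).orthogonalProjectionOnto_comp G
    exact (ContinuousLinearMap.nonneg_iff_isPositive _).mpr h
  have hσ₀u : IsUnit (compress G σ) := by
    refine isUnit_of_ker fun v hv => ?_
    have h1 : σ v = 0 := by
      rw [← hσe, extend_apply, Submodule.orthogonalProjectionOnto_mem_subspace_eq_self, hv,
        Submodule.coe_zero]
    have h2 := (Submodule.mem_orthogonal G _).mp ((hker v).mpr h1) v v.2
    exact Subtype.ext (inner_self_eq_zero.mp h2)
  obtain ⟨L, d, m, n, bG, ρ, U, π, hpos, hρ, hπ, hA, hT⟩ :=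
    exists_normal_form_of_isUnit hK₀ hσ₀0 hσ₀u hσ₀f
  obtain ⟨b, hb0, hbG, hspan⟩ := exists_adapted_basis G bG
  have hmat := mat_extend b bG hb0 hbG
  refine ⟨L, _, d, m, n, b, ρ, U, π, hpos, hρ, hπ, hspan, fun X => ?_, fun X X₀ hX => ?_,
    fun ℓ => isQuantumChannel_unitaryChannel _, fun ℓ => isQuantumChannel_permChannel _ (hρ ℓ) _,
    fun ℓ k => permChannel_hatState _ (fun k => (hρ ℓ k).2) _ k⟩
  · rw [hattr]
    constructor
    · rintro ⟨Y, hY, rfl⟩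
      obtain ⟨X₀, hX₀, h⟩ := (hA Y).mp hY
      exact ⟨X₀, hX₀, by rw [hmat, h, zeroPlus]⟩
    · rintro ⟨X₀, hX₀, h⟩
      refine ⟨(matEquiv bG).symm (Matrix.blockDiagonal' X₀), (hA _).mpr ⟨X₀, hX₀, ?_⟩, ?_⟩
      · exact (matEquiv bG).apply_symm_apply _
      · apply (matEquiv b).injective
        rw [matEquiv_apply, matEquiv_apply, hmat, h, zeroPlus, ← matEquiv_apply,
          LinearEquiv.apply_symm_apply]
  · obtain ⟨Y, hY, hYX⟩ := hattr.le X.2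
    obtain ⟨X₁, hX₁, h⟩ := (hA Y).mp hY
    -- The blocks of `X` are unique, so the given ones are those of an element of `Attr`.
    have h01 : X₁ = X₀ := by
      rw [← hYX, hmat, h, zeroPlus] at hX
      exact Matrix.blockDiagonal'_injective (Matrix.fromBlocks_inj.mp hX).2.2.2
    subst h01
    change mat b (krausMap K X) = _
    rw [← hYX, krausMap_extend hinv, hmat, hT Y X₁ hX₁ h, zeroPlus]
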